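/- **Setting.** Let $S$ be a string of length $|S|\ge 2$ over an alphabet of $\sigma$ symbols, $\lg=\log_2$, $\lg^{(1)}u=\lg u$, $\lg^{(i+1)}u=\lg\lg^{(i)}u$, $\lg^*u=\min\{i\ge 1:\lg^{(i)}u\le 1\}$, $K=\lg^*|S|$, and $\alpha\in(0,1]$. *Parsing.* Symbols are natural numbers: the terminals $0,\dots,\sigma-1$ and the variables $\sigma,\sigma+1,\dots$. Starting with $S$, a string of length at least two is divided into blocks, and each block is replaced by one symbol: a pair $xy$ by the variable $z$ with rule $z\to xy$, a trigram $xyw$ by $z$ with rules $z\to xy'$, $y'\to yw$ (equal right-hand sides give equal variables). This is iterated until one symbol is left. Blocks follow edit-sensitive parsing (ESP): boundaries are placed at both ends of every maximal repetition $a^k$, $k\ge 2$ (type 1), and, in repetition-free substrings longer than $2K$ (type 2), before every landmark, i.e. every position with at least $2K$ symbols of left context in the substring whose label after $K$ rounds of alphabet reduction is a strict local maximum; other substrings (type 3) get no inner boundary. One round of alphabet reduction replaces the label $b$ of a position, whose left neighbour has label $a$, by $2\ell+b_\ell$, where $\ell$ is the lowest bit position in which $a$ and $b$ differ and $b_\ell$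 is that bit of $b$. Between successive boundaries the string is parsed left-aligned into pairs, with a final trigram if the number of symbols is odd; a boundary right after the first symbol of a block has no effect. Since a variable is created as soon as the last symbol of its block has arrived, a boundary after position $e$, which is known once symbol $e+2$ has been read, takes effect after position $e+3$. A single symbol left over at the end of a level is passed on unchanged. Variables are numbered in the order of their creation, which is the post-order of the post-order partial parse tree (POPPT), i.e. of the parse tree in which every repeated occurrence of a variable is made a leaf. Let $n$ be the number of variables. *OESP-index of $S$.* It consists of: the bit string $B$ of the POPPT in post-order ($0$ for a leaf, $1$ for an internal node, and a final $1$ for a virtual node) with a range minimum tree over its excess; the sequence $L$ of leaf labels in a pointer-based dynamic wavelet tree; the array $R$ of the lengths of the strings derived from the variables; and a chaining hash table for the reverse dictionary $(x,y)\mapsto z$ of the rules $z\to xy$, with $\max(1,\lceil\alpha n\rceil)$ entries (growing one entry at a time by splitting one list) and the hash function $(x,y)\mapsto a_1x+a_2y+b \bmod p$, where $p$ is a prime with $|S|+\sigma<p\le(|S|+\sigma)^2$ and $a_1,a_2,b\in\{0,\dots,p-1\}$ are independent and uniformly random. The machine is a word RAM with words of $O(\lg p)$ bits and extensible arrays whose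 cells are as wide as their largest entry. The numbers $K$ and $p$ are given in advance. *Online construction.* The symbols of $S$ are read one by one. An update for an input symbol puts it into a queue and performs a fixed number of steps of the parsing (a step being the arrival of one symbol at one level, the search for one digram in the hash table, the addition of one leaf, or the creation of one variable); at the end of the input the remaining work is done and all levels are closed. **Theorem.** There is an absolute constant $C$ such that for all $\sigma$, $S$, $\alpha$, $p$ as above: 1. for every choice of the hash function and every $1\le t\le|S|$, the construction with input $S[1,t]$ (and the parameter $K=\lg^*|S|$) ends with the OESP-index of $S[1,t]$, and the number of variables at any time does not depend on the hash function; 2. the OESP-index of $S$ takes at most $n\lg|S|+C(n+\sigma)\lg(n+\sigma)$ bits; 3. the working memory during the whole construction is at most $n\lg|S|+C(n+\sigma)\lg(n+\sigma)$ bits; 4. the expected construction time is at most $C\cdot\frac1\alpha|S|\lg(n+\sigma)\lg^*|S|$; 5. for every $t<|S|$, the expected time of the update for the $(t+1)$-st input symbol is at most $C\cdot\frac1\alpha\lg(\nu_t+\sigma)\lg^*|S|$, where $\nu_t$ is the number of variables after the updates for the first $t$ symbols, provided that $\nu_t+\sigma\ge 2$. -/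

import Mathlib

open scoped BigOperators

namespace Oesp

/-! # Logarithms -/

/-- The iterated logarithm `lg* u = min {i ≥ 1 | lg⁽ⁱ⁾ u ≤ 1}`, where `lg = log₂`. -/
noncomputable def lgStar (u : ℕ) : ℕ :=
  sInf {i : ℕ | 1 ≤ i ∧ (Real.logb 2)^[i] (u : ℝ) ≤ 1}

/-! # Edit-sensitive parsing of one level

A string is given by its symbols `s 0, s 1, …`; a symbol is a natural number (terminals are
`0, …, σ - 1`, variables are `σ, σ + 1, …`).  `K` stands for `lg* |S|`. -/

/-- Position of the lowest set bit (`0` for the number `0`). -/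
def lowBit (a : ℕ) : ℕ := padicValNat 2 a

/-- One round of alphabet reduction at a symbol `b` with left neighbour `a`: twice the lowest
position at which the binary expansions of `a` and `b` differ, plus the bit of `b` there. -/
def reduceLabel (a b : ℕ) : ℕ :=
  2 * lowBit (a ^^^ b) + (if b.testBit (lowBit (a ^^^ b)) then 1 else 0)

/-- The label of position `i` after `j` rounds of alphabet reduction. -/
def label (s : ℕ → ℕ) : ℕ → ℕ → ℕ
  | 0, i => s i
  | j + 1, i => reduceLabel (label s j (i - 1)) (label s j i)

/-- Position `i` lies in a type-1 substring, i.e. in a repetition of length at least two. -/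
def InRun (s : ℕ → ℕ) (i : ℕ) : Prop := (1 ≤ i ∧ s (i - 1) = s i) ∨ s (i + 1) = s i

instance (s : ℕ → ℕ) (i : ℕ) : Decidable (InRun s i) := by unfold InRun; infer_instance

/-- Position `e` is the last one of a maximal type-1 substring, or position `e + 1` is the first
one of a maximal type-1 substring. -/
def TypeBoundary (s : ℕ → ℕ) (e : ℕ) : Prop :=
  s e ≠ s (e + 1) ∧ (InRun s e ∨ InRun s (e + 1))

instance (s : ℕ → ℕ) (e : ℕ) : Decidable (TypeBoundary s e) := by
  unfold TypeBoundary; infer_instance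

/-- `i` is a landmark: it lies in a type-2 substring (a repetition-free substring longer than
`2 * K`), is preceded in it by at least `2 * K` symbols of left context, and its label after
`K` rounds of alphabet reduction is a strict local maximum. -/
def Landmark (K : ℕ) (s : ℕ → ℕ) (i : ℕ) : Prop :=
  2 * K ≤ i ∧ (∀ d ≤ 2 * K, ¬ InRun s (i - d)) ∧
    label s K (i - 1) < label s K i ∧ label s K (i + 1) < label s K i

instance (K : ℕ) (s : ℕ → ℕ) (i : ℕ) : Decidable (Landmark K s i) := by
  unfold Landmark; infer_instance

/-- A boundary of the parsing between the positions `e` and `e + 1`. -/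
def Boundary (K : ℕ) (s : ℕ → ℕ) (e : ℕ) : Prop := TypeBoundary s e ∨ Landmark K s (e + 1)

instance (K : ℕ) (s : ℕ → ℕ) (e : ℕ) : Decidable (Boundary K s e) := by
  unfold Boundary; infer_instance

/-- In the online parsing a variable is created (and gets its post-order number) as soon as the
last symbol of its block has arrived, so the end of a block may depend on symbols already read
only.  A boundary after position `e` is known when symbol `e + 2` is there; it takes effect after
position `e + 3`. -/
def Cut (K : ℕ) (s : ℕ → ℕ) (c : ℕ) : Prop := 3 ≤ c ∧ Boundary K s (c - 3)

instance (K : ℕ) (s : ℕ → ℕ) (c : ℕ) : Decidable (Cut K s c) := by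
  unfold Cut; infer_instance

/-- The blocks of the string `l = s i, s (i + 1), …`: between two successive cuts the parsing is
left aligned, i.e. into pairs, with a trigram at the end if the number of symbols is odd.  (A cut
right after the first symbol of a block has no effect.)  A last single symbol of the string forms
a block by itself and is passed to the next level unchanged. -/
def blocks (K : ℕ) (s : ℕ → ℕ) : ℕ → List ℕ → List (List ℕ)
  | _, [] => []
  | _, [x] => [[x]]
  | _, [x, y] => [[x, y]]
  | i, x :: y :: z :: l =>
    if Cut K s (i + 2) ∧ ¬ Cut K s (i + 1) then [x, y, z] :: blocks K s (i + 3) l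
    else [x, y] :: blocks K s (i + 2) (z :: l)
  termination_by _ l => l.length

/-- The partition of a string into blocks of one level. -/
def espBlocks (K : ℕ) (l : List ℕ) : List (List ℕ) := blocks K (fun i => l.getD i 0) 0 l

/-! # Grammars and the post-order partial parse tree

The production rules are a list `D`; its `k`-th entry `(x, y)` is the rule `σ + k → x y`. -/

/-- The rule `z → x y` is in `D`. -/
def Rule (σ : ℕ) (D : List (ℕ × ℕ)) (z x y : ℕ) : Prop := σ ≤ z ∧ D[z - σ]? = some (x, y)

/-- `val(x)` is the string `w`. -/
inductive Yields (σ : ℕ) (D : List (ℕ × ℕ)) : ℕ → List ℕ → Prop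
  | term (x : ℕ) : x < σ → Yields σ D x [x]
  | var (z x y : ℕ) (u v : List ℕ) :
      Rule σ D z x y → Yields σ D x u → Yields σ D y v → Yields σ D z (u ++ v)

/-- The root of the tree built over a block: a 2-tree `z → x y` over a pair, a 2-2-tree
`z → x y'`, `y' → y w` over a trigram. -/
inductive BlockRoot (σ : ℕ) (D : List (ℕ × ℕ)) : List ℕ → ℕ → Prop
  | one (x : ℕ) : BlockRoot σ D [x] x
  | two (x y z : ℕ) : Rule σ D z x y → BlockRoot σ D [x, y] z
  | three (x y w y' z : ℕ) : Rule σ D y' y w → Rule σ D z x y' → BlockRoot σ D [x, y, w] z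

/-- Iterated parsing of the string `s`, level by level, ends in the single symbol `root`. -/
inductive EspParse (σ K : ℕ) (D : List (ℕ × ℕ)) : List ℕ → ℕ → Prop
  | single (x : ℕ) : EspParse σ K D [x] x
  | level (s s' : List ℕ) (root : ℕ) : 2 ≤ s.length →
      List.Forall₂ (BlockRoot σ D) (espBlocks K s) s' → EspParse σ K D s' root →
      EspParse σ K D s root

/-- A node of a partial parse tree. -/
inductive Node
  | leaf (x : ℕ)
  | inner (x : ℕ)

/-- `Poppt σ D m x l m'`: traversing in post-order the part of the POPPT below an occurrence of
the symbol `x`, when the first `m` variables have already occurred, visits the nodes `l`, and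
afterwards the first `m'` variables have occurred.  Terminals and repeated occurrences of
variables are leaves, and the variable at an internal node is its post-order number. -/
inductive Poppt (σ : ℕ) (D : List (ℕ × ℕ)) : ℕ → ℕ → List Node → ℕ → Prop
  | leaf (m x : ℕ) : x < σ + m → Poppt σ D m x [.leaf x] m
  | inner (m m₁ m₂ x y : ℕ) (l₁ l₂ : List Node) : Rule σ D (σ + m₂) x y →
      Poppt σ D m x l₁ m₁ → Poppt σ D m₁ y l₂ m₂ →
      Poppt σ D m (σ + m₂) (l₁ ++ l₂ ++ [.inner (σ + m₂)]) (m₂ + 1)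

/-- The bit of a node in the succinct tree: `0` for a leaf, `1` otherwise. -/
def Node.bit : Node → Bool
  | .leaf _ => false
  | .inner _ => true

def Node.leafLabel? : Node → Option ℕ
  | .leaf x => some x
  | .inner _ => none

/-! # Computations with step count

Word-RAM computations are written in the monad `Timed`; `op` marks one step, which is a bounded
number of machine instructions: access to one cell of an array, change of one cell, appending or
removing a cell at an end, and arithmetic and bit operations (with population count and position
of the lowest set bit) on words.  Tests, and the computation of the arguments of a call, count
with a neighbouring `op`.  `peak` is the largest amount of memory reported by `note`. -/

structure Timed (A : Type) where
  val : A
  time : ℕ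
  peak : ℕ

instance : Monad Timed where
  pure a := ⟨a, 0, 0⟩
  bind x f := ⟨(f x.val).val, x.time + (f x.val).time, max x.peak (f x.val).peak⟩

def op {A : Type} (a : A) : Timed A := ⟨a, 1, 0⟩

/-- Report that `m` bits of memory are in use. -/
def note (m : ℕ) : Timed Unit := ⟨(), 0, m⟩

/-- Bits of an array of numbers: cells of equal width, as wide as the largest entry requires,
and the length. -/
def arrBits (l : List ℕ) : ℕ := l.length * Nat.size (l.foldr max 0) + Nat.size l.length

/-! # Bit strings with rank -/

/-- An extensible bit string: `zeros` zero bits, which are not stored, followed by `bits`.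
`cnt` holds the number of ones in the first `w`, `2 * w`, … of the stored bits, where `w` is the
word length. -/
structure Fid where
  zeros : ℕ
  bits : List Bool
  cnt : List ℕ

def Fid.toList (A : Fid) : List Bool := List.replicate A.zeros false ++ A.bits

/-- Number of ones among the bits at positions `i, …, j - 1` (used for `j ≤ i + w` only, where
it concerns a bounded number of words). -/
def popCount (l : List Bool) (i j : ℕ) : ℕ := ((l.take j).drop i).count true

def Fid.push (w : ℕ) (A : Fid) (b : Bool) : Timed Fid := do
  let bits ← op (A.bits ++ [b])
  if bits.length % w = 0 then
    let c ← op (A.cnt.getLastD 0 + popCount bits (bits.length - w) bits.length)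
    let cnt ← op (A.cnt ++ [c])
    op ⟨A.zeros, bits, cnt⟩
  else
    op ⟨A.zeros, bits, A.cnt⟩

def Fid.access (A : Fid) (i : ℕ) : Timed Bool :=
  if i < A.zeros then op false else op (A.bits.getD (i - A.zeros) false)

/-- Number of ones before position `i`. -/
def Fid.rank (w : ℕ) (A : Fid) (i : ℕ) : Timed ℕ :=
  if i ≤ A.zeros then op 0
  else do
    let j ← op (i - A.zeros)
    let base ← op (if j / w = 0 then 0 else A.cnt.getD (j / w - 1) 0)
    let c ← op (popCount A.bits (j / w * w) j)
    op (base + c)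

def Fid.size (A : Fid) : ℕ :=
  Nat.size A.zeros + Nat.size A.bits.length + A.bits.length + arrBits A.cnt

/-! # Dynamic wavelet tree -/

/-- A wavelet tree; a subtree without any symbol is not stored. -/
inductive WTree
  | nil
  | node (A : Fid) (l r : WTree)

def WTree.nodes : WTree → ℕ
  | .nil => 0
  | .node _ l r => l.nodes + r.nodes + 1

/-- Bits of the tree, with `ptr` bits for each of the three pointers of a node. -/
def WTree.size (ptr : ℕ) : WTree → ℕ
  | .nil => 0
  | .node A l r => A.size + 3 * ptr + l.size ptr + r.size ptr

/-- The tree `t` is the wavelet tree of the sequence `l` over the range `0, …, 2 ^ h - 1` (in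
terms of the `h` low-order bits of the symbols). -/
def IsWTree : ℕ → List ℕ → WTree → Prop
  | 0, _, t => t = .nil
  | _ + 1, l, .nil => l = []
  | h + 1, l, .node A t₀ t₁ => l ≠ [] ∧ A.toList = l.map (fun x => x.testBit h) ∧
      IsWTree h (l.filter fun x => !x.testBit h) t₀ ∧ IsWTree h (l.filter fun x => x.testBit h) t₁

def WTree.push (w x : ℕ) : ℕ → WTree → Timed WTree
  | 0, t => pure t
  | h + 1, .nil => do
    let b ← op (x.testBit h)
    let A ← Fid.push w ⟨0, [], []⟩ b
    let t ← WTree.push w x h .nil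
    if b then op (.node A .nil t) else op (.node A t .nil)
  | h + 1, .node A l r => do
    let b ← op (x.testBit h)
    let A ← A.push w b
    if b then
      let r ← WTree.push w x h r
      op (.node A l r)
    else
      let l ← WTree.push w x h l
      op (.node A l r)

def WTree.access (w : ℕ) : ℕ → WTree → ℕ → Timed ℕ
  | 0, _, _ => pure 0
  | _ + 1, .nil, _ => pure 0
  | h + 1, .node A l r, i => do
    let b ← A.access i
    let c ← A.rank w i
    if b then
      let v ← WTree.access w h r c
      op (2 ^ h + v)
    else
      WTree.access w h l (i - c)

/-- A dynamic wavelet tree of height `h` for a sequence of length `len`. -/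
structure Dwt where
  len : ℕ
  h : ℕ
  tree : WTree

def Dwt.Represents (T : Dwt) (l : List ℕ) : Prop :=
  T.len = l.length ∧ (∀ x ∈ l, x < 2 ^ T.h) ∧ IsWTree T.h l T.tree

/-- Increase the height by `k`: each new root has the old tree as its left child. -/
def Dwt.grow (T : Dwt) : ℕ → Timed Dwt
  | 0 => pure T
  | k + 1 => do
    let T ← T.grow k
    if T.len = 0 then op ⟨0, T.h + 1, .nil⟩
    else op ⟨T.len, T.h + 1, .node ⟨T.len, [], []⟩ T.tree .nil⟩

/-- Append a symbol, after the height has been increased if the symbol exceeds the range. -/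
def Dwt.push (w : ℕ) (T : Dwt) (x : ℕ) : Timed Dwt := do
  let k ← op (Nat.size x - T.h)
  let T ← T.grow k
  let t ← WTree.push w x T.h T.tree
  op ⟨T.len + 1, T.h, t⟩

def Dwt.access (w : ℕ) (T : Dwt) (i : ℕ) : Timed ℕ := WTree.access w T.h T.tree i

def Dwt.size (T : Dwt) : ℕ :=
  Nat.size T.len + Nat.size T.h + T.tree.size (Nat.size T.tree.nodes)

/-! # Succinct tree with a dynamic range minimum tree -/

/-- The bit string of the tree.  `mins` is the range minimum tree: its level `0` holds the excess
`#zeros - #ones` of every prefix of the bit string, the other levels the minima of successive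
pairs of the level below. -/
structure Succ where
  bits : List Bool
  mins : List (List ℕ)

def excess (l : List Bool) : ℕ := l.count false - l.count true

def pairMin : List ℕ → List ℕ
  | a :: b :: l => min a b :: pairMin l
  | _ => []

/-- Each level consists of the minima of the pairs of the level below, down to one entry. -/
def IsMinTree : List (List ℕ) → Prop
  | [] => False
  | [l] => pairMin l = []
  | l :: m :: ls => m = pairMin l ∧ m ≠ [] ∧ IsMinTree (m :: ls)

def Succ.Represents (B : Succ) (l : List Bool) : Prop :=
  B.bits = l ∧ B.mins.head? = some (l.inits.map excess) ∧ IsMinTree B.mins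

def Succ.empty : Succ := ⟨[], [[0]]⟩

def pushMin : List (List ℕ) → ℕ → Timed (List (List ℕ))
  | [], v => op [[v]]
  | l :: ls, v => do
    let l ← op (l ++ [v])
    if l.length % 2 = 0 then
      let m ← op (min (l.getD (l.length - 2) 0) (l.getD (l.length - 1) 0))
      let ls ← pushMin ls m
      op (l :: ls)
    else
      op (l :: ls)

def Succ.minAt (B : Succ) (j k : ℕ) : Timed ℕ := op ((B.mins.getD j []).getD k 0)

def Succ.push (B : Succ) (b : Bool) : Timed Succ := do
  let bits ← op (B.bits ++ [b])
  let e ← B.minAt 0 B.bits.length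
  let mins ← pushMin B.mins (if b then e - 1 else e + 1)
  op ⟨bits, mins⟩

/-- Number of ones, respectively zeros, before position `i`. -/
def Succ.rank₁ (B : Succ) (i : ℕ) : Timed ℕ := do
  let e ← B.minAt 0 i
  op ((i - e) / 2)

def Succ.rank₀ (B : Succ) (i : ℕ) : Timed ℕ := do
  let e ← B.minAt 0 i
  op ((i + e) / 2)

/-- Binary search for the last position before which there are at most `k` ones. -/
def Succ.selectLoop (B : Succ) (k : ℕ) : ℕ → ℕ → ℕ → Timed ℕ
  | 0, lo, _ => pure lo
  | f + 1, lo, hi =>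
    if lo + 1 < hi then do
      let mid ← op ((lo + hi) / 2)
      let r ← B.rank₁ mid
      if r ≤ k then B.selectLoop k f mid hi else B.selectLoop k f lo mid
    else op lo

/-- Position of the `k`-th one (counted from `0`). -/
def Succ.select₁ (B : Succ) (k : ℕ) : Timed ℕ :=
  B.selectLoop k (Nat.size B.bits.length + 1) 0 B.bits.length

def Succ.descend (B : Succ) (v : ℕ) : ℕ → ℕ → Timed ℕ
  | 0, k => pure k
  | j + 1, k => do
    let x ← B.minAt j (2 * k + 1)
    if x ≤ v then B.descend v j (2 * k + 1) else B.descend v j (2 * k)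

def Succ.climb (B : Succ) (v : ℕ) : ℕ → ℕ → ℕ → Timed ℕ
  | 0, _, _ => pure 0
  | f + 1, j, k => do
    let x ← B.minAt j (k - 1)
    if k % 2 = 1 ∧ x ≤ v then B.descend v j (k - 1) else B.climb v f (j + 1) (k / 2)

/-- The largest `s < i` such that the prefix of length `s` has excess at most `v`. -/
def Succ.search (B : Succ) (v i : ℕ) : Timed ℕ := B.climb v (B.mins.length + 1) 0 i

/-- Right child of the internal node at position `i`. -/
def Succ.rightChild (_B : Succ) (i : ℕ) : Timed ℕ := op (i - 1)

/-- Left child of the internal node at position `i`. -/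
def Succ.leftChild (B : Succ) (i : ℕ) : Timed ℕ := do
  let e ← B.minAt 0 i
  let s ← B.search (e - 1) i
  op (s - 1)

def Succ.size (B : Succ) : ℕ :=
  Nat.size B.bits.length + B.bits.length + (B.mins.map arrBits).sum + Nat.size B.mins.length

/-! # The index -/

/-- Parameters of the index: alphabet size, `K = lg* |S|`, the prime modulus `p` of the hash
function `(x, y) ↦ a₁ x + a₂ y + b mod p`, whose length is also the word length of the machine,
and the number of hash table entries for a given number of variables. -/
structure Par where
  σ : ℕ
  K : ℕ
  p : ℕ
  a₁ : ℕ
  a₂ : ℕ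
  b : ℕ
  buckets : ℕ → ℕ

def Par.w (P : Par) : ℕ := Nat.size P.p

def Par.hash (P : Par) (x y : ℕ) : ℕ := (P.a₁ * x + P.a₂ * y + P.b) % P.p

/-- Entry for hash value `v` in a table of `m ≥ 1` entries that grows by one entry at a time. -/
def addr (m v : ℕ) : ℕ :=
  if v % 2 ^ (Nat.log2 m + 1) < m then v % 2 ^ (Nat.log2 m + 1) else v % 2 ^ Nat.log2 m

/-- The index: succinct tree `B`, leaf labels `L`, lengths `R`, and the chaining hash table.
`heads` are the table entries and `next` the links of their lists; `0` is the end of a list and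
`k + 1` stands for the variable `σ + k`. -/
structure Index where
  B : Succ
  L : Dwt
  R : List ℕ
  heads : List ℕ
  next : List ℕ

def Index.empty : Index := ⟨Succ.empty, ⟨0, 0, .nil⟩, [], [0], []⟩

/-- The number of variables. -/
def Index.n (I : Index) : ℕ := I.R.length

/-- Size of the index in bits, with the hash function. -/
def Index.size (P : Par) (I : Index) : ℕ :=
  I.B.size + I.L.size + arrBits I.R + arrBits I.heads + arrBits I.next +
    (Nat.size P.p + Nat.size P.a₁ + Nat.size P.a₂ + Nat.size P.b)

/-- The variables in the list that starts with the link `c`, following at most `f` links. -/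
def chain (next : List ℕ) : ℕ → ℕ → List ℕ
  | 0, _ => []
  | _ + 1, 0 => []
  | f + 1, k + 1 => k :: chain next f (next.getD k 0)

/-- `I` is the OESP-index of the string `s`: for a grammar `D` that derives `s`, obtained by
iterated parsing, with post-order variables, it consists of the succinct tree of the POPPT (with
a final `1` for the virtual node), the wavelet tree of the leaf labels, the lengths of the
strings derived from the variables, and the chaining hash table of the reverse dictionary. -/
def IsIndex (P : Par) (s : List ℕ) (I : Index) : Prop :=
  ∃ (D : List (ℕ × ℕ)) (root : ℕ) (T : List Node),
    D.Nodup ∧ Yields P.σ D root s ∧ EspParse P.σ P.K D s root ∧ Poppt P.σ D 0 root T D.length ∧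
    I.B.Represents (T.map Node.bit ++ [true]) ∧
    I.L.Represents (T.filterMap Node.leafLabel?) ∧
    List.Forall₂ (fun k r => ∃ u, Yields P.σ D (P.σ + k) u ∧ u.length = r)
      (List.range D.length) I.R ∧
    I.heads.length = max 1 (P.buckets D.length) ∧ I.next.length = D.length ∧
    ∀ i < I.heads.length,
      (chain I.next (D.length + 1) (I.heads.getD i 0)).Nodup ∧
      ∀ k, k ∈ chain I.next (D.length + 1) (I.heads.getD i 0) ↔
        ∃ x y, D[k]? = some (x, y) ∧ addr I.heads.length (P.hash x y) = i

/-! # Operations of the index -/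

/-- The symbol at the node at position `q` of the succinct tree. -/
def Index.symAt (P : Par) (I : Index) (q : ℕ) : Timed ℕ := do
  let b ← op (I.B.bits.getD q false)
  if b then
    let r ← I.B.rank₁ q
    op (P.σ + r)
  else
    let r ← I.B.rank₀ q
    I.L.access P.w r

/-- Phrase dictionary: the right-hand side of the rule of the variable `σ + k`. -/
def Index.digram (P : Par) (I : Index) (k : ℕ) : Timed (ℕ × ℕ) := do
  let q ← I.B.select₁ k
  let l ← I.B.leftChild q
  let r ← I.B.rightChild q
  let x ← I.symAt P l
  let y ← I.symAt P r
  op (x, y)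

def Index.lookupLoop (P : Par) (I : Index) (x y : ℕ) : ℕ → ℕ → Timed (Option ℕ)
  | 0, _ => pure none
  | _ + 1, 0 => op none
  | f + 1, k + 1 => do
    let d ← I.digram P k
    if d = (x, y) then op (some (P.σ + k))
    else
      let c ← op (I.next.getD k 0)
      I.lookupLoop P x y f c

/-- Reverse dictionary: the variable with right-hand side `x y`, if there is one. -/
def Index.lookup (P : Par) (I : Index) (x y : ℕ) : Timed (Option ℕ) := do
  let i ← op (addr I.heads.length (P.hash x y))
  let c ← op (I.heads.getD i 0)
  I.lookupLoop P x y (I.n + 1) c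

/-- Distribute the list that starts with `c` to the entry `i` and a new entry, when the table
gets `m` entries; `c₀` and `c₁` are the two lists made so far. -/
def Index.splitLoop (P : Par) (I : Index) (m i : ℕ) :
    ℕ → ℕ → ℕ → ℕ → List ℕ → Timed (ℕ × ℕ × List ℕ)
  | 0, _, c₀, c₁, next => pure (c₀, c₁, next)
  | _ + 1, 0, c₀, c₁, next => op (c₀, c₁, next)
  | f + 1, k + 1, c₀, c₁, next => do
    let d ← I.digram P k
    let c ← op (next.getD k 0)
    let j ← op (addr m (P.hash d.1 d.2))
    if j = i then
      let next ← op (next.set k c₀)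
      I.splitLoop P m i f c (k + 1) c₁ next
    else
      let next ← op (next.set k c₁)
      I.splitLoop P m i f c c₀ (k + 1) next

/-- Add one entry to the hash table if the number of variables requires it. -/
def Index.enlarge (P : Par) (I : Index) : Timed Index := do
  let m ← op I.heads.length
  let m' ← op (P.buckets I.n)
  if m < m' then
    let i ← op (m - 2 ^ Nat.log2 m)
    let c ← op (I.heads.getD i 0)
    let r ← I.splitLoop P (m + 1) i (I.n + 1) c 0 0 I.next
    let heads ← op (I.heads.set i r.1)
    let heads ← op (heads ++ [r.2.1])
    op { I with heads := heads, next := r.2.2 }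
  else
    op I

def Index.symLen (P : Par) (I : Index) (x : ℕ) : Timed ℕ :=
  if x < P.σ then op 1 else op (I.R.getD (x - P.σ) 0)

/-- Append a leaf to the POPPT. -/
def Index.addLeaf (P : Par) (I : Index) (x : ℕ) : Timed Index := do
  let B ← I.B.push false
  let L ← I.L.push P.w x
  op { I with B := B, L := L }

/-- Append an internal node to the POPPT, i.e. create a variable with right-hand side `x y`. -/
def Index.addVar (P : Par) (I : Index) (x y : ℕ) : Timed Index := do
  let B ← I.B.push true
  let u ← I.symLen P x
  let v ← I.symLen P y
  let R ← op (I.R ++ [u + v])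
  let i ← op (addr I.heads.length (P.hash x y))
  let c ← op (I.heads.getD i 0)
  let next ← op (I.next ++ [c])
  let heads ← op (I.heads.set i R.length)
  Index.enlarge P ⟨B, I.L, R, heads, next⟩

/-! # Online construction -/

/-- What has to be known of the string of one level of the parsing, whose last symbol is at
position `t`: the number of pending symbols (not yet in a finished block), the number of symbols
(up to `2`), whether position `t`, respectively `t - 1`, repeats the symbol before it, the number
(up to `2 * K`) of symbols before position `t` in its repetition-free substring, whether there is
a cut after position `t + 1`, whether the last label of `t` exceeds that of `t - 1`, and the
labels of position `t` after `0, …, K` rounds of alphabet reduction. -/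
structure Level where
  pend : ℕ
  age : ℕ
  rep : Bool
  rep' : Bool
  off : ℕ
  cut : Bool
  up : Bool
  labels : List ℕ

def Level.init (K : ℕ) : Level := ⟨0, 0, false, false, 0, false, false, List.replicate (K + 1) 0⟩

/-- The new labels from the labels of the previous position and the new symbol. -/
def relabel : List ℕ → ℕ → Timed (List ℕ)
  | [], _ => op []
  | a :: as, x => do
    let y ← op (reduceLabel a x)
    let ys ← relabel as y
    op (x :: ys)

/-- Arrival of the symbol `x`. The result tells how many pairs are to be merged: none if the
block of the pending symbols is not complete, `1` for a pair, and `2` for a trigram. -/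
def Level.arrive (K : ℕ) (v : Level) (x : ℕ) : Timed (Level × ℕ) := do
  let rep ← op (decide (0 < v.age) && v.labels.headD 0 == x)
  let off ← op (if rep || v.rep || v.age == 0 then 0 else min (v.off + 1) (2 * K))
  let labels ← relabel v.labels x
  let old ← op (v.labels.getLastD 0)
  let new ← op (labels.getLastD 0)
  let boundary ← op (!v.rep && (v.rep' || rep))
  let landmark ← op (!v.rep && !rep && v.off == 2 * K && v.up && decide (new < old))
  let cut ← op (v.age == 2 && (boundary || landmark))
  let merges ← op (if v.pend = 0 then 0 else if v.pend = 1 then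
    (if cut && !v.cut then 0 else 1) else 2)
  let pend ← op (if merges = 0 then v.pend + 1 else 0)
  let age ← op (min (v.age + 1) 2)
  op (⟨pend, age, rep, v.rep, off, cut, decide (old < new), labels⟩, merges)

/-- What the construction does next: nothing, let the top of the stack arrive at level `k`,
merge the two topmost symbols of the stack (and do `j` merges in all for a block of level `k`),
or create a new variable for them, after their addition to the POPPT. -/
inductive Task
  | idle
  | arrive (k : ℕ)
  | merge (k j : ℕ)
  | create (k j : ℕ)

/-- State of the construction: the index so far; input symbols that wait for being processed;
the pending symbols of all levels, from the highest to the lowest level; how many of them, from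
the bottom of the stack, are nodes of the POPPT already; the levels; and the current task. -/
structure State where
  I : Index
  queue : List ℕ
  stack : List ℕ
  done : ℕ
  levels : List Level
  task : Task

def State.init : State := ⟨Index.empty, [], [], 0, [], .idle⟩

/-- Bits of the working memory: the index, the queue, the stack, and for every component of the
levels an array. -/
def State.size (P : Par) (st : State) : ℕ :=
  st.I.size P + arrBits st.queue + arrBits st.stack + Nat.size st.done +
    arrBits (st.levels.map Level.pend) + arrBits (st.levels.map Level.age) +
    arrBits (st.levels.map fun v => v.rep.toNat) + arrBits (st.levels.map fun v => v.rep'.toNat) +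
    arrBits (st.levels.map Level.off) + arrBits (st.levels.map fun v => v.cut.toNat) +
    arrBits (st.levels.map fun v => v.up.toNat) +
    (∑ j ∈ Finset.range (P.K + 1), arrBits (st.levels.map fun v => v.labels.getD j 0)) +
    Nat.size P.K + Nat.size P.σ +
    match st.task with
    | .idle => 2
    | .arrive k => 2 + Nat.size k
    | .merge k j => 2 + Nat.size k + Nat.size j
    | .create k j => 2 + Nat.size k + Nat.size j

/-- Replace the two topmost symbols by `z` and continue. -/
def State.replace (st : State) (I : Index) (done k j z : ℕ) : Timed State := do
  let stack ← op (st.stack.take (st.stack.length - 2) ++ [z])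
  op { st with I := I, stack := stack, done := min done stack.length,
               task := if j ≤ 1 then .arrive (k + 1) else .merge k (j - 1) }

/-- One step of the construction. -/
def State.perform (P : Par) (st : State) : Timed State :=
  match st.task with
  | .idle => match st.queue with
    | [] => op st
    | c :: q => do
      let stack ← op (st.stack ++ [c])
      op { st with queue := q, stack := stack, task := .arrive 0 }
  | .arrive k => do
    let x ← op (st.stack.getLastD 0)
    let v ← op (st.levels.getD k (Level.init P.K))
    let r ← v.arrive P.K x
    let levels ← op (if k < st.levels.length then st.levels.set k r.1 else st.levels ++ [r.1])
    op { st with levels := levels, task := if r.2 = 0 then .idle else .merge k r.2 }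
  | .merge k j => do
    let x ← op (st.stack.getD (st.stack.length - 2) 0)
    let y ← op (st.stack.getD (st.stack.length - 1) 0)
    let z ← st.I.lookup P x y
    match z with
    | some z => st.replace st.I st.done k j z
    | none => op { st with task := .create k j }
  | .create k j =>
    if st.done < st.stack.length then do
      let x ← op (st.stack.getD st.done 0)
      let I ← st.I.addLeaf P x
      op { st with I := I, done := st.done + 1 }
    else do
      let x ← op (st.stack.getD (st.stack.length - 2) 0)
      let y ← op (st.stack.getD (st.stack.length - 1) 0)
      let I ← st.I.addVar P x y
      st.replace I st.done k j (P.σ + st.I.n)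

/-- One step of the construction, with a report of the memory then in use. -/
def State.step (P : Par) (st : State) : Timed State := do
  let st ← st.perform P
  note (st.size P)
  pure st

def State.steps (P : Par) : ℕ → State → Timed State
  | 0, st => pure st
  | f + 1, st => do
    let st ← st.step P
    State.steps P f st

/-- Update for the next input symbol: it enters the queue, and a fixed number of steps is done. -/
def State.update (P : Par) (st : State) (c : ℕ) : Timed State := do
  let queue ← op (st.queue ++ [c])
  note ({ st with queue := queue }.size P)
  State.steps P 16 { st with queue := queue }

/-- The state after the input symbols of a string. -/
def State.read (P : Par) (st : State) : List ℕ → Timed State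
  | [] => pure st
  | c :: s => do
    let st ← st.update P c
    st.read P s

/-- Work until nothing remains to be done, at most `f` steps. -/
def State.drain (P : Par) : ℕ → State → Timed State
  | 0, st => pure st
  | f + 1, st => match st.task, st.queue with
    | .idle, [] => op st
    | _, _ => do
      let st ← st.step P
      State.drain P f st

/-- A number of steps after which nothing remains to be done. -/
def State.fuel (st : State) : ℕ :=
  100 * (st.queue.length + st.stack.length + st.levels.length + 1)

/-- End of the input: finish the last blocks of the levels `k, k + 1, …`. -/
def State.close (P : Par) : ℕ → ℕ → State → Timed State
  | 0, _, st => pure st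
  | f + 1, k, st =>
    if st.stack.length ≤ 1 then op st
    else do
      let v ← op (st.levels.getD k (Level.init P.K))
      let levels ← op (st.levels.set k { v with pend := 0 })
      let task ← op (if v.pend = 0 then Task.idle else if v.pend = 1 then .arrive (k + 1)
        else .merge k 1)
      let st ← State.drain P st.fuel { st with levels := levels, task := task }
      State.close P f (k + 1) st

/-- End of the input: process the waiting symbols, finish all levels, and complete the POPPT by
its virtual node (and by its only leaf if the input is a single symbol). -/
def State.finish (P : Par) (st : State) : Timed State := do
  let st ← State.drain P st.fuel st
  let st ← State.close P (st.levels.length + 2) 0 st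
  let I ← if st.done < st.stack.length then st.I.addLeaf P (st.stack.getD st.done 0) else op st.I
  let B ← I.B.push true
  note ({ st with I := { I with B := B } }.size P)
  op { st with I := { I with B := B } }

/-- The state after the symbols of `s` have been read. -/
def stateAfter (P : Par) (s : List ℕ) : State := (State.init.read P s).val

/-- The whole construction for the input `s`. -/
def construct (P : Par) (s : List ℕ) : Timed State := do
  let st ← State.init.read P s
  st.finish P

/-! # Hash function chosen at random -/

/-- The parameters for load factor `α`, when the table has `⌈α n⌉` entries for `n` variables. -/
noncomputable def par (σ K : ℕ) (α : ℝ) {p : ℕ} (h : Fin p × Fin p × Fin p) : Par :=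
  ⟨σ, K, p, h.1, h.2.1, h.2.2, fun n => ⌈α * n⌉₊⟩

/-- Expected value over the uniformly random hash function. -/
noncomputable def mean {p : ℕ} (f : Fin p × Fin p × Fin p → ℕ) : ℝ :=
  (∑ h, (f h : ℝ)) / (p : ℝ) ^ 3

end Oesp

open scoped BigOperators

namespace Oesp

/-! # Timed computations -/

/-! The hash function decides which list entries a lookup passes, never what the lookup returns. So
the construction is compared with a deterministic machine without hash table (`AState`,
`AState.step`), whose dictionary is the plain list of rules. `Rel` ties a real state to an abstract
one, and by `State.perform_spec` one real step follows one abstract step, at the cost of O(lg(n+σ))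
for each visited list entry plus O(lg(n+σ) + K). Hence all hash functions share one sequence of
abstract states (`Sim`, `exists_sim_construct`), and the number of variables at any time is common
to them.

Correctness of the index rests on invariants of the abstract machine. `AState.Inv`: the done symbols
at the bottom of the stack are the roots of the subtrees traversed so far, in order (`Forest`).
Since the variable created last occurs in no right-hand side, a successful lookup never swallows a
symbol that is already a node. `AState.Parses`: each level has a string, its finished blocks have as
roots the string of the next level, and the stack consists of the unfinished blocks. That the online
blocks are those of the parsing is `finBlocks_eq_blocks`, based on the record invariant `Level.Ok`.
`AState.Derives`: the stack and the queue derive the input.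

Time: the potential `AState.work` drops with every step and rises by 7 with an input symbol, so 16
steps per symbol keep it below 8L + 8, where L is the number of levels. There are O(|S|) steps in
all. Dictionary and query of a step are fixed while the hash function is averaged, and for m table
entries two distinct digrams collide with probability at most 3/m; so at most 6/α list entries are
visited on average (`mean_visited_le`).

Space: only `R` holds long numbers, n of them, each at most |S|. The rest of the index consists of
O(n+σ) numbers of O(lg(n+σ)) bits, with some bit strings and the hash parameters, which need O(n+σ)
bits as |S| ≤ 2^n. For the working memory, stack and queue are O(L) by the potential. Level masses
give 2^L = O(|S|), while O(L) symbols, each deriving at most 2^n terminals, derive the input; so 2^L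
= O(L 2^n) and L = O(n) (`AState.Good.levels_le`). Of the K+1 labels of a level, all but the first
have a doubly logarithmic length. As |S| ≤ 2^n, K is at most doubly logarithmic in n too, so the
labels of a level take O(lg(n+σ)) bits (`lgStar_mul_size_le`). -/

@[simp] theorem Timed.bind_val {A B : Type} (x : Timed A) (f : A → Timed B) :
    (x >>= f).val = (f x.val).val := id rfl
@[simp] theorem Timed.bind_time {A B : Type} (x : Timed A) (f : A → Timed B) :
    (x >>= f).time = x.time + (f x.val).time := id rfl
@[simp] theorem Timed.bind_peak {A B : Type} (x : Timed A) (f : A → Timed B) :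
    (x >>= f).peak = max x.peak (f x.val).peak := id rfl
@[simp] theorem Timed.pure_val {A : Type} (a : A) : (pure a : Timed A).val = a := id rfl
@[simp] theorem Timed.pure_time {A : Type} (a : A) : (pure a : Timed A).time = 0 := id rfl
@[simp] theorem Timed.pure_peak {A : Type} (a : A) : (pure a : Timed A).peak = 0 := id rfl
@[simp] theorem op_val {A : Type} (a : A) : (op a).val = a := id rfl
@[simp] theorem op_time {A : Type} (a : A) : (op a).time = 1 := id rfl
@[simp] theorem op_peak {A : Type} (a : A) : (op a).peak = 0 := id rfl
@[simp] theorem note_time (m : ℕ) : (note m).time = 0 := id rfl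
@[simp] theorem note_peak (m : ℕ) : (note m).peak = m := id rfl

/-! # Bit strings with rank -/

/-- The counters of a bit string are correct. -/
structure Fid.Ok (w : ℕ) (A : Fid) : Prop where
  len : A.cnt.length = A.bits.length / w
  cnt : ∀ j < A.cnt.length, A.cnt.getD j 0 = (A.bits.take ((j + 1) * w)).count true

theorem popCount_eq (l : List Bool) {i j : ℕ} (h : i ≤ j) :
    (l.take i).count true + popCount l i j = (l.take j).count true := by
  unfold popCount
  have h1 : (l.take j) = (l.take j).take i ++ (l.take j).drop i := (List.take_append_drop _ _).symm
  conv_rhs => rw [h1, List.count_append, List.take_take, min_eq_left h]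

theorem Fid.ok_nil (w z : ℕ) : Fid.Ok w ⟨z, [], []⟩ := ⟨by simp, by simp⟩

theorem Fid.toList_push (w : ℕ) (A : Fid) (b : Bool) :
    (A.push w b).val.toList = A.toList ++ [b] := by
  unfold Fid.push
  by_cases h : (A.bits ++ [b]).length % w = 0
  · simp [Fid.toList]
    split_ifs <;> simp
  · simp [Fid.toList]
    split_ifs <;> simp

theorem Fid.push_time (w : ℕ) (A : Fid) (b : Bool) : (A.push w b).time ≤ 4 := by
  unfold Fid.push
  simp
  split_ifs <;> simp

theorem Fid.push_peak (w : ℕ) (A : Fid) (b : Bool) : (A.push w b).peak = 0 := by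
  unfold Fid.push
  simp
  split_ifs <;> simp

/-- A counter is added exactly when a block of `w` stored bits becomes full; it is the previous
counter plus the ones of this block. -/
theorem Fid.Ok.push {w : ℕ} (hw : 0 < w) {A : Fid} (h : A.Ok w) (b : Bool) :
    (A.push w b).val.Ok w := by
  obtain ⟨h1, h2⟩ := h
  unfold Fid.push
  simp only [Timed.bind_val, op_val]
  have hle : ∀ j < A.cnt.length, (j + 1) * w ≤ A.bits.length := by
    intro j hj
    calc (j + 1) * w ≤ A.bits.length / w * w := Nat.mul_le_mul_right _ (by omega)
      _ ≤ _ := Nat.div_mul_le_self _ _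
  have hold : ∀ j < A.cnt.length, A.cnt.getD j 0 =
      ((A.bits ++ [b]).take ((j + 1) * w)).count true := by
    intro j hj
    rw [h2 j hj, List.take_append_of_le_length (hle j hj)]
  by_cases hd : (A.bits ++ [b]).length % w = 0
  · have hdvd : w ∣ A.bits.length + 1 := Nat.dvd_of_mod_eq_zero (by simpa using hd)
    have hq : (A.bits.length + 1) / w = A.bits.length / w + 1 := by
      rw [Nat.succ_div, if_pos hdvd]
    have hmul : (A.bits.length / w + 1) * w = A.bits.length + 1 := by
      rw [← hq]; exact Nat.div_mul_cancel hdvd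
    rw [if_pos hd]
    simp only [Timed.bind_val, op_val]
    refine ⟨by simp [h1, hq], ?_⟩
    intro j hj
    simp only [List.length_append, List.length_singleton] at hj
    rcases Nat.lt_or_ge j A.cnt.length with hj' | hj'
    · rw [List.getD_append _ _ _ _ hj']
      exact hold j hj'
    · have hjj : j = A.cnt.length := by omega
      subst hjj
      rw [List.getD_append_right _ _ _ _ le_rfl]
      simp only [Nat.sub_self, List.getD_cons_zero, List.length_append, List.length_singleton]
      -- If there is no counter yet, the full block starts at position 0, and the default 0 of
      -- `getLastD` is the right count before it.
      have hlast : A.cnt.getLastD 0 = ((A.bits ++ [b]).take (A.bits.length + 1 - w)).count true := by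
        rcases Nat.eq_zero_or_pos A.cnt.length with h0 | h0
        · have : A.bits.length + 1 - w = 0 := by
            rw [← h1, h0] at hmul; omega
          rw [this]
          simp [List.length_eq_zero_iff.1 h0]
        · have hm : A.cnt.length * w + w = A.bits.length + 1 := by
            rw [← hmul, ← h1]; ring
          have e : A.bits.length + 1 - w = (A.cnt.length - 1 + 1) * w := by
            rw [Nat.sub_add_cancel h0]; omega
          rw [e, ← hold _ (by omega)]
          rw [List.getLastD_eq_getLast?, List.getLast?_eq_getElem?, List.getD_eq_getElem?_getD]
      rw [hlast, popCount_eq _ (by omega), h1, hmul]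
  · have hdvd : ¬ w ∣ A.bits.length + 1 := fun h => hd (by simpa using Nat.mod_eq_zero_of_dvd h)
    rw [if_neg hd]
    refine ⟨by simp [h1, Nat.succ_div, hdvd], hold⟩

theorem Fid.access_val (A : Fid) (i : ℕ) : (A.access i).val = A.toList.getD i false := by
  unfold Fid.access Fid.toList
  split_ifs with h
  · rw [List.getD_append _ _ _ _ (by simpa using h)]
    simp [h]
  · rw [List.getD_append_right _ _ _ _ (by simpa using h)]
    simp

theorem Fid.access_time (A : Fid) (i : ℕ) : (A.access i).time = 1 := by
  unfold Fid.access; split_ifs <;> rfl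

theorem Fid.access_peak (A : Fid) (i : ℕ) : (A.access i).peak = 0 := by
  unfold Fid.access; split_ifs <;> rfl

theorem Fid.rank_time (w : ℕ) (A : Fid) (i : ℕ) : (A.rank w i).time ≤ 4 := by
  unfold Fid.rank; split_ifs <;> simp

theorem Fid.rank_peak (w : ℕ) (A : Fid) (i : ℕ) : (A.rank w i).peak = 0 := by
  unfold Fid.rank; split_ifs <;> simp

/-- The counters give the ones up to the last full block and the population count those in the rest;
the zeros that are not stored contribute nothing. -/
theorem Fid.Ok.rank_val {w : ℕ} {A : Fid} (h : A.Ok w) {i : ℕ}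
    (hi : i ≤ A.toList.length) : (A.rank w i).val = (A.toList.take i).count true := by
  unfold Fid.rank Fid.toList
  split_ifs with h0
  · rw [List.take_append_of_le_length (by simpa using h0)]
    simp [List.take_replicate, List.count_replicate]
  · simp only [Timed.bind_val, op_val]
    rw [List.take_append, List.count_append]
    simp only [List.take_replicate, List.length_replicate, List.count_replicate]
    simp only [Fid.toList, List.length_append, List.length_replicate] at hi
    set j := i - A.zeros with hj
    have hjl : j ≤ A.bits.length := by omega
    have key : (if j / w = 0 then 0 else A.cnt.getD (j / w - 1) 0) =
        (A.bits.take (j / w * w)).count true := by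
      split_ifs with hz
      · simp [hz]
      · have hpos : 0 < j / w := Nat.pos_of_ne_zero hz
        have hlt : j / w - 1 < A.cnt.length := by
          have hd := Nat.div_le_div_right (c := w) hjl
          rw [h.len]
          exact lt_of_lt_of_le (Nat.sub_lt hpos one_pos) hd
        rw [h.cnt _ hlt, Nat.sub_add_cancel hpos]
    rw [key, popCount_eq _ (Nat.div_mul_le_self _ _)]
    simp

/-! ### Space of arrays -/

theorem foldr_max_le {l : List ℕ} {m : ℕ} (h : ∀ x ∈ l, x ≤ m) : l.foldr max 0 ≤ m := by
  induction l with
  | nil => simp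
  | cons a l ih =>
    simp only [List.foldr_cons]
    exact max_le (h a (by simp)) (ih fun x hx => h x (by simp [hx]))

theorem arrBits_le {l : List ℕ} {m : ℕ} (h : ∀ x ∈ l, x ≤ m) :
    arrBits l ≤ l.length * Nat.size m + Nat.size l.length := by
  unfold arrBits
  gcongr
  exact Nat.size_le_size (foldr_max_le h)

/-- There is one counter for `w` stored bits, and a counter has at most `Nat.size m ≤ w` bits. So
the counters take no more space than the bits, whence the factor 2. -/
theorem Fid.Ok.size_le {w : ℕ} {A : Fid} (h : A.Ok w) {m : ℕ} (hm : A.toList.length ≤ m)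
    (hw : Nat.size m ≤ w) : A.size ≤ 3 * Nat.size m + 2 * A.toList.length := by
  simp only [Fid.toList, List.length_append, List.length_replicate] at *
  unfold Fid.size
  have hdiv : A.bits.length / w ≤ A.bits.length := Nat.div_le_self _ _
  have h1 : arrBits A.cnt ≤ A.cnt.length * Nat.size m + Nat.size A.cnt.length := by
    apply arrBits_le
    intro x hx
    obtain ⟨j, hj, rfl⟩ := List.mem_iff_getElem.1 hx
    rw [← List.getD_eq_getElem _ 0 hj, h.cnt j hj]
    have := List.count_le_length (a := true) (l := A.bits.take ((j + 1) * w))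
    rw [List.length_take] at this
    omega
  have h2 : A.cnt.length * Nat.size m ≤ A.bits.length := by
    calc A.cnt.length * Nat.size m ≤ A.bits.length / w * w := by
          rw [h.len]; exact Nat.mul_le_mul_left _ hw
      _ ≤ _ := Nat.div_mul_le_self _ _
  have h3 : Nat.size A.cnt.length ≤ Nat.size m := Nat.size_le_size (by rw [h.len]; omega)
  have h5 : Nat.size A.zeros + Nat.size A.bits.length ≤ 2 * Nat.size m := by
    have := Nat.size_le_size (show A.zeros ≤ m by omega)
    have := Nat.size_le_size (show A.bits.length ≤ m by omega)
    omega
  omega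

/-! # Wavelet tree -/

/-- A correct wavelet tree with correct counters. -/
def WTree.Ok (w : ℕ) : ℕ → List ℕ → WTree → Prop
  | 0, _, t => t = .nil
  | _ + 1, l, .nil => l = []
  | h + 1, l, .node A t₀ t₁ => l ≠ [] ∧ A.toList = l.map (fun x => x.testBit h) ∧ A.Ok w ∧
      WTree.Ok w h (l.filter fun x => !x.testBit h) t₀ ∧
      WTree.Ok w h (l.filter fun x => x.testBit h) t₁

theorem WTree.Ok.isWTree {w h : ℕ} {l : List ℕ} {t : WTree} (H : t.Ok w h l) : IsWTree h l t := by
  induction h generalizing l t with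
  | zero => exact H
  | succ h ih =>
    cases t with
    | nil => exact H
    | node A t₀ t₁ => exact ⟨H.1, H.2.1, ih H.2.2.2.1, ih H.2.2.2.2⟩

theorem WTree.ok_nil (w h : ℕ) : WTree.Ok w h [] .nil := by cases h <;> rfl

theorem WTree.Ok.push {w : ℕ} (hw : 0 < w) (x : ℕ) {h : ℕ} {l : List ℕ} {t : WTree}
    (H : t.Ok w h l) : (WTree.push w x h t).val.Ok w h (l ++ [x]) := by
  induction h generalizing l t with
  | zero => exact H
  | succ h ih =>
    cases t with
    | nil =>
      have H : l = [] := H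
      subst H
      have := ih (l := []) (t := .nil) (WTree.ok_nil w h)
      have hp := (Fid.ok_nil w 0).push hw (x.testBit h)
      have ht : (Fid.push w ⟨0, [], []⟩ (x.testBit h)).val.toList = [x.testBit h] := by
        rw [Fid.toList_push]; rfl
      simp only [WTree.push, Timed.bind_val, op_val]
      cases hb : x.testBit h
      · rw [hb] at hp ht
        simpa [WTree.Ok, hb, hp, ht, WTree.ok_nil] using this
      · rw [hb] at hp ht
        simpa [WTree.Ok, hb, hp, ht, WTree.ok_nil] using this
    | node A t₀ t₁ =>
      obtain ⟨-, h2, h3, h4, h5⟩ := H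
      have hp := h3.push hw (x.testBit h)
      have ht := Fid.toList_push w A (x.testBit h)
      simp only [WTree.push, Timed.bind_val, op_val]
      cases hb : x.testBit h
      · rw [hb] at hp ht
        have := ih h4
        simp [WTree.Ok, hb, hp, ht, h2, h5, this]
      · rw [hb] at hp ht
        have := ih h5
        simp [WTree.Ok, hb, hp, ht, h2, h4, this]

theorem WTree.push_time (w x h : ℕ) (t : WTree) : (WTree.push w x h t).time ≤ 6 * h := by
  induction h generalizing t with
  | zero => simp [WTree.push]
  | succ h ih =>
    cases t with
    | nil =>
      have h1 := Fid.push_time w ⟨0, [], []⟩ (x.testBit h)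
      have h2 := ih .nil
      simp only [WTree.push, Timed.bind_time, op_val, op_time]
      split_ifs <;> simp <;> omega
    | node A l r =>
      have h1 := Fid.push_time w A (x.testBit h)
      have h2 := ih l
      have h3 := ih r
      simp only [WTree.push, Timed.bind_time, op_val, op_time]
      split_ifs <;> simp <;> omega

theorem WTree.push_peak (w x h : ℕ) (t : WTree) : (WTree.push w x h t).peak = 0 := by
  induction h generalizing t with
  | zero => simp [WTree.push]
  | succ h ih =>
    cases t with
    | nil =>
      simp only [WTree.push, Timed.bind_peak, op_val, op_peak, Fid.push_peak, ih]
      split_ifs <;> simp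
    | node A l r =>
      simp only [WTree.push, Timed.bind_peak, op_val, op_peak, Fid.push_peak]
      split_ifs <;> simp [ih]

theorem WTree.access_time (w h : ℕ) (t : WTree) (i : ℕ) :
    (WTree.access w h t i).time ≤ 6 * h := by
  induction h generalizing t i with
  | zero => simp [WTree.access]
  | succ h ih =>
    cases t with
    | nil => simp [WTree.access]
    | node A l r =>
      have h1 := Fid.access_time A i
      have h4 := Fid.rank_time w A i
      simp only [WTree.access, Timed.bind_time]
      split_ifs
      · have := ih r (A.rank w i).val
        simp; omega
      · have := ih l (i - (A.rank w i).val)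
        omega

theorem WTree.access_peak (w h : ℕ) (t : WTree) (i : ℕ) :
    (WTree.access w h t i).peak = 0 := by
  induction h generalizing t i with
  | zero => simp [WTree.access]
  | succ h ih =>
    cases t with
    | nil => simp [WTree.access]
    | node A l r =>
      simp only [WTree.access, Timed.bind_peak, Fid.access_peak, Fid.rank_peak]
      split_ifs <;> simp [ih]

/-- Rank and selection of a filtered list. -/
theorem getD_filter_rank {α : Type*} (d : α) (f : α → Bool) (l : List α) (i : ℕ)
    (hi : i < l.length) (hf : f (l.getD i d) = true) :
    (l.filter f).getD ((l.take i).countP f) d = l.getD i d ∧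
      (l.take i).countP f < (l.filter f).length := by
  induction l generalizing i with
  | nil => simp at hi
  | cons a l ih =>
    cases i with
    | zero => simp at hf; simp [hf]
    | succ i =>
      simp only [List.length_cons, Nat.add_lt_add_iff_right] at hi
      simp only [List.getD_cons_succ] at hf ⊢
      have := ih i hi hf
      by_cases ha : f a = true
      · simp [ha] at this ⊢
        exact this
      · simp [ha] at this ⊢
        exact this

theorem mod_two_pow_succ_testBit (x h : ℕ) :
    x % 2 ^ (h + 1) = (if x.testBit h then 2 ^ h else 0) + x % 2 ^ h := by
  rw [Nat.mod_pow_succ, Nat.testBit_eq_decide_div_mod_eq]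
  rcases Nat.mod_two_eq_zero_or_one (x / 2 ^ h) with h | h <;> simp [h]; ring

/-- A residue is the right form for the induction: a subtree of height `h` knows only the `h`
low-order bits of its symbols. Bit `h` selects the child, and a rank gives the position in the
filtered sequence there. -/
theorem WTree.Ok.access_val {w h : ℕ} {l : List ℕ} {t : WTree} (H : t.Ok w h l) {i : ℕ}
    (hi : i < l.length) : (WTree.access w h t i).val = l.getD i 0 % 2 ^ h := by
  induction h generalizing l t i with
  | zero => simp [WTree.access, Nat.mod_one]
  | succ h ih =>
    cases t with
    | nil =>
      have H : l = [] := H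
      simp [H] at hi
    | node A t₀ t₁ =>
      obtain ⟨-, h2, h3, h4, h5⟩ := H
      have hb : A.toList.getD i false = (l.getD i 0).testBit h := by
        rw [h2, List.getD_eq_getElem _ _ (by simpa using hi), List.getD_eq_getElem _ _ hi]
        simp
      have hr : (A.rank w i).val = (l.take i).countP (fun x => x.testBit h) := by
        rw [h3.rank_val (by rw [h2]; simpa using hi.le), h2, ← List.map_take, List.count,
          List.countP_map]
        congr 1
        funext x
        simp
      simp only [WTree.access, Timed.bind_val, Fid.access_val, hb]
      rw [mod_two_pow_succ_testBit]
      cases hc : (l.getD i 0).testBit h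
      · have := getD_filter_rank 0 (fun x : ℕ => !x.testBit h) l i hi (by simp only [hc]; rfl)
        have hsum : i - (A.rank w i).val = (l.take i).countP (fun x => !x.testBit h) := by
          have := List.length_eq_countP_add_countP (fun x : ℕ => x.testBit h) (l := l.take i)
          rw [List.length_take, min_eq_left hi.le] at this
          simp only [Bool.not_eq_true, Bool.decide_eq_false] at this
          omega
        simp only [Bool.false_eq_true, if_false, zero_add]
        rw [hsum, ih h4 this.2, this.1]
      · have := getD_filter_rank 0 (fun x : ℕ => x.testBit h) l i hi hc
        simp only [if_true, Timed.bind_val, op_val]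
        rw [hr, ih h5 this.2, this.1]

theorem WTree.Ok.nodes_lt {w h : ℕ} {l : List ℕ} {t : WTree} (H : t.Ok w h l) :
    t.nodes + 1 ≤ 2 ^ h := by
  induction h generalizing l t with
  | zero => cases H; simp [WTree.nodes]
  | succ h ih =>
    cases t with
    | nil => simp [WTree.nodes]; exact Nat.one_le_two_pow
    | node A t₀ t₁ =>
      have h1 := ih H.2.2.2.1
      have h2 := ih H.2.2.2.2
      simp only [WTree.nodes, pow_succ]
      omega

theorem length_filter_add (f : ℕ → Bool) (l : List ℕ) :
    (l.filter f).length + (l.filter fun x => !f x).length = l.length := by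
  induction l with
  | nil => rfl
  | cons a l ih => cases h : f a <;> simp [h] <;> omega

/-- The sequences of the two children partition that of their parent, so each of the `h` levels
holds at most `l.length` bits; the factor 2 comes from the counters. -/
theorem WTree.Ok.size_le {w h : ℕ} {l : List ℕ} {t : WTree} (H : t.Ok w h l) {m : ℕ}
    (hm : l.length ≤ m) (hw : Nat.size m ≤ w) (ptr : ℕ) :
    t.size ptr ≤ t.nodes * (3 * Nat.size m + 3 * ptr) + 2 * h * l.length := by
  induction h generalizing l t with
  | zero => cases H; simp [WTree.size]
  | succ h ih =>
    cases t with
    | nil => simp [WTree.size]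
    | node A t₀ t₁ =>
      obtain ⟨-, h2, h3, h4, h5⟩ := H
      have hl := length_filter_add (fun x => x.testBit h) l
      have hA : A.toList.length = l.length := by simp [h2]
      have hs := h3.size_le (hA.trans_le hm) hw
      have h6 := ih h4 (by omega)
      have h7 := ih h5 (by omega)
      simp only [WTree.nodes, WTree.size]
      rw [hA] at hs
      have e : 2 * h * (l.filter fun x => x.testBit h).length +
          2 * h * (l.filter fun x => !x.testBit h).length = 2 * h * l.length := by
        rw [← mul_add, hl]
      nlinarith

/-! # Dynamic wavelet tree -/

structure Dwt.Ok (w : ℕ) (T : Dwt) (l : List ℕ) : Prop where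
  len : T.len = l.length
  lt : ∀ x ∈ l, x < 2 ^ T.h
  tree : T.tree.Ok w T.h l

theorem Dwt.Ok.represents {w : ℕ} {T : Dwt} {l : List ℕ} (H : T.Ok w l) : T.Represents l :=
  ⟨H.len, H.lt, H.tree.isWTree⟩

/-- All old symbols have bit 0 at the new root, so its bit string is a run of zeros of which only
the length is kept. Thus a new level costs one step, however long the sequence is. -/
theorem Dwt.Ok.grow {w : ℕ} {T : Dwt} {l : List ℕ} (H : T.Ok w l) (k : ℕ) :
    (T.grow k).val.Ok w l ∧ (T.grow k).val.h = T.h + k ∧ (T.grow k).val.len = T.len := by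
  induction k with
  | zero => exact ⟨H, rfl, rfl⟩
  | succ k ih =>
    obtain ⟨⟨h1, h2, h3⟩, h4, h5⟩ := ih
    simp only [Dwt.grow, Timed.bind_val]
    have hlt : ∀ x ∈ l, x < 2 ^ ((T.grow k).val.h + 1) := fun x hx =>
      (h2 x hx).trans (Nat.pow_lt_pow_right (by norm_num) (by omega))
    have htb : ∀ x ∈ l, x.testBit (T.grow k).val.h = false := fun x hx =>
      Nat.testBit_lt_two_pow (h2 x hx)
    split_ifs with h0
    · have hl : l = [] := List.length_eq_zero_iff.1 (by omega)
      subst hl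
      refine ⟨⟨by simp, by simp, WTree.ok_nil _ _⟩, by simp; omega, by simp; omega⟩
    · refine ⟨⟨by simpa using h1, hlt, ?_⟩, by simp; omega, by simp [h5]⟩
      refine ⟨?_, ?_, Fid.ok_nil _ _, ?_, ?_⟩
      · rintro rfl; exact h0 (by simpa using h1)
      · simp only [Fid.toList, List.append_nil]
        rw [h1]
        symm
        rw [List.eq_replicate_iff]
        refine ⟨by simp, ?_⟩
        intro b hb
        obtain ⟨x, hx, rfl⟩ := List.mem_map.1 hb
        exact htb x hx
      · have : (l.filter fun x => !x.testBit (T.grow k).val.h) = l :=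
          List.filter_eq_self.2 fun x hx => by simp [htb x hx]
        rw [this]; exact h3
      · have : (l.filter fun x => x.testBit (T.grow k).val.h) = [] :=
          List.filter_eq_nil_iff.2 fun x hx => by simp [htb x hx]
        rw [this]; exact WTree.ok_nil _ _

theorem Dwt.grow_time (T : Dwt) (k : ℕ) : (T.grow k).time = k := by
  induction k with
  | zero => rfl
  | succ k ih =>
    simp only [Dwt.grow, Timed.bind_time]
    split_ifs <;> simp [ih]

theorem Dwt.grow_peak (T : Dwt) (k : ℕ) : (T.grow k).peak = 0 := by
  induction k with
  | zero => rfl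
  | succ k ih =>
    simp only [Dwt.grow, Timed.bind_peak]
    split_ifs <;> simp [ih]

theorem Dwt.Ok.push {w : ℕ} (hw : 0 < w) {T : Dwt} {l : List ℕ} (H : T.Ok w l) (x : ℕ) :
    (T.push w x).val.Ok w (l ++ [x]) ∧ (T.push w x).val.h = max T.h (Nat.size x) ∧
      (T.push w x).time ≤ 8 * max T.h (Nat.size x) + 2 := by
  obtain ⟨⟨h1, h2, h3⟩, h4, h5⟩ := H.grow (Nat.size x - T.h)
  have hh : (T.grow (Nat.size x - T.h)).val.h = max T.h (Nat.size x) := by omega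
  simp only [Dwt.push, Timed.bind_val, op_val, Timed.bind_time, op_time, Dwt.grow_time, hh] at *
  refine ⟨⟨by simp [h1], ?_, h3.push hw x⟩, by simp, ?_⟩
  · intro y hy
    rcases List.mem_append.1 hy with hy | hy
    · exact h2 y hy
    · rw [List.mem_singleton.1 hy]
      exact Nat.size_le.1 (le_max_right _ _)
  · have := WTree.push_time w x (max T.h (Nat.size x)) (T.grow (Nat.size x - T.h)).val.tree
    omega

theorem Dwt.push_peak (w : ℕ) (T : Dwt) (x : ℕ) : (T.push w x).peak = 0 := by
  simp [Dwt.push, Dwt.grow_peak, WTree.push_peak]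

theorem Dwt.Ok.access_val {w : ℕ} {T : Dwt} {l : List ℕ} (H : T.Ok w l) {i : ℕ}
    (hi : i < l.length) : (T.access w i).val = l.getD i 0 := by
  rw [Dwt.access, H.tree.access_val hi, Nat.mod_eq_of_lt]
  rw [List.getD_eq_getElem _ _ hi]
  exact H.lt _ (List.getElem_mem hi)

theorem Dwt.Ok.size_le {w : ℕ} {T : Dwt} {l : List ℕ} (H : T.Ok w l) {m : ℕ}
    (hm : l.length ≤ m) (hw : Nat.size m ≤ w) :
    T.size ≤ 2 ^ T.h * (3 * Nat.size m + 3 * (T.h + 1)) + 2 * T.h * l.length + Nat.size m + T.h := by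
  have h1 := H.tree.nodes_lt
  have h2 := H.tree.size_le hm hw (Nat.size T.tree.nodes)
  have h3 : Nat.size T.tree.nodes ≤ T.h + 1 := by
    refine Nat.size_le.2 (lt_of_lt_of_le ?_ (Nat.pow_le_pow_right (by norm_num) (Nat.le_succ _)))
    omega
  have h4 : Nat.size T.len ≤ Nat.size m := Nat.size_le_size (H.len.trans_le hm)
  have h5 : Nat.size T.h ≤ T.h := Nat.size_le.2 Nat.lt_two_pow_self
  have h6 : T.tree.nodes * (3 * Nat.size m + 3 * Nat.size T.tree.nodes) ≤
      2 ^ T.h * (3 * Nat.size m + 3 * (T.h + 1)) := by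
    gcongr
    omega
  unfold Dwt.size
  omega

theorem Dwt.ok_empty (w : ℕ) : Dwt.Ok w ⟨0, 0, .nil⟩ [] := ⟨rfl, by simp, WTree.ok_nil _ _⟩

/-! # Range minimum tree -/

theorem pairMin_length (l : List ℕ) : (pairMin l).length = l.length / 2 := by
  induction l using pairMin.induct with
  | case1 a b l ih => simp [pairMin, ih]; omega
  | case2 l h =>
    match l, h with
    | [], _ => rfl
    | [a], _ => simp [pairMin]
    | a :: b :: l, h => exact (h a b l rfl).elim

theorem pairMin_getD (l : List ℕ) {k : ℕ} (hk : k < l.length / 2) :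
    (pairMin l).getD k 0 = min (l.getD (2 * k) 0) (l.getD (2 * k + 1) 0) := by
  induction l using pairMin.induct generalizing k with
  | case1 a b l ih =>
    cases k with
    | zero => simp [pairMin]
    | succ k =>
      have := ih (k := k) (by simp at hk; omega)
      simp only [pairMin, List.getD_cons_succ, this]
      rw [show 2 * (k + 1) = 2 * k + 1 + 1 by ring]
      simp only [List.getD_cons_succ]
  | case2 l h =>
    match l, h with
    | [], _ => simp at hk
    | [a], _ => simp at hk
    | a :: b :: l, h => exact (h a b l rfl).elim

/-- The new entry completes a pair exactly if the new length is even; an unpaired last entry has no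
trace on the next level. -/
theorem pairMin_append_singleton (l : List ℕ) (v : ℕ) :
    pairMin (l ++ [v]) = if (l ++ [v]).length % 2 = 0 then
      pairMin l ++ [min ((l ++ [v]).getD ((l ++ [v]).length - 2) 0)
        ((l ++ [v]).getD ((l ++ [v]).length - 1) 0)] else pairMin l := by
  induction l using pairMin.induct with
  | case1 a b l ih =>
    simp only [List.cons_append, pairMin, ih, List.length_cons]
    have h2 : ((l ++ [v]).length + 1 + 1) % 2 = (l ++ [v]).length % 2 := by omega
    simp only [h2]
    split_ifs with h
    · have : 2 ≤ (l ++ [v]).length := by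
        have : (l ++ [v]).length = l.length + 1 := by simp
        omega
      obtain ⟨m, hm⟩ := Nat.exists_eq_add_of_le this
      simp only [hm]
      simp [show 2 + m + 1 + 1 - 2 = m + 2 by omega, show 2 + m - 2 = m by omega,
        show 2 + m + 1 + 1 - 1 = (m + 1) + 2 by omega, show 2 + m - 1 = m + 1 by omega]
    · rfl
  | case2 l h =>
    match l, h with
    | [], _ => simp [pairMin]
    | [a], _ => simp [pairMin]
    | a :: b :: l, h => exact (h a b l rfl).elim

/-- This holds above the top as well: the top level has no pair, and a missing level is read as an
empty one. So the recursion can be used without bounds on `j`. -/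
theorem IsMinTree.getD_succ {ls : List (List ℕ)} (h : IsMinTree ls) (j : ℕ) :
    ls.getD (j + 1) [] = pairMin (ls.getD j []) := by
  induction ls generalizing j with
  | nil => exact h.elim
  | cons l ls ih =>
    cases ls with
    | nil =>
      cases j with
      | zero => exact (show pairMin l = [] from h).symm
      | succ j => simp [pairMin]
    | cons m ls =>
      obtain ⟨h1, -, h3⟩ := h
      cases j with
      | zero => simpa using h1
      | succ j => simpa using ih h3 j

theorem IsMinTree.getD_length {ls : List (List ℕ)} (h : IsMinTree ls) (j : ℕ) :
    (ls.getD j []).length = (ls.getD 0 []).length / 2 ^ j := by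
  induction j with
  | zero => simp
  | succ j ih => rw [h.getD_succ, pairMin_length, ih, Nat.div_div_eq_div_mul, pow_succ]

theorem IsMinTree.getD_ne_nil {ls : List (List ℕ)} (h : IsMinTree ls) (h0 : ls.getD 0 [] ≠ [])
    {j : ℕ} (hj : j < ls.length) : ls.getD j [] ≠ [] := by
  induction ls generalizing j with
  | nil => exact h.elim
  | cons l ls ih =>
    cases j with
    | zero => exact h0
    | succ j =>
      cases ls with
      | nil => simp at hj
      | cons m ls =>
        obtain ⟨-, h2, h3⟩ := h
        simpa using ih h3 (by simpa using h2) (j := j) (by simpa using hj)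

theorem IsMinTree.length_le {ls : List (List ℕ)} (h : IsMinTree ls) (h0 : ls.getD 0 [] ≠ []) :
    ls.length ≤ Nat.size (ls.getD 0 []).length := by
  rcases Nat.eq_zero_or_pos ls.length with h1 | h1
  · omega
  have h2 := h.getD_ne_nil h0 (j := ls.length - 1) (by omega)
  rw [← List.length_pos_iff, h.getD_length] at h2
  have h3 : 2 ^ (ls.length - 1) ≤ (ls.getD 0 []).length := (Nat.div_pos_iff.1 h2).2
  have := Nat.lt_size.2 h3
  omega

theorem IsMinTree.lt_length {ls : List (List ℕ)} (h : IsMinTree ls) {j : ℕ}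
    (hj : 2 ^ j ≤ (ls.getD 0 []).length) : j < ls.length := by
  by_contra hc
  have h1 := h.getD_length j
  rw [List.getD_eq_default _ _ (by omega)] at h1
  have : 0 < (ls.getD 0 []).length / 2 ^ j := Nat.div_pos hj (by positivity)
  simp only [List.length_nil] at h1
  omega

/-- Entry `k` of level `j` is the minimum over a block of `2 ^ j` entries of level 0. Only complete
blocks have an entry, which is the hypothesis `hk`. -/
theorem IsMinTree.le_iff {ls : List (List ℕ)} (h : IsMinTree ls) (v : ℕ) {j k : ℕ}
    (hk : (k + 1) * 2 ^ j ≤ (ls.getD 0 []).length) :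
    (ls.getD j []).getD k 0 ≤ v ↔
      ∃ s, k * 2 ^ j ≤ s ∧ s < (k + 1) * 2 ^ j ∧ (ls.getD 0 []).getD s 0 ≤ v := by
  induction j generalizing k with
  | zero =>
    constructor
    · intro hv; exact ⟨k, by simp, by simp, hv⟩
    · rintro ⟨s, h1, h2, h3⟩
      have : s = k := by simp at h1 h2; omega
      rwa [this] at h3
  | succ j ih =>
    have e1 : (2 * k + 1) * 2 ^ j = k * 2 ^ (j + 1) + 2 ^ j := by rw [pow_succ]; ring
    have e2 : (2 * k + 1 + 1) * 2 ^ j = (k + 1) * 2 ^ (j + 1) := by rw [pow_succ]; ring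
    have e3 : 2 * k * 2 ^ j = k * 2 ^ (j + 1) := by rw [pow_succ]; ring
    have hp : 0 < 2 ^ j := by positivity
    have e4 : (k + 1) * 2 ^ (j + 1) = k * 2 ^ (j + 1) + 2 ^ j + 2 ^ j := by rw [pow_succ]; ring
    rw [h.getD_succ, pairMin_getD, min_le_iff, ih (k := 2 * k) (by omega),
      ih (k := 2 * k + 1) (by omega), e1, e2, e3]
    · constructor
      · rintro (⟨s, h1, h2, h3⟩ | ⟨s, h1, h2, h3⟩)
        · exact ⟨s, h1, by omega, h3⟩
        · exact ⟨s, by omega, h2, h3⟩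
      · rintro ⟨s, h1, h2, h3⟩
        rcases Nat.lt_or_ge s (k * 2 ^ (j + 1) + 2 ^ j) with h4 | h4
        · exact Or.inl ⟨s, h1, h4, h3⟩
        · exact Or.inr ⟨s, h4, h2, h3⟩
    · rw [h.getD_length, Nat.div_div_eq_div_mul, ← pow_succ]
      exact (Nat.le_div_iff_mul_le (by positivity)).2 hk

/-- The change spreads upwards while it completes pairs; if it completes the pair of the top level,
a new top with one entry arises. -/
theorem pushMin_spec (l : List ℕ) (ls : List (List ℕ)) (v : ℕ) (h : IsMinTree (l :: ls)) :
    IsMinTree (pushMin (l :: ls) v).val ∧ (pushMin (l :: ls) v).val.head? = some (l ++ [v]) := by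
  induction ls generalizing l v with
  | nil =>
    have hp := pairMin_append_singleton l v
    have h : pairMin l = [] := h
    simp only [pushMin, Timed.bind_val, op_val] at *
    split_ifs at hp ⊢ with hc
    · simp only [Timed.bind_val, op_val, List.head?_cons, and_true]
      refine ⟨by rw [hp, h]; rfl, by simp, rfl⟩
    · exact ⟨by show pairMin _ = []; rw [hp, h], rfl⟩
  | cons m ls ih =>
    obtain ⟨h1, h2, h3⟩ := h
    have hp := pairMin_append_singleton l v
    rw [pushMin]
    simp only [Timed.bind_val, op_val] at *
    split_ifs at hp ⊢ with hc
    · simp only [Timed.bind_val, op_val, List.head?_cons, and_true]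
      obtain ⟨h4, h5⟩ := ih m (min ((l ++ [v]).getD ((l ++ [v]).length - 2) 0)
        ((l ++ [v]).getD ((l ++ [v]).length - 1) 0)) h3
      revert h4 h5
      generalize (pushMin (m :: ls) _).val = q
      intro h4 h5
      cases q with
      | nil => simp at h5
      | cons a q =>
        simp only [List.head?_cons, Option.some.injEq] at h5
        exact ⟨by rw [h5, hp, h1], by simp [h5], h4⟩
    · exact ⟨⟨by rw [hp, h1], h2, h3⟩, rfl⟩

theorem pushMin_time (ls : List (List ℕ)) (v : ℕ) : (pushMin ls v).time ≤ 3 * ls.length + 1 := by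
  induction ls generalizing v with
  | nil => simp [pushMin]
  | cons l ls ih =>
    rw [pushMin]
    simp only [Timed.bind_time, op_val, op_time, List.length_cons]
    split_ifs
    · have := ih (min ((l ++ [v]).getD ((l ++ [v]).length - 2) 0)
        ((l ++ [v]).getD ((l ++ [v]).length - 1) 0))
      simp only [Timed.bind_time, op_time, op_val]
      omega
    · simp only [op_time]; omega

theorem pushMin_peak (ls : List (List ℕ)) (v : ℕ) : (pushMin ls v).peak = 0 := by
  induction ls generalizing v with
  | nil => simp [pushMin]
  | cons l ls ih =>
    rw [pushMin]
    simp only [Timed.bind_peak, op_val, op_peak]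
    split_ifs <;> simp [ih]

/-! # Succinct tree -/

/-- In every prefix there are at most as many ones as zeros. -/
def Balanced (l : List Bool) : Prop := ∀ i, (l.take i).count true ≤ (l.take i).count false

theorem count_true_add_count_false (l : List Bool) : l.count true + l.count false = l.length := by
  induction l with
  | nil => rfl
  | cons a l ih => cases a <;> simp <;> omega

theorem Balanced.count_le {l : List Bool} (h : Balanced l) : l.count true ≤ l.count false := by
  simpa using h l.length

theorem Balanced.append_singleton {l : List Bool} (h : Balanced l) {b : Bool}
    (hb : b = true → l.count true < l.count false) : Balanced (l ++ [b]) := by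
  intro i
  rcases Nat.lt_or_ge l.length i with hi | hi
  · rw [List.take_of_length_le (by simp; omega)]
    have := h.count_le
    cases b
    · simp; omega
    · have := hb rfl
      simp; omega
  · rw [List.take_append_of_le_length hi]
    exact h i

theorem inits_append_singleton {α : Type*} (l : List α) (b : α) :
    (l ++ [b]).inits = l.inits ++ [l ++ [b]] := by
  simp [List.inits_append]

theorem Succ.Represents.mins_zero {B : Succ} {l : List Bool} (h : B.Represents l) :
    B.mins.getD 0 [] = l.inits.map excess := by
  have := h.2.1
  rw [List.getD_eq_getElem?_getD, ← List.head?_eq_getElem?, this]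
  rfl

theorem Succ.Represents.mins_length {B : Succ} {l : List Bool} (h : B.Represents l) :
    B.mins.length ≤ Nat.size (l.length + 1) := by
  have := h.2.2.length_le (by rw [h.mins_zero]; cases l <;> simp)
  rw [h.mins_zero] at this
  simpa using this

theorem Succ.Represents.minAt_zero {B : Succ} {l : List Bool} (h : B.Represents l) {i : ℕ}
    (hi : i ≤ l.length) : (B.minAt 0 i).val = excess (l.take i) := by
  unfold Succ.minAt
  rw [op_val, h.mins_zero, List.getD_eq_getElem _ _ (by simp; omega)]
  simp

theorem Succ.represents_empty : Succ.empty.Represents [] := ⟨rfl, rfl, rfl⟩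

/-- Balance is needed when a zero is appended: `excess` is a truncated difference, and it grows by
exactly one only if the ones do not outnumber the zeros. -/
theorem Succ.Represents.push {B : Succ} {l : List Bool} (h : B.Represents l) (hl : Balanced l)
    (b : Bool) : (B.push b).val.Represents (l ++ [b]) ∧
      (B.push b).time ≤ 3 * Nat.size (l.length + 1) + 4 := by
  have h0 := h.minAt_zero le_rfl
  have h3 := h.mins_length
  obtain ⟨h1, h2, h4⟩ := h
  obtain ⟨bits, mins⟩ := B
  simp only at h1 h2 h3 h4
  subst h1
  cases mins with
  | nil => simp at h2
  | cons m ms =>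
    simp only [List.head?_cons, Option.some.injEq] at h2
    have hc := hl.count_le
    unfold Succ.push
    simp only [Timed.bind_val, op_val, Timed.bind_time, op_time]
    rw [h0]
    simp only [List.take_length]
    have h5 := pushMin_spec m ms (if b then excess bits - 1 else excess bits + 1) h4
    have h6 := pushMin_time (m :: ms) (if b then excess bits - 1 else excess bits + 1)
    refine ⟨⟨rfl, ?_, h5.1⟩, ?_⟩
    · rw [h5.2, h2, inits_append_singleton, List.map_append]
      congr 2
      unfold excess
      cases b <;> simp <;> omega
    · have : (Succ.minAt ⟨bits, m :: ms⟩ 0 bits.length).time = 1 := rfl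
      omega

theorem Succ.push_peak (B : Succ) (b : Bool) : (B.push b).peak = 0 := by
  simp [Succ.push, Succ.minAt, pushMin_peak]

/-- Zeros plus ones make the position, zeros minus ones the excess; so one stored excess yields both
ranks. -/
theorem Succ.Represents.rank₁_val {B : Succ} {l : List Bool} (h : B.Represents l)
    (hl : Balanced l) {i : ℕ} (hi : i ≤ l.length) :
    (B.rank₁ i).val = (l.take i).count true := by
  unfold Succ.rank₁
  have h1 := hl i
  have h2 := count_true_add_count_false (l.take i)
  rw [List.length_take, min_eq_left hi] at h2
  simp only [Timed.bind_val, op_val, h.minAt_zero hi, excess]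
  omega

theorem Succ.Represents.rank₀_val {B : Succ} {l : List Bool} (h : B.Represents l)
    (hl : Balanced l) {i : ℕ} (hi : i ≤ l.length) :
    (B.rank₀ i).val = (l.take i).count false := by
  unfold Succ.rank₀
  have h1 := hl i
  have h2 := count_true_add_count_false (l.take i)
  rw [List.length_take, min_eq_left hi] at h2
  simp only [Timed.bind_val, op_val, h.minAt_zero hi, excess]
  omega

/-- Bisection with at most `k` ones before `lo` and more than `k` before `hi`. The interval shrinks
to half its length, rounded up, so `f` rounds and a final test suffice for length `2 ^ f`. -/
theorem Succ.selectLoop_spec {B : Succ} {l : List Bool} (h : B.Represents l) (hl : Balanced l)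
    (k : ℕ) (f lo hi : ℕ) (hf : hi - lo ≤ 2 ^ f) (hlo : (l.take lo).count true ≤ k)
    (hhi : k < (l.take hi).count true) (hhl : hi ≤ l.length) :
    let r := (B.selectLoop k (f + 1) lo hi).val
    r < l.length ∧ (l.take r).count true ≤ k ∧ k < (l.take (r + 1)).count true := by
  have mono : ∀ i j, i ≤ j → (l.take i).count true ≤ (l.take j).count true := fun i j hij =>
    (List.take_sublist_take_left hij).count_le true
  induction f generalizing lo hi with
  | zero =>
    have h1 : lo < hi := by
      by_contra hc
      have := mono hi lo (by omega)
      omega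
    simp only [pow_zero] at hf
    simp only [Succ.selectLoop]
    rw [if_neg (by omega)]
    have : lo + 1 = hi := by omega
    simp only [op_val, this]
    exact ⟨by omega, hlo, hhi⟩
  | succ f ih =>
    rw [Succ.selectLoop]
    have h1 : lo < hi := by
      by_contra hc
      have := mono hi lo (by omega)
      omega
    split_ifs with hc
    · simp only [Timed.bind_val, op_val]
      rw [h.rank₁_val hl (by omega)]
      rw [pow_succ] at hf
      split_ifs with hr
      · exact ih _ _ (by omega) hr hhi hhl
      · exact ih _ _ (by omega) hlo (by omega) (by omega)
    · have : lo + 1 = hi := by omega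
      simp only [op_val, this]
      exact ⟨by omega, hlo, hhi⟩

theorem Succ.selectLoop_time (B : Succ) (k f lo hi : ℕ) :
    (B.selectLoop k f lo hi).time ≤ 3 * f := by
  induction f generalizing lo hi with
  | zero => simp [Succ.selectLoop]
  | succ f ih =>
    rw [Succ.selectLoop]
    split_ifs with hc
    · simp only [Timed.bind_time, op_time, op_val, Succ.rank₁, Succ.minAt, Timed.bind_val]
      split_ifs
      · have := ih ((lo + hi) / 2) hi; omega
      · have := ih lo ((lo + hi) / 2); omega
    · simp; omega

theorem Succ.selectLoop_peak (B : Succ) (k f lo hi : ℕ) : (B.selectLoop k f lo hi).peak = 0 := by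
  induction f generalizing lo hi with
  | zero => simp [Succ.selectLoop]
  | succ f ih =>
    rw [Succ.selectLoop]
    split_ifs with hc
    · simp only [Timed.bind_peak, op_peak, op_val, Succ.rank₁, Succ.minAt, Timed.bind_val]
      split_ifs <;> simp [ih]
    · simp

theorem Succ.Represents.select₁_val {B : Succ} {l : List Bool} (h : B.Represents l)
    (hl : Balanced l) {q : ℕ} (hq : q < l.length) (hb : l.getD q false = true) :
    (B.select₁ ((l.take q).count true)).val = q := by
  have mono : ∀ i j, i ≤ j → (l.take i).count true ≤ (l.take j).count true := fun i j hij =>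
    (List.take_sublist_take_left hij).count_le true
  have hstep : (l.take (q + 1)).count true = (l.take q).count true + 1 := by
    rw [List.take_add_one]
    rw [List.getD_eq_getElem _ _ hq] at hb
    simp [List.getElem?_eq_getElem hq, hb]
  unfold Succ.select₁
  rw [h.1]
  have hlast := mono (q + 1) l.length hq
  obtain ⟨h1, h2, h3⟩ := Succ.selectLoop_spec h hl ((l.take q).count true) (Nat.size l.length)
    0 l.length (by simpa using (Nat.lt_size_self l.length).le) (by simp) (by omega) le_rfl
  set r := (B.selectLoop ((l.take q).count true) (Nat.size l.length + 1) 0 l.length).val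
  by_contra hne
  rcases Nat.lt_or_gt_of_ne hne with hlt | hlt
  · have := mono (r + 1) q hlt
    omega
  · have := mono (q + 1) r hlt
    omega

theorem Succ.Represents.select₁_time {B : Succ} {l : List Bool} (h : B.Represents l) (k : ℕ) :
    (B.select₁ k).time ≤ 3 * Nat.size l.length + 3 := by
  have := B.selectLoop_time k (Nat.size B.bits.length + 1) 0 B.bits.length
  rw [h.1] at this
  unfold Succ.select₁
  rw [h.1]
  omega

/-- `r` is the last position before `i` at which `f` is at most `v`. -/
def IsLast (f : ℕ → ℕ) (v i r : ℕ) : Prop := r < i ∧ f r ≤ v ∧ ∀ s, r < s → s < i → v < f s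

/-- The right half is preferred. If its minimum exceeds `v`, no position of it qualifies, and the
last one is in the left half. -/
theorem Succ.descend_spec {B : Succ} (h : IsMinTree B.mins) (v : ℕ) (j k : ℕ)
    (hk : (k + 1) * 2 ^ j ≤ (B.mins.getD 0 []).length)
    (hv : ∃ s, k * 2 ^ j ≤ s ∧ s < (k + 1) * 2 ^ j ∧ (B.mins.getD 0 []).getD s 0 ≤ v) :
    IsLast (fun s => (B.mins.getD 0 []).getD s 0) v ((k + 1) * 2 ^ j) (B.descend v j k).val := by
  induction j generalizing k with
  | zero =>
    obtain ⟨s, h1, h2, h3⟩ := hv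
    have : s = k := by simp at h1 h2; omega
    subst this
    simp only [Succ.descend, pow_zero, mul_one, Timed.pure_val]
    exact ⟨by omega, h3, fun s h4 h5 => by omega⟩
  | succ j ih =>
    have e1 : (2 * k + 1) * 2 ^ j = k * 2 ^ (j + 1) + 2 ^ j := by rw [pow_succ]; ring
    have e2 : (2 * k + 1 + 1) * 2 ^ j = (k + 1) * 2 ^ (j + 1) := by rw [pow_succ]; ring
    have e3 : 2 * k * 2 ^ j = k * 2 ^ (j + 1) := by rw [pow_succ]; ring
    have hp : 0 < 2 ^ j := by positivity
    have e4 : (k + 1) * 2 ^ (j + 1) = k * 2 ^ (j + 1) + 2 ^ j + 2 ^ j := by rw [pow_succ]; ring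
    have key := h.le_iff v (j := j) (k := 2 * k + 1) (by omega)
    simp only [Succ.descend, Timed.bind_val, Succ.minAt, op_val]
    split_ifs with hc
    · have := ih (2 * k + 1) (by omega) (key.1 hc)
      rwa [e2] at this
    · have hno : ∀ s, (2 * k + 1) * 2 ^ j ≤ s → s < (k + 1) * 2 ^ (j + 1) →
          v < (B.mins.getD 0 []).getD s 0 := by
        intro s h1 h2
        by_contra h3
        exact hc (key.2 ⟨s, h1, by omega, by omega⟩)
      obtain ⟨s, h1, h2, h3⟩ := hv
      have hs : s < (2 * k + 1) * 2 ^ j := by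
        by_contra h4
        have := hno s (by omega) h2
        omega
      have := ih (2 * k) (by omega) ⟨s, by omega, hs, h3⟩
      obtain ⟨h5, h6, h7⟩ := this
      refine ⟨by omega, h6, ?_⟩
      intro s hs1 hs2
      rcases Nat.lt_or_ge s ((2 * k + 1) * 2 ^ j) with h8 | h8
      · exact h7 s hs1 h8
      · exact hno s h8 hs2

theorem Succ.descend_time (B : Succ) (v j k : ℕ) : (B.descend v j k).time = j := by
  induction j generalizing k with
  | zero => rfl
  | succ j ih =>
    simp only [Succ.descend, Timed.bind_time, Succ.minAt, op_time, op_val]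
    split_ifs <;> simp [ih] <;> omega

theorem Succ.descend_peak (B : Succ) (v j k : ℕ) : (B.descend v j k).peak = 0 := by
  induction j generalizing k with
  | zero => rfl
  | succ j ih =>
    simp only [Succ.descend, Timed.bind_peak, Succ.minAt, op_peak, op_val]
    split_ifs <;> simp [ih]

/-- Invariant: from the start of block `k` of level `j` up to `i` all values exceed `v`. For odd `k`
the left sibling is examined before going up; for even `k` the parent starts at the same position,
so nothing is skipped. -/
theorem Succ.climb_spec {B : Succ} (h : IsMinTree B.mins) (v i : ℕ) (f j k : ℕ)
    (hf : B.mins.length ≤ f + j)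
    (hi : i ≤ (B.mins.getD 0 []).length) (hk : k * 2 ^ j ≤ i)
    (hno : ∀ s, k * 2 ^ j ≤ s → s < i → v < (B.mins.getD 0 []).getD s 0)
    (hv : ∃ s < i, (B.mins.getD 0 []).getD s 0 ≤ v) :
    IsLast (fun s => (B.mins.getD 0 []).getD s 0) v i (B.climb v f j k).val := by
  -- For `k = 0` the whole prefix would be excluded, against `hv`.
  have hk0 : 0 < k := by
    rcases Nat.eq_zero_or_pos k with rfl | hk0
    · obtain ⟨s, h1, h2⟩ := hv
      have := hno s (by simp) h1
      omega
    · exact hk0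
  -- Some complete block of level `j` lies before `i`, so this level exists and the fuel cannot be
  -- exhausted.
  have hj : j < B.mins.length := h.lt_length
    (le_trans (Nat.le_mul_of_pos_left _ hk0) (hk.trans hi))
  induction f generalizing j k with
  | zero => omega
  | succ f ih =>
    simp only [Succ.climb, Timed.bind_val, Succ.minAt, op_val]
    have hp : 0 < 2 ^ j := by positivity
    have hkk : (k - 1 + 1) * 2 ^ j = k * 2 ^ j := by rw [Nat.sub_add_cancel hk0]
    have key := h.le_iff v (j := j) (k := k - 1) (by omega)
    rw [hkk] at key
    split_ifs with hc
    · obtain ⟨h1, h2, h3⟩ := Succ.descend_spec h v j (k - 1) (by omega) (by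
        rw [hkk]; exact key.1 hc.2)
      rw [hkk] at h1 h3
      refine ⟨by omega, h2, fun s h4 h5 => ?_⟩
      rcases Nat.lt_or_ge s (k * 2 ^ j) with h6 | h6
      · exact h3 s h4 h6
      · exact hno s h6 h5
    · have hle : k / 2 * 2 ^ (j + 1) ≤ k * 2 ^ j := by
        rw [pow_succ, mul_comm (2 ^ j) 2, ← mul_assoc]
        exact Nat.mul_le_mul_right _ (Nat.div_mul_le_self k 2)
      have hno' : ∀ s, k / 2 * 2 ^ (j + 1) ≤ s → s < i → v < (B.mins.getD 0 []).getD s 0 := by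
        intro s h1 h2
        rcases Nat.lt_or_ge s (k * 2 ^ j) with h6 | h6
        · rcases Nat.mod_two_eq_zero_or_one k with hm | hm
          · exfalso
            have : k / 2 * 2 ^ (j + 1) = k * 2 ^ j := by
              rw [pow_succ, mul_comm (2 ^ j) 2, ← mul_assoc, Nat.div_mul_cancel
                (Nat.dvd_of_mod_eq_zero hm)]
            omega
          · by_contra h3
            refine hc ⟨hm, key.2 ⟨s, ?_, h6, by omega⟩⟩
            have : k / 2 * 2 ^ (j + 1) = (k - 1) * 2 ^ j := by
              rw [pow_succ, mul_comm (2 ^ j) 2, ← mul_assoc]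
              congr 1
              omega
            omega
        · exact hno s h6 h2
      have hk0' : 0 < k / 2 := by
        rcases Nat.eq_zero_or_pos (k / 2) with h0 | h0
        · obtain ⟨s, h1, h2⟩ := hv
          have := hno' s (by simp [h0]) h1
          omega
        · exact h0
      exact ih (j + 1) (k / 2) (by omega) (hle.trans hk) hno' hk0' (h.lt_length
        (le_trans (Nat.le_mul_of_pos_left _ hk0') ((hle.trans hk).trans hi)))

theorem Succ.climb_time (B : Succ) (v f j k : ℕ) : (B.climb v f j k).time ≤ 2 * f + j := by
  induction f generalizing j k with
  | zero => simp [Succ.climb]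
  | succ f ih =>
    simp only [Succ.climb, Timed.bind_time, Succ.minAt, op_time, op_val]
    split_ifs
    · rw [Succ.descend_time]; omega
    · have := ih (j + 1) (k / 2); omega

theorem Succ.climb_peak (B : Succ) (v f j k : ℕ) : (B.climb v f j k).peak = 0 := by
  induction f generalizing j k with
  | zero => simp [Succ.climb]
  | succ f ih =>
    simp only [Succ.climb, Timed.bind_peak, Succ.minAt, op_peak, op_val]
    split_ifs <;> simp [ih, Succ.descend_peak]

theorem Succ.Represents.search_val {B : Succ} {l : List Bool} (h : B.Represents l) {v i r : ℕ}
    (hi : i ≤ l.length) (hr : r < i) (hrv : excess (l.take r) ≤ v)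
    (hno : ∀ s, r < s → s < i → v < excess (l.take s)) : (B.search v i).val = r := by
  have hf : ∀ s < i, (B.mins.getD 0 []).getD s 0 = excess (l.take s) := fun s hs =>
    h.minAt_zero (hs.le.trans hi)
  have hlen : (B.mins.getD 0 []).length = l.length + 1 := by rw [h.mins_zero]; simp
  have hmain : IsLast (fun s => (B.mins.getD 0 []).getD s 0) v i (B.search v i).val :=
    Succ.climb_spec h.2.2 v i (B.mins.length + 1) 0 i (by omega) (by omega)
      (by simp) (fun s h1 h2 => by simp at h1; omega) ⟨r, hr, by rw [hf r hr]; exact hrv⟩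
  obtain ⟨h1, h2, h3⟩ := hmain
  simp only at h2 h3
  rw [hf _ h1] at h2
  by_contra hne
  rcases Nat.lt_or_gt_of_ne hne with hlt | hlt
  · have := h3 r hlt hr
    rw [hf r hr] at this
    omega
  · have := hno _ hlt h1
    omega

theorem Succ.Represents.leftChild_time {B : Succ} {l : List Bool} (h : B.Represents l) (i : ℕ) :
    (B.leftChild i).time ≤ 2 * Nat.size (l.length + 1) + 4 := by
  have h1 := h.mins_length
  simp only [Succ.leftChild, Timed.bind_time, Succ.minAt, op_time, op_val, Succ.search]
  have := B.climb_time ((B.mins.getD 0 []).getD i 0 - 1) (B.mins.length + 1) 0 i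
  omega

theorem Succ.leftChild_peak (B : Succ) (i : ℕ) : (B.leftChild i).peak = 0 := by
  simp [Succ.leftChild, Succ.minAt, Succ.search, Succ.climb_peak]

/-! ### Space of the range minimum tree -/

/-- Every level has at most half the length of the one below, so the lengths are bounded by a
geometric sum. -/
theorem sum_map_le_of_pairMin (ls : List (List ℕ)) (h : IsMinTree ls) :
    (ls.map List.length).sum ≤ 2 * (ls.getD 0 []).length := by
  induction ls with
  | nil => exact h.elim
  | cons l ls ih =>
    cases ls with
    | nil => simp; omega
    | cons m ls =>
      have := ih h.2.2
      have h1 := pairMin_length l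
      rw [← h.1] at h1
      simp only [List.map_cons, List.sum_cons, List.getD_cons_zero] at *
      omega

theorem IsMinTree.entry_le {ls : List (List ℕ)} (h : IsMinTree ls) {M : ℕ}
    (hM : ∀ x ∈ ls.getD 0 [], x ≤ M) : ∀ l ∈ ls, ∀ x ∈ l, x ≤ M := by
  have hpm : ∀ l : List ℕ, (∀ x ∈ l, x ≤ M) → ∀ x ∈ pairMin l, x ≤ M := by
    intro l
    induction l using pairMin.induct with
    | case1 a b l ih =>
      intro hl x hx
      simp only [pairMin, List.mem_cons] at hx
      rcases hx with rfl | hx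
      · exact min_le_of_left_le (hl a (by simp))
      · exact ih (fun y hy => hl y (by simp [hy])) x hx
    | case2 l h => intro _ x hx; simp [pairMin] at hx
  induction ls with
  | nil => exact h.elim
  | cons l ls ih =>
    intro l' hl'
    rcases List.mem_cons.1 hl' with rfl | hl'
    · simpa using hM
    · cases ls with
      | nil => simp at hl'
      | cons m ls =>
        refine ih h.2.2 ?_ l' hl'
        simp only [List.getD_cons_zero] at hM ⊢
        rw [h.1]
        exact hpm l hM

theorem sum_arrBits_le (ls : List (List ℕ)) {M N : ℕ} (h : ∀ l ∈ ls, ∀ x ∈ l, x ≤ M)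
    (hN : ∀ l ∈ ls, l.length ≤ N) :
    (ls.map arrBits).sum ≤ (ls.map List.length).sum * Nat.size M + ls.length * Nat.size N := by
  induction ls with
  | nil => simp
  | cons l ls ih =>
    have h1 := ih (fun l' hl' => h l' (by simp [hl'])) (fun l' hl' => hN l' (by simp [hl']))
    have h2 := arrBits_le (h l (by simp))
    have h3 := Nat.size_le_size (hN l (by simp))
    simp only [List.map_cons, List.sum_cons, List.length_cons]
    nlinarith

theorem Succ.Represents.size_le {B : Succ} {l : List Bool} (h : B.Represents l) :
    B.size ≤ 2 * (l.length + 1) * Nat.size (l.length + 1) +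
      (Nat.size (l.length + 1)) ^ 2 + 2 * Nat.size (l.length + 1) + l.length := by
  have h1 := h.mins_length
  have h2 := sum_map_le_of_pairMin _ h.2.2
  have hlen : (B.mins.getD 0 []).length = l.length + 1 := by rw [h.mins_zero]; simp
  rw [hlen] at h2
  have h3 : ∀ x ∈ B.mins.getD 0 [], x ≤ l.length + 1 := by
    rw [h.mins_zero]
    intro x hx
    obtain ⟨y, hy, rfl⟩ := List.mem_map.1 hx
    have hy : y <+: l := (List.mem_inits _ _).1 hy
    have := hy.length_le
    have := List.count_le_length (a := false) (l := y)
    unfold excess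
    omega
  have h4 : ∀ m ∈ B.mins, m.length ≤ l.length + 1 := by
    intro m hm
    obtain ⟨j, hj, rfl⟩ := List.mem_iff_getElem.1 hm
    rw [← List.getD_eq_getElem _ [] hj, h.2.2.getD_length, hlen]
    exact Nat.div_le_self _ _
  have h5 := sum_arrBits_le _ (h.2.2.entry_le h3) h4
  unfold Succ.size
  rw [h.1]
  have h6 : Nat.size B.mins.length ≤ Nat.size (l.length + 1) := by
    refine Nat.size_le_size (h1.trans ?_)
    exact Nat.size_le.2 Nat.lt_two_pow_self
  have h7 : Nat.size l.length ≤ Nat.size (l.length + 1) := Nat.size_le_size (by omega)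
  nlinarith [Nat.mul_le_mul_right (Nat.size (l.length + 1)) h2,
    Nat.mul_le_mul_right (Nat.size (l.length + 1)) h1]

/-! # Grammars -/

/-- The rules of a grammar without repeated right-hand sides, in post-order. -/
structure RulesOk (σ : ℕ) (D : List (ℕ × ℕ)) : Prop where
  nodup : D.Nodup
  lt : ∀ k x y, D[k]? = some (x, y) → x < σ + k ∧ y < σ + k

theorem Rule.append {σ : ℕ} {D : List (ℕ × ℕ)} {z x y : ℕ} (h : Rule σ D z x y)
    (E : List (ℕ × ℕ)) : Rule σ (D ++ E) z x y := by
  refine ⟨h.1, ?_⟩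
  rw [List.getElem?_append_left (List.getElem?_eq_some_iff.1 h.2).1, h.2]

theorem Yields.append {σ : ℕ} {D : List (ℕ × ℕ)} {x : ℕ} {u : List ℕ} (h : Yields σ D x u)
    (E : List (ℕ × ℕ)) : Yields σ (D ++ E) x u := by
  induction h with
  | term x hx => exact .term x hx
  | var z x y u v hr _ _ ih1 ih2 => exact .var z x y u v (hr.append E) ih1 ih2

theorem Poppt.append {σ : ℕ} {D : List (ℕ × ℕ)} {m x m' : ℕ} {l : List Node}
    (h : Poppt σ D m x l m') (E : List (ℕ × ℕ)) : Poppt σ (D ++ E) m x l m' := by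
  induction h with
  | leaf m x hx => exact .leaf m x hx
  | inner m m₁ m₂ x y l₁ l₂ hr _ _ ih1 ih2 => exact .inner m m₁ m₂ x y l₁ l₂ (hr.append E) ih1 ih2

theorem BlockRoot.append {σ : ℕ} {D : List (ℕ × ℕ)} {l : List ℕ} {z : ℕ}
    (h : BlockRoot σ D l z) (E : List (ℕ × ℕ)) : BlockRoot σ (D ++ E) l z := by
  cases h with
  | one => exact .one _
  | two x y z h => exact .two x y z (h.append E)
  | three x y w y' z h1 h2 => exact .three x y w y' z (h1.append E) (h2.append E)

/-! # Post-order partial parse trees -/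

/-- The symbol at a node. -/
def Node.sym : Node → ℕ
  | .leaf x => x
  | .inner x => x

theorem Poppt.getLast {σ : ℕ} {D : List (ℕ × ℕ)} {m x m' : ℕ} {l : List Node}
    (h : Poppt σ D m x l m') : ∃ l' nd, l = l' ++ [nd] ∧ Node.sym nd = x := by
  cases h with
  | leaf => exact ⟨[], .leaf x, rfl, rfl⟩
  | inner => exact ⟨_, _, rfl, rfl⟩

theorem Poppt.count_eq {σ : ℕ} {D : List (ℕ × ℕ)} {m x m' : ℕ} {l : List Node}
    (h : Poppt σ D m x l m') :
    (l.map Node.bit).count false = (l.map Node.bit).count true + 1 := by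
  induction h with
  | leaf => rfl
  | inner m m₁ m₂ x y l₁ l₂ hr _ _ ih1 ih2 => simp [Node.bit] at *; omega

/-- A nonempty prefix of a post-order traversal is a nonempty sequence of complete subtrees, and
each of these has one leaf more than internal nodes. This is what locates the start of a right
subtree by its excess. -/
theorem Poppt.count_lt {σ : ℕ} {D : List (ℕ × ℕ)} {m x m' : ℕ} {l : List Node}
    (h : Poppt σ D m x l m') (i : ℕ) (hi : 0 < i) :
    ((l.map Node.bit).take i).count true < ((l.map Node.bit).take i).count false := by
  induction h generalizing i with
  | leaf => cases i <;> simp [Node.bit] at *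
  | inner m m₁ m₂ x y l₁ l₂ hr h1 h2 ih1 ih2 =>
    have c1 := h1.count_eq
    have c2 := h2.count_eq
    simp only [List.map_append, List.append_assoc]
    rw [List.take_append, List.count_append, List.count_append]
    rcases Nat.lt_or_ge (l₁.map Node.bit).length i with hi1 | hi1
    · rw [List.take_of_length_le hi1.le]
      set i' := i - (l₁.map Node.bit).length with hi'
      rw [List.take_append, List.count_append, List.count_append]
      rcases Nat.lt_or_ge (l₂.map Node.bit).length i' with hi2 | hi2
      · rw [List.take_of_length_le hi2.le, List.take_of_length_le (by simp at *; omega)]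
        simp [Node.bit] at *
        omega
      · have e : i' - (l₂.map Node.bit).length = 0 := by omega
        rw [e]
        have := ih2 i' (by omega)
        simp at *
        omega
    · have e : i - (l₁.map Node.bit).length = 0 := by omega
      rw [e]
      simpa using ih1 i hi

/-- The traversed part of a post-order partial parse tree. -/
structure TreeOk (σ : ℕ) (D : List (ℕ × ℕ)) (T : List Node) : Prop where
  bal : Balanced (T.map Node.bit)
  num : ∀ q x, T[q]? = some (.inner x) → x = σ + ((T.take q).map Node.bit).count true
  dec : ∀ k x y, D[k]? = some (x, y) → ∃ A l₁ l₂ E m₀ m₁,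
    T = A ++ (l₁ ++ (l₂ ++ .inner (σ + k) :: E)) ∧
      Poppt σ D m₀ x l₁ m₁ ∧ Poppt σ D m₁ y l₂ k

/-- The part of the index without the hash table is correct. -/
structure BaseOk (P : Par) (D : List (ℕ × ℕ)) (T : List Node) (I : Index) : Prop where
  B : I.B.Represents (T.map Node.bit)
  L : I.L.Ok P.w (T.filterMap Node.leafLabel?)
  Lh : I.L.h ≤ Nat.size (P.σ + D.length)
  R : List.Forall₂ (fun k r => ∃ u, Yields P.σ D (P.σ + k) u ∧ u.length = r)
      (List.range D.length) I.R

theorem BaseOk.R_length {P : Par} {D : List (ℕ × ℕ)} {T : List Node} {I : Index}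
    (h : BaseOk P D T I) : I.R.length = D.length := by
  simpa using h.R.length_eq.symm

theorem filterMap_leafLabel_length (T : List Node) :
    (T.filterMap Node.leafLabel?).length = (T.map Node.bit).count false := by
  induction T with
  | nil => rfl
  | cons a T ih => cases a <;> simp [List.filterMap_cons, Node.leafLabel?, Node.bit, ih]

/-- Both kinds of labels are found by ranks: an internal node is numbered by the internal nodes
before it, and the label of a leaf is stored at the number of leaves before it. -/
theorem Index.symAt_val {P : Par} {D : List (ℕ × ℕ)} {T : List Node} {I : Index}
    (hT : TreeOk P.σ D T) (h : BaseOk P D T I) {q : ℕ} {nd : Node} (hq : T[q]? = some nd) :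
    (I.symAt P q).val = nd.sym := by
  obtain ⟨hlt, hnd⟩ := List.getElem?_eq_some_iff.1 hq
  have hb : I.B.bits.getD q false = nd.bit := by
    rw [h.B.1, List.getD_eq_getElem _ _ (by simpa using hlt)]
    simp [hnd]
  simp only [Index.symAt, Timed.bind_val, op_val, hb]
  cases nd with
  | inner x =>
    simp only [Node.bit, if_true, Timed.bind_val, op_val, Node.sym]
    rw [h.B.rank₁_val hT.bal (by simpa using hlt.le), hT.num q x hq, List.map_take]
  | leaf x =>
    simp only [Node.bit, Bool.false_eq_true, if_false, Timed.bind_val, Node.sym]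
    rw [h.B.rank₀_val hT.bal (by simpa using hlt.le), ← List.map_take,
      ← filterMap_leafLabel_length]
    have hsplit : T = T.take q ++ .leaf x :: T.drop (q + 1) := by
      rw [← hnd, List.getElem_cons_drop, List.take_append_drop]
    have hf : T.filterMap Node.leafLabel? =
        (T.take q).filterMap Node.leafLabel? ++ x :: (T.drop (q + 1)).filterMap Node.leafLabel? := by
      conv_lhs => rw [hsplit]
      simp [Node.leafLabel?]
    rw [h.L.access_val (by rw [hf]; simp), hf, List.getD_append_right _ _ _ _ le_rfl]
    simp

theorem Index.symAt_time (P : Par) (I : Index) (q : ℕ) : (I.symAt P q).time ≤ 6 * I.L.h + 4 := by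
  simp only [Index.symAt, Timed.bind_time, op_time, op_val]
  split_ifs
  · simp [Succ.rank₁, Succ.minAt]
  · have := WTree.access_time P.w I.L.h I.L.tree (I.B.rank₀ q).val
    simp only [Succ.rank₀, Succ.minAt, Dwt.access, Timed.bind_time, op_time, op_val, Timed.bind_val]
      at this ⊢
    omega

theorem Index.symAt_peak (P : Par) (I : Index) (q : ℕ) : (I.symAt P q).peak = 0 := by
  simp only [Index.symAt, Timed.bind_peak, op_peak, op_val]
  split_ifs <;> simp [Succ.rank₁, Succ.rank₀, Succ.minAt, Dwt.access, WTree.access_peak]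

/-- In post-order the right child directly precedes its parent, and the left child directly precedes
the right subtree. A right subtree raises the excess by one, and inside it the excess never returns
to its starting value; so it begins at the last earlier position with a smaller excess than at the
parent. -/
theorem Index.digram_val {P : Par} {D : List (ℕ × ℕ)} {T : List Node} {I : Index}
    (hT : TreeOk P.σ D T) (h : BaseOk P D T I) {k x y : ℕ} (hk : D[k]? = some (x, y)) :
    (I.digram P k).val = (x, y) := by
  obtain ⟨A, l₁, l₂, E, m₀, m₁, hTe, h1, h2⟩ := hT.dec k x y hk
  have c1 := h1.count_eq
  have c2 := h2.count_eq
  set q := A.length + l₁.length + l₂.length with hq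
  have hTq : T[q]? = some (.inner (P.σ + k)) := by
    rw [hTe, ← List.append_assoc, ← List.append_assoc, List.getElem?_append_right (by simp; omega)]
    simp [hq, Nat.add_assoc]
  have hlt : q < T.length := (List.getElem?_eq_some_iff.1 hTq).1
  have hqb : (T.map Node.bit).getD q false = true := by
    rw [List.getD_eq_getElem?_getD, List.getElem?_map, hTq]; rfl
  have hcount : ((T.map Node.bit).take q).count true = k := by
    have := hT.num _ _ hTq
    rw [List.map_take] at this
    omega
  have hsel : (I.B.select₁ k).val = q := by
    rw [← hcount]
    exact h.B.select₁_val hT.bal (by simpa using hlt) hqb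
  have hmap : T.map Node.bit = A.map Node.bit ++ (l₁.map Node.bit ++
      (l₂.map Node.bit ++ true :: E.map Node.bit)) := by
    rw [hTe]; simp [Node.bit]
  have hA : (A.map Node.bit).count true ≤ (A.map Node.bit).count false := by
    have := hT.bal A.length
    rwa [hmap, List.take_left' (by simp)] at this
  have hpre : ∀ s, q - l₂.length ≤ s → s ≤ q → (T.map Node.bit).take s =
      A.map Node.bit ++ (l₁.map Node.bit ++ (l₂.map Node.bit).take (s - (q - l₂.length))) := by
    intro s hs1 hs2
    rw [hmap, List.take_append, List.take_of_length_le (by simp; omega), List.take_append,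
      List.take_of_length_le (by simp; omega), List.take_append_of_le_length (by simp; omega)]
    simp only [List.length_map]
    rw [show s - A.length - l₁.length = s - (q - l₂.length) by omega]
  have hexq : excess ((T.map Node.bit).take q) - 1 =
      (A.map Node.bit).count false - (A.map Node.bit).count true + 1 := by
    rw [hpre q (by omega) le_rfl, List.take_of_length_le (by simp; omega)]
    unfold excess
    simp only [List.count_append]
    omega
  have hl1 : 0 < l₁.length := by
    obtain ⟨l', nd, rfl, -⟩ := h1.getLast; simp
  have hl2 : 0 < l₂.length := by
    obtain ⟨l', nd, rfl, -⟩ := h2.getLast; simp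
  have hsearch : (I.B.search (excess ((T.map Node.bit).take q) - 1) q).val = q - l₂.length := by
    apply h.B.search_val (by simpa using hlt.le) (by omega)
    · rw [hexq, hpre _ le_rfl (by omega)]
      unfold excess
      simp only [Nat.sub_self, List.take_zero, List.append_nil, List.count_append]
      omega
    -- Such a position cuts the right subtree after a nonempty prefix, where `Poppt.count_lt` gives
    -- a larger excess.
    · intro s hs1 hs2
      rw [hexq, hpre s (by omega) (by omega)]
      have := h2.count_lt (s - (q - l₂.length)) (by omega)
      unfold excess
      simp only [List.count_append]
      omega
  obtain ⟨l₁', nd₁, rfl, hn1⟩ := h1.getLast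
  obtain ⟨l₂', nd₂, rfl, hn2⟩ := h2.getLast
  have hg1 : T[q - (l₂' ++ [nd₂]).length - 1]? = some nd₁ := by
    have : q - (l₂' ++ [nd₂]).length - 1 = (A ++ l₁').length := by simp at hq ⊢; omega
    rw [this, hTe, show A ++ (l₁' ++ [nd₁] ++ ((l₂' ++ [nd₂]) ++ Node.inner (P.σ + k) :: E)) =
      (A ++ l₁') ++ (nd₁ :: ((l₂' ++ [nd₂]) ++ Node.inner (P.σ + k) :: E)) by simp,
      List.getElem?_append_right le_rfl]
    simp
  have hg2 : T[q - 1]? = some nd₂ := by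
    have : q - 1 = (A ++ l₁' ++ [nd₁] ++ l₂').length := by simp at hq ⊢; omega
    rw [this, hTe, show A ++ (l₁' ++ [nd₁] ++ ((l₂' ++ [nd₂]) ++ Node.inner (P.σ + k) :: E)) =
      (A ++ l₁' ++ [nd₁] ++ l₂') ++ (nd₂ :: Node.inner (P.σ + k) :: E) by simp,
      List.getElem?_append_right le_rfl]
    simp
  simp only [Index.digram, Timed.bind_val, op_val, hsel, Succ.leftChild, Succ.rightChild,
    h.B.minAt_zero (show q ≤ (T.map Node.bit).length by simpa using hlt.le), hsearch]
  rw [Index.symAt_val hT h hg1, Index.symAt_val hT h hg2, hn1, hn2]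

theorem Index.digram_time {P : Par} {D : List (ℕ × ℕ)} {T : List Node} {I : Index}
    (h : BaseOk P D T I) {V : ℕ} (hV1 : Nat.size (T.length + 1) ≤ V) (hV2 : I.L.h ≤ V) (k : ℕ) :
    (I.digram P k).time ≤ 17 * V + 17 := by
  have h1 := h.B.select₁_time k
  have h2 := h.B.leftChild_time (I.B.select₁ k).val
  have h3 := I.symAt_time P (I.B.leftChild (I.B.select₁ k).val).val
  have h4 := I.symAt_time P (I.B.rightChild (I.B.select₁ k).val).val
  have h5 : (I.B.rightChild (I.B.select₁ k).val).time = 1 := rfl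
  simp only [List.length_map] at h1 h2
  have h6 : Nat.size T.length ≤ Nat.size (T.length + 1) := Nat.size_le_size (by omega)
  simp only [Index.digram, Timed.bind_time, op_time]
  omega

theorem Index.digram_peak (P : Par) (I : Index) (k : ℕ) : (I.digram P k).peak = 0 := by
  simp [Index.digram, Index.symAt_peak, Succ.leftChild_peak, Succ.select₁, Succ.selectLoop_peak,
    Succ.rightChild]

/-! # Hash table -/

/-- The list of links that starts with `c` visits `l`. -/
inductive IsChain (next : List ℕ) : ℕ → List ℕ → Prop
  | nil : IsChain next 0 []
  | cons (k : ℕ) (l : List ℕ) : k < next.length → IsChain next (next.getD k 0) l →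
      IsChain next (k + 1) (k :: l)

theorem IsChain.chain_eq {next : List ℕ} {c : ℕ} {l : List ℕ} (h : IsChain next c l) {f : ℕ}
    (hf : l.length ≤ f) : chain next f c = l := by
  induction h generalizing f with
  | nil => cases f <;> rfl
  | cons k l hk _ ih =>
    cases f with
    | zero => simp at hf
    | succ f => rw [chain, ih (by simpa using hf)]

theorem IsChain.lt {next : List ℕ} {c : ℕ} {l : List ℕ} (h : IsChain next c l) :
    ∀ k ∈ l, k < next.length := by
  induction h with
  | nil => simp
  | cons k l hk _ ih => intro j hj; rcases List.mem_cons.1 hj with rfl | hj; exacts [hk, ih j hj]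

theorem IsChain.congr {next next' : List ℕ} {c : ℕ} {l : List ℕ} (h : IsChain next c l)
    (hl : next.length ≤ next'.length) (he : ∀ k ∈ l, next'.getD k 0 = next.getD k 0) :
    IsChain next' c l := by
  induction h with
  | nil => exact .nil
  | cons k l hk _ ih =>
    refine .cons k l (by omega) ?_
    rw [he k (by simp)]
    exact ih fun j hj => he j (by simp [hj])

theorem length_le_of_nodup_lt {l : List ℕ} {n : ℕ} (hl : l.Nodup) (h : ∀ k ∈ l, k < n) :
    l.length ≤ n := by
  have := (List.Nodup.subperm hl (l₂ := List.range n)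
    (fun k hk => List.mem_range.2 (h k hk))).length_le
  simpa using this

/-- The number of rules at the entry `i` of a hash table with `m` entries. -/
def bucketCount (P : Par) (D : List (ℕ × ℕ)) (m i : ℕ) : ℕ :=
  D.countP fun d => decide (addr m (P.hash d.1 d.2) = i)

/-- The list `l` consists of the rules at the entry `i` of a hash table with `m` entries. -/
def IsBucket (P : Par) (D : List (ℕ × ℕ)) (m i : ℕ) (l : List ℕ) : Prop :=
  l.Nodup ∧ ∀ k, k ∈ l ↔ ∃ x y, D[k]? = some (x, y) ∧ addr m (P.hash x y) = i

theorem IsBucket.lt {P : Par} {D : List (ℕ × ℕ)} {m i : ℕ} {l : List ℕ} (h : IsBucket P D m i l) :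
    ∀ k ∈ l, k < D.length := by
  intro k hk
  obtain ⟨x, y, h1, -⟩ := (h.2 k).1 hk
  exact (List.getElem?_eq_some_iff.1 h1).1

/-- Turns the length of a list into a count over the rules, which can be summed over the hash
functions. -/
theorem IsBucket.length_eq {P : Par} {D : List (ℕ × ℕ)} {m i : ℕ} {l : List ℕ}
    (h : IsBucket P D m i l) : l.length = bucketCount P D m i := by
  have hD : D = (List.range D.length).map (fun k => D.getD k (0, 0)) := by
    apply List.ext_getElem?
    intro k
    rcases Nat.lt_or_ge k D.length with hk | hk
    · simp [hk]
    · simp [hk]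
  set f : ℕ → Bool := fun k => decide (addr m (P.hash (D.getD k (0, 0)).1 (D.getD k (0, 0)).2) = i)
  have hp : l.Perm ((List.range D.length).filter f) := by
    rw [List.perm_ext_iff_of_nodup h.1 (List.nodup_range.filter _)]
    intro k
    rw [h.2, List.mem_filter, List.mem_range]
    constructor
    · rintro ⟨x, y, h1, h2⟩
      refine ⟨(List.getElem?_eq_some_iff.1 h1).1, ?_⟩
      simp only [f, List.getD_eq_getElem?_getD, h1, Option.getD_some, h2, decide_true]
    · rintro ⟨h1, h2⟩
      refine ⟨_, _, List.getElem?_eq_getElem h1, ?_⟩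
      simpa [f, h1] using h2
  rw [hp.length_eq, ← List.countP_eq_length_filter, bucketCount]
  conv_rhs => rw [hD, List.countP_map]
  rfl

/-- The table with `m` entries contains the rules `D`. -/
structure HashOk (P : Par) (D : List (ℕ × ℕ)) (m : ℕ) (heads next : List ℕ) : Prop where
  heads_length : heads.length = m
  next_length : next.length = D.length
  chains : ∀ i < m, ∃ l, IsChain next (heads.getD i 0) l ∧ IsBucket P D m i l

theorem addr_lt {m : ℕ} (hm : 0 < m) (v : ℕ) : addr m v < m := by
  unfold addr
  split_ifs with h
  · exact h
  · refine lt_of_lt_of_le (Nat.mod_lt _ (by positivity)) ?_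
    rw [Nat.log2_eq_log_two]
    exact Nat.pow_log_le_self 2 hm.ne'

/-- Writes addresses of the larger table with the exponent of `m`. The exponent changes only if `m +
1` is a power of two, and then both branches of `addr` are the residue modulo `m + 1`. -/
theorem addr_succ {m : ℕ} (hm : 0 < m) (v : ℕ) :
    addr (m + 1) v = if v % 2 ^ (Nat.log2 m + 1) ≤ m then v % 2 ^ (Nat.log2 m + 1)
      else v % 2 ^ Nat.log2 m := by
  have h1 : 2 ^ Nat.log2 m ≤ m := by rw [Nat.log2_eq_log_two]; exact Nat.pow_log_le_self 2 hm.ne'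
  have h2 : m < 2 ^ (Nat.log2 m + 1) := by
    rw [Nat.log2_eq_log_two]; exact Nat.lt_pow_succ_log_self (by norm_num) m
  have hlt : v % 2 ^ (Nat.log2 m + 1) < 2 ^ (Nat.log2 m + 1) := Nat.mod_lt _ (by positivity)
  unfold addr
  rcases Nat.lt_or_ge (m + 1) (2 ^ (Nat.log2 m + 1)) with h | h
  · have : Nat.log2 (m + 1) = Nat.log2 m := by
      rw [Nat.log2_eq_log_two (n := m + 1)]
      exact Nat.log_eq_of_pow_le_of_lt_pow (by omega) h
    rw [this]
    simp only [Nat.lt_succ_iff]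
  · have hme : m + 1 = 2 ^ (Nat.log2 m + 1) := by omega
    have hlog : Nat.log2 (m + 1) = Nat.log2 m + 1 := by
      rw [Nat.log2_eq_log_two (n := m + 1), hme, Nat.log_pow (by norm_num)]
    rw [hlog, if_pos (show v % 2 ^ (Nat.log2 m + 1) ≤ m by omega)]
    split_ifs with h3
    · rw [hme] at h3
      rw [← Nat.mod_mod_of_dvd v (pow_dvd_pow 2 (Nat.le_succ (Nat.log2 m + 1))),
        Nat.mod_eq_of_lt h3]
    · rfl

/-- A new entry splits one list of the table. -/
theorem addr_succ_cases {m : ℕ} (hm : 0 < m) (v : ℕ) :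
    (addr m v = m - 2 ^ Nat.log2 m ∧
      (addr (m + 1) v = m ∨ addr (m + 1) v = m - 2 ^ Nat.log2 m)) ∨
    (addr m v ≠ m - 2 ^ Nat.log2 m ∧ addr (m + 1) v = addr m v) := by
  have h1 : 2 ^ Nat.log2 m ≤ m := by rw [Nat.log2_eq_log_two]; exact Nat.pow_log_le_self 2 hm.ne'
  have h2 : m < 2 ^ (Nat.log2 m + 1) := by
    rw [Nat.log2_eq_log_two]; exact Nat.lt_pow_succ_log_self (by norm_num) m
  rw [addr_succ hm]
  unfold addr
  rcases Nat.lt_trichotomy (v % 2 ^ (Nat.log2 m + 1)) m with h | h | h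
  · rw [if_pos h, if_pos h.le]
    by_cases h3 : v % 2 ^ (Nat.log2 m + 1) = m - 2 ^ Nat.log2 m
    · exact Or.inl ⟨h3, Or.inr h3⟩
    · exact Or.inr ⟨h3, rfl⟩
  · left
    have : v % 2 ^ Nat.log2 m = m - 2 ^ Nat.log2 m := by
      rw [← Nat.mod_mod_of_dvd v (pow_dvd_pow 2 (Nat.le_succ (Nat.log2 m))), h,
        Nat.mod_eq_sub_mod h1, Nat.mod_eq_of_lt (by rw [pow_succ] at h2; omega)]
    rw [if_neg (by omega), if_pos h.le, this]
    exact ⟨rfl, Or.inl h⟩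
  · rw [if_neg (by omega), if_neg (by omega)]
    by_cases h3 : v % 2 ^ Nat.log2 m = m - 2 ^ Nat.log2 m
    · exact Or.inl ⟨h3, Or.inr h3⟩
    · exact Or.inr ⟨h3, rfl⟩

/-! ### Searching and splitting lists -/

theorem Index.lookupLoop_spec {P : Par} {D : List (ℕ × ℕ)} {I : Index}
    (hd : ∀ k x y, D[k]? = some (x, y) → (I.digram P k).val = (x, y)) (x y : ℕ)
    {c : ℕ} {l : List ℕ} (h : IsChain I.next c l) (hl : ∀ k ∈ l, k < D.length) {f : ℕ}
    (hf : l.length < f) :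
    (∃ k ∈ l, D[k]? = some (x, y) ∧ (I.lookupLoop P x y f c).val = some (P.σ + k)) ∨
      ((∀ k ∈ l, D[k]? ≠ some (x, y)) ∧ (I.lookupLoop P x y f c).val = none) := by
  induction h generalizing f with
  | nil =>
    right
    cases f <;> exact ⟨by simp, rfl⟩
  | cons k l hk _ ih =>
    cases f with
    | zero => simp at hf
    | succ f =>
      obtain ⟨x', y', hxy⟩ : ∃ x' y', D[k]? = some (x', y') :=
        ⟨_, _, List.getElem?_eq_getElem (hl k (by simp))⟩
      simp only [Index.lookupLoop, Timed.bind_val, hd _ _ _ hxy]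
      by_cases he : (x', y') = (x, y)
      · left
        rw [if_pos he]
        exact ⟨k, by simp, by rw [hxy, he], rfl⟩
      · rw [if_neg he]
        simp only [Timed.bind_val, op_val]
        rcases ih (fun j hj => hl j (by simp [hj])) (f := f) (by simpa using hf) with
          ⟨j, h1, h2, h3⟩ | ⟨h1, h2⟩
        · exact Or.inl ⟨j, by simp [h1], h2, h3⟩
        · refine Or.inr ⟨?_, h2⟩
          intro j hj
          rcases List.mem_cons.1 hj with rfl | hj
          · rw [hxy]; exact fun h => he (Option.some.inj h)
          · exact h1 j hj

theorem Index.lookupLoop_time {P : Par} {I : Index} {V : ℕ} (hd : ∀ k, (I.digram P k).time ≤ V)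
    (x y : ℕ) {c : ℕ} {l : List ℕ} (h : IsChain I.next c l) (f : ℕ) :
    (I.lookupLoop P x y f c).time ≤ l.length * (V + 1) + 1 := by
  induction h generalizing f with
  | nil => cases f <;> simp [Index.lookupLoop]
  | cons k l hk _ ih =>
    cases f with
    | zero => simp [Index.lookupLoop]
    | succ f =>
      have h1 := hd k
      have h2 := ih f
      simp only [Index.lookupLoop, Timed.bind_time, List.length_cons, add_mul]
      split_ifs
      · simp only [op_time]; omega
      · simp only [Timed.bind_time, op_time, op_val]; omega

theorem Index.lookupLoop_peak (P : Par) (I : Index) (x y f c : ℕ) :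
    (I.lookupLoop P x y f c).peak = 0 := by
  induction f generalizing c with
  | zero => simp [Index.lookupLoop]
  | succ f ih =>
    cases c with
    | zero => simp [Index.lookupLoop]
    | succ k =>
      simp only [Index.lookupLoop, Timed.bind_peak, Index.digram_peak]
      split_ifs <;> simp [ih]

theorem Index.lookup_peak (P : Par) (I : Index) (x y : ℕ) : (I.lookup P x y).peak = 0 := by
  simp [Index.lookup, Index.lookupLoop_peak]

/-- The answer does not mention the hash function, although the list searched depends on it. This is
why one abstract run serves all hash functions. -/
theorem Index.lookup_val {P : Par} {D : List (ℕ × ℕ)} {T : List Node} {I : Index} {m : ℕ}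
    (hD : D.Nodup) (hT : TreeOk P.σ D T) (h : BaseOk P D T I) (hm : 0 < m)
    (hH : HashOk P D m I.heads I.next) (x y : ℕ) :
    (I.lookup P x y).val = if (x, y) ∈ D then some (P.σ + D.idxOf (x, y)) else none := by
  obtain ⟨l, hl1, hl2⟩ := hH.chains _ (addr_lt hm (P.hash x y))
  have hlen : l.length < I.n + 1 := by
    have := length_le_of_nodup_lt hl2.1 hl2.lt
    rw [Index.n, h.R_length]; omega
  simp only [Index.lookup, Timed.bind_val, op_val, hH.heads_length]
  rcases Index.lookupLoop_spec (fun k x y hk => Index.digram_val hT h hk) x y hl1 hl2.lt hlen with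
    ⟨k, -, h2, h3⟩ | ⟨h1, h2⟩
  · obtain ⟨hk, hk2⟩ := List.getElem?_eq_some_iff.1 h2
    rw [h3, if_pos (hk2 ▸ List.getElem_mem hk)]
    congr 2
    rw [← hk2, hD.idxOf_getElem]
  · rw [h2, if_neg]
    intro hmem
    obtain ⟨k, hk, hk2⟩ := List.mem_iff_getElem.1 hmem
    have hk3 : D[k]? = some (x, y) := by rw [List.getElem?_eq_getElem hk, hk2]
    exact h1 k ((hl2.2 k).2 ⟨x, y, hk3, rfl⟩) hk3

theorem Index.lookup_time {P : Par} {D : List (ℕ × ℕ)} {T : List Node} {I : Index} {m : ℕ}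
    (h : BaseOk P D T I) (hm : 0 < m)
    (hH : HashOk P D m I.heads I.next) {V : ℕ} (hV1 : Nat.size (T.length + 1) ≤ V)
    (hV2 : I.L.h ≤ V) (x y : ℕ) :
    (I.lookup P x y).time ≤ bucketCount P D m (addr m (P.hash x y)) * (17 * V + 18) + 3 := by
  obtain ⟨l, hl1, hl2⟩ := hH.chains _ (addr_lt hm (P.hash x y))
  have := Index.lookupLoop_time (fun k => Index.digram_time h hV1 hV2 k) x y hl1 (I.n + 1)
  rw [hl2.length_eq, show 17 * V + 17 + 1 = 17 * V + 18 from rfl] at this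
  simp only [Index.lookup, Timed.bind_time, op_val, op_time, hH.heads_length]
  omega

/-- Each entry is taken off the old list and put in front of one of two new ones by overwriting its
link. The remaining list and the two new lists stay disjoint, so this link belongs to none of the
other entries, and links outside the old list do not change. -/
theorem Index.splitLoop_spec {P : Par} {D : List (ℕ × ℕ)} {I : Index}
    (hd : ∀ k x y, D[k]? = some (x, y) → (I.digram P k).val = (x, y)) (m i : ℕ)
    (f c c₀ c₁ : ℕ) (next l l₀ l₁ : List ℕ) (h : IsChain next c l) (h0 : IsChain next c₀ l₀)
    (h1 : IsChain next c₁ l₁) (hn : (l ++ (l₀ ++ l₁)).Nodup) (hl : ∀ k ∈ l, k < D.length)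
    (hf : l.length ≤ f) :
    let r := (I.splitLoop P m i f c c₀ c₁ next).val
    ∃ l₀' l₁', IsChain r.2.2 r.1 l₀' ∧ IsChain r.2.2 r.2.1 l₁' ∧ (l₀' ++ l₁').Nodup ∧
      r.2.2.length = next.length ∧ (∀ k, k ∉ l → r.2.2.getD k 0 = next.getD k 0) ∧
      (∀ k, k ∈ l₀' ↔ k ∈ l₀ ∨ k ∈ l ∧
        ∃ x y, D[k]? = some (x, y) ∧ addr m (P.hash x y) = i) ∧
      (∀ k, k ∈ l₁' ↔ k ∈ l₁ ∨ k ∈ l ∧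
        ∃ x y, D[k]? = some (x, y) ∧ addr m (P.hash x y) ≠ i) := by
  induction l generalizing f c c₀ c₁ next l₀ l₁ with
  | nil =>
    cases h
    have : (I.splitLoop P m i f 0 c₀ c₁ next).val = (c₀, c₁, next) := by cases f <;> rfl
    simp only [this]
    exact ⟨l₀, l₁, h0, h1, by simpa using hn, trivial, fun _ _ => trivial, by simp, by simp⟩
  | cons k l ih =>
    cases h with
    | cons _ _ hk hc =>
    cases f with
    | zero => simp at hf
    | succ f =>
      obtain ⟨x, y, hxy⟩ : ∃ x' y', D[k]? = some (x', y') :=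
        ⟨_, _, List.getElem?_eq_getElem (hl k (by simp))⟩
      have hset : ∀ (c' j : ℕ), j ≠ k → (next.set k c').getD j 0 = next.getD j 0 := by
        intro c' j hj
        simp [List.getD_eq_getElem?_getD, List.getElem?_set_ne (Ne.symm hj)]
      have hsetk : ∀ c' : ℕ, (next.set k c').getD k 0 = c' := by
        intro c'
        simp [List.getD_eq_getElem?_getD, hk]
      simp only [List.cons_append, List.nodup_cons, List.mem_append, not_or] at hn
      obtain ⟨⟨hk1, hk2, hk3⟩, hn⟩ := hn
      have hne : ∀ (s : List ℕ), k ∉ s → ∀ j ∈ s, j ≠ k := fun s hs j hj e => hs (e ▸ hj)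
      have tr : ∀ {s : List ℕ} {a : ℕ} (c' : ℕ), k ∉ s → IsChain next a s →
          IsChain (next.set k c') a s := fun c' hs h =>
        h.congr (by simp) fun j hj => hset c' j (hne _ hs j hj)
      have hperm : ∀ {a b d : List ℕ}, (a ++ (b ++ d)).Nodup → k ∉ a → k ∉ b → k ∉ d →
          (a ++ (k :: b ++ d)).Nodup ∧ (a ++ (b ++ k :: d)).Nodup := by
        intro a b d h1 h2 h3 h4
        simp only [List.nodup_append, List.nodup_cons, List.cons_append, List.mem_append,
          List.mem_cons, not_or] at *
        grind
      obtain ⟨hp1, hp2⟩ := hperm hn hk1 hk2 hk3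
      simp only [Index.splitLoop, Timed.bind_val, op_val, hd _ _ _ hxy]
      by_cases he : addr m (P.hash x y) = i
      · rw [if_pos he]
        simp only [Timed.bind_val, op_val]
        obtain ⟨l₀', l₁', r1, r2, r3, r4, r5, r6, r7⟩ := ih f (next.getD k 0) (k + 1) c₁
          (next.set k c₀) (k :: l₀) l₁ (tr _ hk1 hc)
          (.cons _ _ (by simpa using hk) (by rw [hsetk]; exact tr _ hk2 h0)) (tr _ hk3 h1) hp1
          (fun j hj => hl j (by simp [hj])) (by simpa using hf)
        refine ⟨l₀', l₁', r1, r2, r3, by simpa using r4, ?_, ?_, ?_⟩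
        · intro j hj
          simp only [List.mem_cons, not_or] at hj
          rw [r5 j hj.2, hset _ _ hj.1]
        · intro j
          rw [r6]
          constructor
          · rintro (h | h)
            · rcases List.mem_cons.1 h with rfl | h
              · exact Or.inr ⟨by simp, x, y, hxy, he⟩
              · exact Or.inl h
            · exact Or.inr ⟨by simp [h.1], h.2⟩
          · rintro (h | ⟨h, h'⟩)
            · exact Or.inl (by simp [h])
            · rcases List.mem_cons.1 h with rfl | h
              · exact Or.inl (by simp)
              · exact Or.inr ⟨h, h'⟩
        · intro j
          rw [r7]
          constructor
          · rintro (h | h)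
            · exact Or.inl h
            · exact Or.inr ⟨by simp [h.1], h.2⟩
          · rintro (h | ⟨h, x', y', h', h''⟩)
            · exact Or.inl h
            · rcases List.mem_cons.1 h with rfl | h
              · rw [hxy] at h'
                cases h'
                exact (h'' he).elim
              · exact Or.inr ⟨h, x', y', h', h''⟩
      · rw [if_neg he]
        simp only [Timed.bind_val, op_val]
        obtain ⟨l₀', l₁', r1, r2, r3, r4, r5, r6, r7⟩ := ih f (next.getD k 0) c₀ (k + 1)
          (next.set k c₁) l₀ (k :: l₁) (tr _ hk1 hc) (tr _ hk2 h0)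
          (.cons _ _ (by simpa using hk) (by rw [hsetk]; exact tr _ hk3 h1)) hp2
          (fun j hj => hl j (by simp [hj])) (by simpa using hf)
        refine ⟨l₀', l₁', r1, r2, r3, by simpa using r4, ?_, ?_, ?_⟩
        · intro j hj
          simp only [List.mem_cons, not_or] at hj
          rw [r5 j hj.2, hset _ _ hj.1]
        · intro j
          rw [r6]
          constructor
          · rintro (h | h)
            · exact Or.inl h
            · exact Or.inr ⟨by simp [h.1], h.2⟩
          · rintro (h | ⟨h, x', y', h', h''⟩)
            · exact Or.inl h
            · rcases List.mem_cons.1 h with rfl | h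
              · rw [hxy] at h'
                cases h'
                exact (he h'').elim
              · exact Or.inr ⟨h, x', y', h', h''⟩
        · intro j
          rw [r7]
          constructor
          · rintro (h | h)
            · rcases List.mem_cons.1 h with rfl | h
              · exact Or.inr ⟨by simp, x, y, hxy, he⟩
              · exact Or.inl h
            · exact Or.inr ⟨by simp [h.1], h.2⟩
          · rintro (h | ⟨h, h'⟩)
            · exact Or.inl (by simp [h])
            · rcases List.mem_cons.1 h with rfl | h
              · exact Or.inl (by simp)
              · exact Or.inr ⟨h, h'⟩

theorem Index.splitLoop_time {P : Par} {I : Index} {V : ℕ} (hd : ∀ k, (I.digram P k).time ≤ V)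
    (m i f c c₀ c₁ : ℕ) (next l : List ℕ) (h : IsChain next c l) (hn : l.Nodup) :
    (I.splitLoop P m i f c c₀ c₁ next).time ≤ l.length * (V + 3) + 1 := by
  induction l generalizing f c c₀ c₁ next with
  | nil => cases h; cases f <;> simp [Index.splitLoop]
  | cons k l ih =>
    cases h with
    | cons _ _ hk hc =>
    cases f with
    | zero => simp [Index.splitLoop]
    | succ f =>
      have h1 := hd k
      rw [List.nodup_cons] at hn
      have tr : ∀ c', IsChain (next.set k c') (next.getD k 0) l := fun c' =>
        hc.congr (by simp) fun j hj => by
          have : k ≠ j := fun e => hn.1 (e ▸ hj)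
          simp [List.getD_eq_getElem?_getD, List.getElem?_set_ne this]
      have h2 := ih f (next.getD k 0) (k + 1) c₁ (next.set k c₀) (tr _) hn.2
      have h3 := ih f (next.getD k 0) c₀ (k + 1) (next.set k c₁) (tr _) hn.2
      simp only [Index.splitLoop, Timed.bind_time, op_val, op_time,
        List.length_cons, add_mul]
      split_ifs
      · simp only [Timed.bind_time, op_time, op_val]; omega
      · simp only [Timed.bind_time, op_time, op_val]; omega

theorem Index.splitLoop_peak (P : Par) (I : Index) (m i f c c₀ c₁ : ℕ) (next : List ℕ) :
    (I.splitLoop P m i f c c₀ c₁ next).peak = 0 := by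
  induction f generalizing c c₀ c₁ next with
  | zero => simp [Index.splitLoop]
  | succ f ih =>
    cases c with
    | zero => simp [Index.splitLoop]
    | succ k =>
      simp only [Index.splitLoop, Timed.bind_peak, op_val, op_peak, Index.digram_peak]
      split_ifs <;> simp [ih]

theorem getD_set_self {α : Type*} {l : List α} {i : ℕ} (h : i < l.length) (a d : α) :
    (l.set i a).getD i d = a := by
  rw [List.getD_eq_getElem?_getD, List.getElem?_set_self h]; rfl

theorem getD_set_ne {α : Type*} {l : List α} {i j : ℕ} (h : i ≠ j) (a d : α) :
    (l.set i a).getD j d = l.getD j d := by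
  rw [List.getD_eq_getElem?_getD, List.getElem?_set_ne h, List.getD_eq_getElem?_getD]

theorem Yields.unique {σ : ℕ} {D : List (ℕ × ℕ)} {x : ℕ} {u v : List ℕ} (hu : Yields σ D x u)
    (hv : Yields σ D x v) : u = v := by
  induction hu generalizing v with
  | term x hx =>
    cases hv with
    | term => rfl
    | var _ _ _ _ _ hr => exact absurd hr.1 (by omega)
  | var z x y u u' hr _ _ ih1 ih2 =>
    cases hv with
    | term _ hx => exact absurd hr.1 (by omega)
    | var _ x' y' w w' hr' h1 h2 =>
      have := hr.2.symm.trans hr'.2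
      simp only [Option.some.injEq, Prod.mk.injEq] at this
      obtain ⟨rfl, rfl⟩ := this
      rw [ih1 h1, ih2 h2]

theorem Poppt.count_true {σ : ℕ} {D : List (ℕ × ℕ)} {m x m' : ℕ} {l : List Node}
    (h : Poppt σ D m x l m') : m' = m + (l.map Node.bit).count true := by
  induction h with
  | leaf => simp [Node.bit]
  | inner m m₁ m₂ x y l₁ l₂ hr _ _ ih1 ih2 => simp [Node.bit]; omega

/-! ### Growth of the tree and of the index -/

theorem TreeOk.nil (σ : ℕ) : TreeOk σ [] [] :=
  ⟨fun i => by simp, by simp, by simp⟩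

theorem TreeOk.push_leaf {σ : ℕ} {D : List (ℕ × ℕ)} {T : List Node} (h : TreeOk σ D T) (x : ℕ) :
    TreeOk σ D (T ++ [.leaf x]) := by
  refine ⟨?_, ?_, ?_⟩
  · rw [List.map_append]
    exact h.bal.append_singleton (by simp [Node.bit])
  · intro q z hq
    rcases Nat.lt_or_ge q T.length with hlt | hge
    · rw [List.getElem?_append_left hlt] at hq
      rw [List.take_append_of_le_length hlt.le]
      exact h.num q z hq
    · rw [List.getElem?_append_right hge] at hq
      cases hc : q - T.length <;> simp [hc] at hq
  · intro k x' y' hk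
    obtain ⟨A, l₁, l₂, E, m₀, m₁, rfl, h1, h2⟩ := h.dec k x' y' hk
    exact ⟨A, l₁, l₂, E ++ [.leaf x], m₀, m₁, by simp, h1, h2⟩

/-- The subtrees of both children end the traversal, so the new node closes them. The ones before it
are as many as the rules, which gives it the next variable as number. -/
theorem TreeOk.push_inner {σ : ℕ} {D : List (ℕ × ℕ)} {A l₁ l₂ : List Node} {x y m₀ m₁ : ℕ}
    (h : TreeOk σ D (A ++ (l₁ ++ l₂))) (h1 : Poppt σ D m₀ x l₁ m₁)
    (h2 : Poppt σ D m₁ y l₂ D.length)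
    (hc : ((A ++ (l₁ ++ l₂)).map Node.bit).count true = D.length) :
    TreeOk σ (D ++ [(x, y)]) (A ++ (l₁ ++ l₂) ++ [.inner (σ + D.length)]) := by
  refine ⟨?_, ?_, ?_⟩
  · rw [List.map_append]
    refine h.bal.append_singleton fun _ => ?_
    have e1 := h1.count_eq
    have e2 := h2.count_eq
    have e3 := h.bal A.length
    rw [List.map_append, List.take_left' (by simp)] at e3
    simp only [List.map_append, List.count_append]
    omega
  · intro q z hq
    rcases Nat.lt_or_ge q (A ++ (l₁ ++ l₂)).length with hlt | hge
    · rw [List.getElem?_append_left hlt] at hq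
      rw [List.take_append_of_le_length hlt.le]
      exact h.num q z hq
    · rw [List.getElem?_append_right hge] at hq
      cases hd : q - (A ++ (l₁ ++ l₂)).length with
      | zero =>
        rw [hd] at hq
        simp only [List.getElem?_cons_zero, Option.some.injEq, Node.inner.injEq] at hq
        rw [show q = (A ++ (l₁ ++ l₂)).length by omega, List.take_left, hc, ← hq]
      | succ => rw [hd] at hq; simp at hq
  · intro k x' y' hk
    rcases Nat.lt_or_ge k D.length with hlt | hge
    · rw [List.getElem?_append_left hlt] at hk
      obtain ⟨A', l₁', l₂', E, n₀, n₁, hT, g1, g2⟩ := h.dec k x' y' hk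
      exact ⟨A', l₁', l₂', E ++ [.inner (σ + D.length)], n₀, n₁, by rw [hT]; simp,
        g1.append _, g2.append _⟩
    · rw [List.getElem?_append_right hge] at hk
      cases hd : k - D.length with
      | zero =>
        rw [hd] at hk
        simp only [List.getElem?_cons_zero, Option.some.injEq, Prod.mk.injEq] at hk
        obtain ⟨rfl, rfl⟩ := hk
        have : k = D.length := by omega
        subst this
        exact ⟨A, l₁, l₂, [], m₀, m₁, by simp, h1.append _, h2.append _⟩
      | succ => simp [hd] at hk

/-- The index is correct, for the rules `D` and the traversed nodes `T`. -/
structure IndexOk (P : Par) (D : List (ℕ × ℕ)) (T : List Node) (I : Index) : Prop where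
  base : BaseOk P D T I
  hash : HashOk P D (max 1 (P.buckets D.length)) I.heads I.next

theorem IndexOk.empty (P : Par) (h0 : P.buckets 0 = 0) : IndexOk P [] [] Index.empty := by
  refine ⟨⟨Succ.represents_empty, Dwt.ok_empty _, Nat.zero_le _, by simp [Index.empty]⟩,
    ?_⟩
  rw [List.length_nil, h0]
  refine ⟨rfl, rfl, fun i hi => ⟨[], ?_, by simp, by simp⟩⟩
  have : i = 0 := by omega
  subst this
  exact .nil

theorem IndexOk.addLeaf {P : Par} {D : List (ℕ × ℕ)} {T : List Node} {I : Index}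
    (h : IndexOk P D T I) (hT : TreeOk P.σ D T) (hw : 0 < P.w) {x : ℕ} (hx : x < P.σ + D.length)
    {V : ℕ} (hV1 : Nat.size (T.length + 1) ≤ V) (hV2 : Nat.size (P.σ + D.length) ≤ V) :
    IndexOk P D (T ++ [.leaf x]) (I.addLeaf P x).val ∧ (I.addLeaf P x).time ≤ 11 * V + 7 := by
  obtain ⟨⟨h1, h2, h3, h4⟩, h5⟩ := h
  have hB := h1.push hT.bal false
  obtain ⟨hL1, hL2, hL3⟩ := h2.push hw x
  have hsx : Nat.size x ≤ Nat.size (P.σ + D.length) := Nat.size_le_size hx.le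
  refine ⟨⟨⟨?_, ?_, ?_, ?_⟩, ?_⟩, ?_⟩
  · simpa [Index.addLeaf, Node.bit] using hB.1
  · simpa [Index.addLeaf, Node.leafLabel?] using hL1
  · simp only [Index.addLeaf, Timed.bind_val, op_val]
    rw [hL2]
    exact max_le h3 hsx
  · simpa [Index.addLeaf] using h4
  · simpa [Index.addLeaf] using h5
  · simp only [Index.addLeaf, Timed.bind_time, op_time]
    have := hB.2
    have h6 : max I.L.h (Nat.size x) ≤ V := max_le (h3.trans hV2) (hsx.trans hV2)
    simp only [List.length_map] at this
    omega

theorem Index.addLeaf_peak (P : Par) (I : Index) (x : ℕ) : (I.addLeaf P x).peak = 0 := by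
  simp [Index.addLeaf, Succ.push_peak, Dwt.push_peak]

theorem HashOk.insert {P : Par} {D : List (ℕ × ℕ)} {m : ℕ} {heads next : List ℕ}
    (h : HashOk P D m heads next) (x y : ℕ) :
    HashOk P (D ++ [(x, y)]) m (heads.set (addr m (P.hash x y)) (D.length + 1))
      (next ++ [heads.getD (addr m (P.hash x y)) 0]) := by
  obtain ⟨h1, h2, h3⟩ := h
  refine ⟨by simpa using h1, by simpa using h2, ?_⟩
  intro i hi
  obtain ⟨l, hl, hb⟩ := h3 i hi
  have hl' : IsChain (next ++ [heads.getD (addr m (P.hash x y)) 0]) (heads.getD i 0) l :=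
    hl.congr (by simp) fun k hk => List.getD_append _ _ _ _ (hl.lt k hk)
  have hkey : ∀ k, (∃ x' y', (D ++ [(x, y)])[k]? = some (x', y') ∧ addr m (P.hash x' y') = i) ↔
      k ∈ l ∨ k = D.length ∧ addr m (P.hash x y) = i := by
    intro k
    rw [hb.2 k]
    rcases Nat.lt_trichotomy k D.length with hk | hk | hk
    · rw [List.getElem?_append_left hk]
      constructor
      · exact Or.inl
      · rintro (h | h)
        · exact h
        · omega
    · subst hk
      simp
    · rw [List.getElem?_eq_none (by simp; omega), List.getElem?_eq_none (by omega)]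
      simp; omega
  have hnm : D.length ∉ l := fun hmem => lt_irrefl _ (hb.lt _ hmem)
  by_cases he : addr m (P.hash x y) = i
  · refine ⟨D.length :: l, ?_, ?_, ?_⟩
    · rw [he, getD_set_self (by omega)]
      refine .cons _ _ (by simp [h2]) ?_
      rw [List.getD_append_right _ _ _ _ (by omega)]
      simpa [h2, he] using hl'
    · exact List.nodup_cons.2 ⟨hnm, hb.1⟩
    · intro k
      rw [hkey k]
      simp [he, or_comm]
  · refine ⟨l, ?_, hb.1, ?_⟩
    · rw [getD_set_ne he]
      exact hl'
    · intro k
      rw [hkey k]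
      simp [he]

/-- By `addr_succ_cases` only the rules with address `m - 2 ^ log2 m` can move, and only to the new
entry `m`. The other lists keep their links, since no rule lies in two lists. -/
theorem Index.enlarge_spec {P : Par} {D : List (ℕ × ℕ)} {T : List Node} {I : Index} {m : ℕ}
    (hT : TreeOk P.σ D T) (h : BaseOk P D T I) (hm : 0 < m)
    (hH : HashOk P D m I.heads I.next) (hb1 : m ≤ max 1 (P.buckets D.length))
    (hb2 : P.buckets D.length ≤ m + 1) {V : ℕ} (hV1 : Nat.size (T.length + 1) ≤ V)
    (hV2 : I.L.h ≤ V) :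
    IndexOk P D T (I.enlarge P).val ∧
      (I.enlarge P).time ≤
        bucketCount P D m (m - 2 ^ Nat.log2 m) * (17 * V + 20) + 8 := by
  have hn : I.n = D.length := h.R_length
  simp only [Index.enlarge, Timed.bind_val, op_val, Timed.bind_time, op_time, hn, hH.heads_length]
  split_ifs with hlt
  · set i := m - 2 ^ Nat.log2 m with hi
    have him : i < m := by
      have : 0 < 2 ^ Nat.log2 m := by positivity
      omega
    obtain ⟨l, hl, hb⟩ := hH.chains i him
    have hdv := fun k x y hk => Index.digram_val (k := k) (x := x) (y := y) hT h hk
    have ht := Index.splitLoop_time (fun k => Index.digram_time h hV1 hV2 k) (m + 1) i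
      (D.length + 1) _ 0 0 I.next l hl hb.1
    have hlen := length_le_of_nodup_lt hb.1 hb.lt
    obtain ⟨l₀, l₁, r1, r2, r3, r4, r5, r6, r7⟩ := Index.splitLoop_spec hdv (m + 1) i
      (D.length + 1) _ 0 0 I.next l [] [] hl .nil .nil (by simpa using hb.1) hb.lt (by omega)
    rw [hb.length_eq] at ht
    refine ⟨⟨⟨h.B, h.L, h.Lh, h.R⟩, ?_⟩, ?_⟩
    · have hmax : max 1 (P.buckets D.length) = m + 1 := by omega
      rw [hmax]
      simp only [Timed.bind_val, op_val]
      set r := (I.splitLoop P (m + 1) i (D.length + 1) (I.heads.getD i 0) 0 0 I.next).val with hr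
      refine ⟨by simp [hH.heads_length], r4.trans hH.next_length, ?_⟩
      rw [List.nodup_append] at r3
      have haddr := addr_succ_cases hm
      intro j hj
      rcases Nat.lt_or_ge j m with hjm | hjm
      · have hget : (I.heads.set i r.1 ++ [r.2.1]).getD j 0 = (I.heads.set i r.1).getD j 0 :=
          List.getD_append _ _ _ _ (by simpa [hH.heads_length] using hjm)
        rw [hget]
        by_cases hji : j = i
        · subst hji
          refine ⟨l₀, ?_, r3.1, ?_⟩
          · rw [getD_set_self (by rw [hH.heads_length]; exact hjm)]
            exact r1
          · intro k
            rw [r6, hb.2]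
            constructor
            · rintro (h | h)
              · simp at h
              · exact h.2
            · rintro ⟨x, y, h1, h2⟩
              refine Or.inr ⟨⟨x, y, h1, ?_⟩, x, y, h1, h2⟩
              rcases haddr (P.hash x y) with ⟨h3, -⟩ | ⟨h3, h4⟩
              · exact h3
              · exact absurd (h4.symm.trans h2) h3
        · obtain ⟨l', hl', hb'⟩ := hH.chains j hjm
          refine ⟨l', ?_, hb'.1, ?_⟩
          · rw [getD_set_ne (Ne.symm hji)]
            -- A rule in both lists would have two addresses.
            refine hl'.congr r4.ge fun k hk => r5 k fun hk' => ?_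
            obtain ⟨x, y, h1, h2⟩ := (hb'.2 k).1 hk
            obtain ⟨x', y', h1', h2'⟩ := (hb.2 k).1 hk'
            rw [h1] at h1'
            cases h1'
            exact hji (h2.symm.trans h2')
          · intro k
            rw [hb'.2]
            refine exists_congr fun x => exists_congr fun y => and_congr_right fun _ => ?_
            rcases haddr (P.hash x y) with ⟨h3, h4⟩ | ⟨h3, h4⟩
            · constructor
              · intro h5; exact absurd (h5.symm.trans h3) hji
              · intro h5
                rcases h4 with h4 | h4
                · omega
                · exact absurd (h5.symm.trans h4) hji
            · rw [h4]
      · have hjm' : j = m := by omega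
        subst hjm'
        refine ⟨l₁, ?_, r3.2.1, ?_⟩
        · rw [List.getD_append_right _ _ _ _ (by simp [hH.heads_length])]
          simpa [hH.heads_length] using r2
        · intro k
          rw [r7, hb.2]
          constructor
          · rintro (h | ⟨⟨x', y', h1', h2'⟩, x, y, h1, h2⟩)
            · simp at h
            · rw [h1] at h1'
              cases h1'
              refine ⟨x', y', h1, ?_⟩
              rcases haddr (P.hash x' y') with ⟨h3, h4⟩ | ⟨h3, h4⟩
              · exact h4.resolve_right h2
              · exact absurd h2' h3
          · rintro ⟨x, y, h1, h2⟩
            right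
            rcases haddr (P.hash x y) with ⟨h3, h4⟩ | ⟨h3, h4⟩
            · exact ⟨⟨x, y, h1, h3⟩, x, y, h1, by omega⟩
            · have := addr_lt hm (P.hash x y)
              omega
    · simp only [Timed.bind_time, op_time, op_val]
      have : (17 * V + 17 + 3) = 17 * V + 20 := rfl
      rw [this] at ht
      omega
  · refine ⟨⟨h, ?_⟩, by simp⟩
    have hmax : max 1 (P.buckets D.length) = m := by omega
    rw [hmax]
    exact hH

theorem Index.enlarge_peak (P : Par) (I : Index) : (I.enlarge P).peak = 0 := by
  simp only [Index.enlarge, Timed.bind_peak, op_peak, op_val]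
  split_ifs <;> simp [Index.splitLoop_peak]

theorem Index.symLen_val {P : Par} {D : List (ℕ × ℕ)} {T : List Node} {I : Index}
    (h : BaseOk P D T I) {x : ℕ} (hx : x < P.σ + D.length) :
    ∃ u, Yields P.σ D x u ∧ u.length = (I.symLen P x).val := by
  unfold Index.symLen
  split_ifs with hlt
  · exact ⟨[x], .term x hlt, rfl⟩
  · obtain ⟨hl, hR⟩ := List.forall₂_iff_get.1 h.R
    have h1 : x - P.σ < I.R.length := by rw [h.R_length]; omega
    obtain ⟨u, h2, h3⟩ := hR (x - P.σ) (by simp; omega) h1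
    simp only [List.get_eq_getElem, List.getElem_range] at h2 h3
    rw [show P.σ + (x - P.σ) = x by omega] at h2
    exact ⟨u, h2, by rw [h3, op_val, List.getD_eq_getElem _ _ h1]⟩

theorem Index.symLen_time (P : Par) (I : Index) (x : ℕ) : (I.symLen P x).time = 1 := by
  unfold Index.symLen; split_ifs <;> rfl

theorem Index.symLen_peak (P : Par) (I : Index) (x : ℕ) : (I.symLen P x).peak = 0 := by
  unfold Index.symLen; split_ifs <;> rfl

/-- The rule is inserted into the table of the old size, which is then enlarged if necessary; so the
cost counts the new rule, but the table size is the one for `D`. -/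
theorem IndexOk.addVar {P : Par} {D : List (ℕ × ℕ)} {T : List Node} {I : Index} {x y : ℕ}
    (h : IndexOk P D T I) (hT : TreeOk P.σ D T)
    (hT' : TreeOk P.σ (D ++ [(x, y)]) (T ++ [.inner (P.σ + D.length)]))
    (hx : x < P.σ + D.length) (hy : y < P.σ + D.length)
    (hb1 : P.buckets D.length ≤ P.buckets (D.length + 1))
    (hb2 : P.buckets (D.length + 1) ≤ P.buckets D.length + 1)
    {V : ℕ} (hV1 : Nat.size (T.length + 2) ≤ V) (hV2 : Nat.size (P.σ + D.length + 1) ≤ V) :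
    IndexOk P (D ++ [(x, y)]) (T ++ [.inner (P.σ + D.length)]) (I.addVar P x y).val ∧
      (I.addVar P x y).time ≤ bucketCount P (D ++ [(x, y)]) (max 1 (P.buckets D.length))
        (max 1 (P.buckets D.length) - 2 ^ Nat.log2 (max 1 (P.buckets D.length))) *
          (17 * V + 20) + 3 * V + 20 := by
  obtain ⟨hbase, hhash⟩ := h
  set m := max 1 (P.buckets D.length) with hmdef
  have hm : 0 < m := by omega
  obtain ⟨hB1, hB2⟩ := hbase.B.push hT.bal true
  obtain ⟨u, hu1, hu2⟩ := Index.symLen_val hbase hx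
  obtain ⟨v, hv1, hv2⟩ := Index.symLen_val hbase hy
  have hins := hhash.insert x y
  set R := I.R ++ [(I.symLen P x).val + (I.symLen P y).val] with hR
  have hRl : R.length = D.length + 1 := by simp [hR, hbase.R_length]
  have hszle : Nat.size (T.length + 1) ≤ V := (Nat.size_le_size (by omega)).trans hV1
  have hnew : BaseOk P (D ++ [(x, y)]) (T ++ [.inner (P.σ + D.length)])
      ⟨(I.B.push true).val, I.L, R, I.heads.set (addr m (P.hash x y)) R.length,
        I.next ++ [I.heads.getD (addr m (P.hash x y)) 0]⟩ := by
    refine ⟨by simpa [Node.bit] using hB1,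
      by simpa [List.filterMap_cons, Node.leafLabel?] using hbase.L, ?_, ?_⟩
    · refine hbase.Lh.trans (Nat.size_le_size ?_)
      simp
    · simp only [List.length_append, List.length_singleton, List.range_succ, hR]
      refine List.rel_append ?_ ?_
      · refine hbase.R.imp fun k r ⟨u, h1, h2⟩ => ⟨u, h1.append _, h2⟩
      · refine .cons ⟨u ++ v, ?_, by simp [hu2, hv2]⟩ .nil
        exact .var _ x y u v ⟨by omega, by simp⟩ (hu1.append _) (hv1.append _)
  have key := Index.enlarge_spec hT' hnew hm
    (by simpa only [hRl] using hins) (by simp; omega) (by simp; omega) (V := V)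
    (by simpa using hV1) (hbase.Lh.trans ((Nat.size_le_size (by omega)).trans hV2))
  simp only [Index.addVar, Timed.bind_val, op_val, Timed.bind_time, op_time, Index.symLen_time,
    hhash.heads_length]
  rw [← hR]
  refine ⟨key.1, ?_⟩
  have := key.2
  simp only [List.length_map] at hB2
  omega

theorem Index.addVar_peak (P : Par) (I : Index) (x y : ℕ) : (I.addVar P x y).peak = 0 := by
  simp [Index.addVar, Succ.push_peak, Index.symLen_peak, Index.enlarge_peak]

/-! # The construction without hash function -/

/-- Rules, visited nodes of the parse tree, and the components of a state of the construction
that do not depend on the hash function. -/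
structure AState where
  D : List (ℕ × ℕ)
  T : List Node
  queue : List ℕ
  stack : List ℕ
  done : ℕ
  levels : List Level
  task : Task

def AState.init : AState := ⟨[], [], [], [], 0, [], .idle⟩

/-- The two topmost symbols of the stack. -/
def AState.top2 (a : AState) : ℕ × ℕ :=
  (a.stack.getD (a.stack.length - 2) 0, a.stack.getD (a.stack.length - 1) 0)

/-- `done` is cut down to the new height: if both replaced symbols are nodes of the tree, then so is
the new symbol, their parent. -/
def AState.replace (a : AState) (D : List (ℕ × ℕ)) (T : List Node) (k j z : ℕ) : AState :=
  { a with
    D := D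
    T := T
    stack := a.stack.take (a.stack.length - 2) ++ [z]
    done := min a.done (a.stack.take (a.stack.length - 2) ++ [z]).length
    task := if j ≤ 1 then .arrive (k + 1) else .merge k (j - 1) }

/-- One step of the construction. -/
def AState.step (σ K : ℕ) (a : AState) : AState :=
  match a.task with
  | .idle => match a.queue with
    | [] => a
    | c :: q => { a with queue := q, stack := a.stack ++ [c], task := .arrive 0 }
  | .arrive k =>
    let r := ((a.levels.getD k (Level.init K)).arrive K (a.stack.getLastD 0)).val
    { a with
      levels := if k < a.levels.length then a.levels.set k r.1 else a.levels ++ [r.1]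
      task := if r.2 = 0 then .idle else .merge k r.2 }
  | .merge k j =>
    if a.top2 ∈ a.D then a.replace a.D a.T k j (σ + a.D.idxOf a.top2)
    else { a with task := .create k j }
  | .create k j =>
    if a.done < a.stack.length then
      { a with T := a.T ++ [.leaf (a.stack.getD a.done 0)], done := a.done + 1 }
    else a.replace (a.D ++ [a.top2]) (a.T ++ [.inner (σ + a.D.length)]) k j (σ + a.D.length)

/-- A sequence of trees in the post-order partial parse tree. -/
inductive Forest (σ : ℕ) (D : List (ℕ × ℕ)) : List ℕ → List Node → ℕ → Prop
  | nil : Forest σ D [] [] 0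
  | snoc (ws : List ℕ) (T : List Node) (m x : ℕ) (l : List Node) (m' : ℕ) :
      Forest σ D ws T m → Poppt σ D m x l m' → Forest σ D (ws ++ [x]) (T ++ l) m'

theorem Forest.append {σ : ℕ} {D : List (ℕ × ℕ)} {ws : List ℕ} {T : List Node} {m : ℕ}
    (h : Forest σ D ws T m) (E : List (ℕ × ℕ)) : Forest σ (D ++ E) ws T m := by
  induction h with
  | nil => exact .nil
  | snoc ws T m x l m' _ hp ih => exact .snoc ws T m x l m' ih (hp.append E)

theorem Forest.snoc_inv {σ : ℕ} {D : List (ℕ × ℕ)} {ws : List ℕ} {x : ℕ} {T : List Node} {m : ℕ}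
    (h : Forest σ D (ws ++ [x]) T m) :
    ∃ T₀ l m₀, T = T₀ ++ l ∧ Forest σ D ws T₀ m₀ ∧ Poppt σ D m₀ x l m := by
  generalize hw : ws ++ [x] = ws' at h
  cases h with
  | nil => simp at hw
  | snoc ws₁ T₁ m₁ x₁ l₁ m' h hp =>
    obtain ⟨rfl, h2⟩ := List.append_inj' hw rfl
    simp only [List.cons.injEq, and_true] at h2
    subst h2
    exact ⟨T₁, l₁, m₁, rfl, h, hp⟩

theorem Forest.count {σ : ℕ} {D : List (ℕ × ℕ)} {ws : List ℕ} {T : List Node} {m : ℕ}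
    (h : Forest σ D ws T m) : (T.map Node.bit).count true = m ∧
      (T.map Node.bit).count false = m + ws.length := by
  induction h with
  | nil => simp
  | snoc ws T m x l m' _ hp ih =>
    have h1 := hp.count_true
    have h2 := hp.count_eq
    simp only [List.map_append, List.count_append, List.length_append, List.length_singleton]
    omega

theorem Forest.length {σ : ℕ} {D : List (ℕ × ℕ)} {ws : List ℕ} {T : List Node} {m : ℕ}
    (h : Forest σ D ws T m) : T.length = 2 * m + ws.length := by
  have h1 := h.count
  have h2 := count_true_add_count_false (T.map Node.bit)
  rw [List.length_map] at h2
  omega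

/-- The symbols that the current task needs are on the stack. -/
def AState.Shape (a : AState) : Prop :=
  match a.task with
  | .idle => True
  | .arrive _ => 1 ≤ a.stack.length
  | .merge _ j => j + 1 ≤ a.stack.length ∧ 1 ≤ j
  | .create _ j => j + 1 ≤ a.stack.length ∧ 1 ≤ j

/-- Invariant of the construction: grammar and partial parse tree. -/
structure AState.Inv (σ K : ℕ) (a : AState) : Prop where
  rules : RulesOk σ a.D
  tree : TreeOk σ a.D a.T
  stack_lt : ∀ x ∈ a.stack, x < σ + a.D.length
  queue_lt : ∀ x ∈ a.queue, x < σ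
  forest : Forest σ a.D (a.stack.take a.done) a.T a.D.length
  done_le : a.done ≤ a.stack.length
  newest : (∀ k j, a.task ≠ .create k j) → a.done ≠ 0 →
    a.stack.getD (a.done - 1) 0 + 1 = σ + a.D.length
  fresh : ∀ k j, a.task = .create k j → a.top2 ∉ a.D
  labels : ∀ v ∈ a.levels, v.labels.length = K + 1

theorem exists_eq_append_pair {l : List ℕ} (h : 2 ≤ l.length) : ∃ S x y, l = S ++ [x, y] := by
  refine ⟨l.take (l.length - 2), l[l.length - 2], l[l.length - 1], ?_⟩
  conv_lhs => rw [← List.take_append_drop (l.length - 2) l]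
  congr 1
  rw [List.drop_eq_getElem_cons (by omega), List.drop_eq_getElem_cons (by omega)]
  simp only [List.cons.injEq, true_and]
  refine ⟨?_, ?_⟩
  · congr 1
    omega
  · simp; omega

theorem AState.top2_eq {a : AState} {S : List ℕ} {x y : ℕ} (h : a.stack = S ++ [x, y]) :
    a.top2 = (x, y) := by
  simp [AState.top2, h]

theorem AState.replace_stack {a : AState} {S : List ℕ} {x y : ℕ} (h : a.stack = S ++ [x, y])
    (D : List (ℕ × ℕ)) (T : List Node) (k j z : ℕ) :
    (a.replace D T k j z).stack = S ++ [z] ∧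
      (a.replace D T k j z).done = min a.done (S.length + 1) := by
  simp [AState.replace, h]

theorem AState.replace_task_ne (a : AState) (D : List (ℕ × ℕ)) (T : List Node) (k j z k' j' : ℕ) :
    (a.replace D T k j z).task ≠ .create k' j' := by
  simp only [AState.replace]
  split_ifs <;> simp

theorem relabel_length (as : List ℕ) (x : ℕ) : (relabel as x).val.length = as.length := by
  induction as generalizing x with
  | nil => rfl
  | cons a as ih => simp [relabel, ih]

theorem relabel_time (as : List ℕ) (x : ℕ) : (relabel as x).time = 2 * as.length + 1 := by
  induction as generalizing x with
  | nil => rfl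
  | cons a as ih => simp [relabel, ih]; ring

theorem relabel_peak (as : List ℕ) (x : ℕ) : (relabel as x).peak = 0 := by
  induction as generalizing x with
  | nil => rfl
  | cons a as ih => simp [relabel, ih]

theorem Level.arrive_labels (K : ℕ) (v : Level) (x : ℕ) :
    (v.arrive K x).val.1.labels = (relabel v.labels x).val := by
  simp [Level.arrive]

theorem Level.arrive_time (K : ℕ) (v : Level) (x : ℕ) :
    (v.arrive K x).time = 2 * v.labels.length + 12 := by
  simp [Level.arrive, relabel_time]; ring

theorem Level.arrive_peak (K : ℕ) (v : Level) (x : ℕ) : (v.arrive K x).peak = 0 := by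
  simp [Level.arrive, relabel_peak]

theorem AState.Inv.labels_getD {σ K : ℕ} {a : AState} (h : a.Inv σ K) (k : ℕ) :
    (a.levels.getD k (Level.init K)).labels.length = K + 1 := by
  rcases Nat.lt_or_ge k a.levels.length with hk | hk
  · rw [List.getD_eq_getElem _ _ hk]
    exact h.labels _ (List.getElem_mem hk)
  · rw [List.getD_eq_default _ _ hk]
    simp [Level.init]

/-- By `newest` the topmost done symbol is the variable created last. The children of a rule are
older than the variable of the rule, so this symbol occurs in no right-hand side and is not one of
`x`, `y`. Hence a repeated occurrence replaces only symbols that are not nodes, and it can later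
become a leaf. -/
theorem AState.Inv.done_lt {σ K : ℕ} {a : AState} (h : a.Inv σ K)
    (ht : ∀ k j, a.task ≠ .create k j) {S : List ℕ} {x y : ℕ} (hs : a.stack = S ++ [x, y])
    (hm : (x, y) ∈ a.D) : a.done ≤ S.length := by
  obtain ⟨k, hk, hk2⟩ := List.mem_iff_getElem.1 hm
  have hlt := h.rules.lt k x y (by rw [List.getElem?_eq_getElem hk, hk2])
  have hle := h.done_le
  rw [hs] at hle
  simp only [List.length_append, List.length_cons, List.length_nil] at hle
  by_contra hc
  have hnew := h.newest ht (by omega)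
  rw [hs] at hnew
  have : a.done - 1 = S.length ∨ a.done - 1 = S.length + 1 := by omega
  rcases this with he | he
  · rw [he] at hnew
    simp at hnew
    omega
  · rw [he] at hnew
    simp at hnew
    omega

theorem AState.Inv.step {σ K : ℕ} {a : AState} (h : a.Inv σ K) (hs : a.Shape) :
    (a.step σ K).Inv σ K := by
  have h' := h
  obtain ⟨h1, h2, h3, h4, h5, h6, h7, h8, h9⟩ := h
  unfold AState.step
  unfold AState.Shape at hs
  split
  · rename_i ht
    split
    · exact h'
    · rename_i c q hq
      have hcσ : c < σ := h4 c (by rw [hq]; simp)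
      refine ⟨h1, h2, ?_, fun x hx => h4 x (by rw [hq]; simp [hx]), ?_, ?_, ?_, ?_, h9⟩
      · intro x hx
        rcases List.mem_append.1 hx with hx | hx
        · exact h3 x hx
        · rw [List.mem_singleton.1 hx]; exact Nat.lt_add_right _ hcσ
      · show Forest σ a.D ((a.stack ++ [c]).take a.done) _ _
        rw [List.take_append_of_le_length h6]
        exact h5
      · simp; omega
      · intro _ hd
        show (a.stack ++ [c]).getD (a.done - 1) 0 + 1 = _
        rw [List.getD_append _ _ _ _ (by change a.done ≠ 0 at hd; omega)]
        exact h7 (by simp [ht]) hd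
      · intro k j hkj
        simp at hkj
  · rename_i k ht
    refine ⟨h1, h2, h3, h4, h5, h6, fun _ => h7 (by simp [ht]), ?_, ?_⟩
    · intro k j hkj
      simp only at hkj
      split_ifs at hkj
    · have hl : ∀ v, (Level.arrive K (a.levels.getD k (Level.init K)) v).val.1.labels.length
          = K + 1 := fun v => by
        rw [Level.arrive_labels, relabel_length, h'.labels_getD]
      intro v hv
      simp only at hv
      split_ifs at hv
      · rcases List.mem_or_eq_of_mem_set hv with hv | rfl
        · exact h9 v hv
        · exact hl _
      · rcases List.mem_append.1 hv with hv | hv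
        · exact h9 v hv
        · rw [List.mem_singleton.1 hv]; exact hl _
  · rename_i k j ht
    rw [ht] at hs
    obtain ⟨S, x, y, hS⟩ := exists_eq_append_pair (l := a.stack) (by simp at hs; omega)
    rw [AState.top2_eq hS]
    split_ifs with hm
    · have hd := h'.done_lt (by simp [ht]) hS hm
      obtain ⟨r1, r2⟩ := AState.replace_stack hS a.D a.T k j (σ + a.D.idxOf (x, y))
      have hidx : a.D.idxOf (x, y) < a.D.length := List.idxOf_lt_length_iff.2 hm
      refine ⟨h1, h2, ?_, h4, ?_, ?_, ?_, ?_, h9⟩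
      · rw [r1]
        intro w hw
        rcases List.mem_append.1 hw with hw | hw
        · exact h3 w (by rw [hS]; simp [hw])
        · rw [List.mem_singleton.1 hw]
          exact Nat.add_lt_add_left hidx σ
      · rw [r1, r2, min_eq_left (by omega), List.take_append_of_le_length hd]
        rw [hS, List.take_append_of_le_length hd] at h5
        exact h5
      · rw [r1, r2]; simp
      · rw [r1, r2, min_eq_left (by omega)]
        intro _ h0
        have := h7 (by simp [ht]) h0
        rw [hS, List.getD_append _ _ _ _ (by omega)] at this
        rw [List.getD_append _ _ _ _ (by omega)]
        exact this
      · intro k' j' hkj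
        exact absurd hkj (AState.replace_task_ne _ _ _ _ _ _ _ _)
    · refine ⟨h1, h2, h3, h4, h5, h6, ?_, ?_, h9⟩
      · intro hc; exact absurd rfl (hc k j)
      · intro _ _ _
        show a.top2 ∉ a.D
        rw [AState.top2_eq hS]
        exact hm
  · rename_i k j ht
    rw [ht] at hs
    split_ifs with hd
    · refine ⟨h1, h2.push_leaf _, h3, h4, ?_, hd, ?_, h8, h9⟩
      · show Forest σ a.D (a.stack.take (a.done + 1)) _ _
        rw [← List.take_concat_get' _ _ hd, List.getD_eq_getElem _ _ hd]
        -- A symbol of the stack is a terminal or an existing variable, so as a new node it is a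
        -- leaf in its own right.
        exact .snoc _ _ _ _ _ _ h5 (.leaf _ _ (h3 _ (List.getElem_mem hd)))
      · intro hc; exact absurd ht (hc k j)
    · obtain ⟨S, x, y, hS⟩ := exists_eq_append_pair (l := a.stack) (by simp at hs; omega)
      have hfresh := h8 k j ht
      rw [AState.top2_eq hS] at hfresh ⊢
      have hde : a.done = S.length + 2 := by
        have : a.stack.length = S.length + 2 := by rw [hS]; simp
        omega
      obtain ⟨r1, r2⟩ := AState.replace_stack hS (a.D ++ [(x, y)])
        (a.T ++ [.inner (σ + a.D.length)]) k j (σ + a.D.length)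
      have hx : x < σ + a.D.length := h3 x (by rw [hS]; simp)
      have hy : y < σ + a.D.length := h3 y (by rw [hS]; simp)
      rw [hS, hde, List.take_of_length_le (by simp), show S ++ [x, y] = (S ++ [x]) ++ [y] by simp]
        at h5
      have hcnt := h5.count.1
      -- By now the whole stack is in the tree, so the forest ends with the subtrees of `x` and `y`,
      -- adjacent as post-order requires.
      obtain ⟨T₁, l₂, m₁, hT, hf1, hp2⟩ := h5.snoc_inv
      obtain ⟨A, l₁, m₀, hT1, hf0, hp1⟩ := hf1.snoc_inv
      have hTA : a.T = A ++ (l₁ ++ l₂) := by rw [hT, hT1, List.append_assoc]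
      refine ⟨⟨?_, ?_⟩, ?_, ?_, h4, ?_, ?_, ?_, ?_, h9⟩
      · show (a.D ++ [(x, y)]).Nodup
        rw [List.nodup_append]
        refine ⟨h1.nodup, by simp, ?_⟩
        intro d hd e he
        rw [List.mem_singleton.1 he]
        exact fun hde => hfresh (hde ▸ hd)
      · intro i x' y' hi
        change (a.D ++ [(x, y)])[i]? = _ at hi
        rcases Nat.lt_or_ge i a.D.length with hlt | hge
        · rw [List.getElem?_append_left hlt] at hi
          exact h1.lt i x' y' hi
        · rw [List.getElem?_append_right hge] at hi
          cases hsub : i - a.D.length with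
          | zero =>
            rw [hsub] at hi
            simp only [List.getElem?_cons_zero, Option.some.injEq, Prod.mk.injEq] at hi
            have : i = a.D.length := by omega
            subst this
            omega
          | succ => rw [hsub] at hi; simp at hi
      · rw [hTA] at h2 hcnt
        have := h2.push_inner hp1 hp2 hcnt
        rw [← hTA] at this
        exact this
      · rw [r1]
        show ∀ w ∈ S ++ [σ + a.D.length], w < σ + (a.D ++ [(x, y)]).length
        intro w hw
        simp only [List.length_append, List.length_singleton]
        rcases List.mem_append.1 hw with hw | hw
        · have := h3 w (by rw [hS]; simp [hw])
          omega
        · rw [List.mem_singleton.1 hw]; omega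
      · rw [r1, r2, hde, min_eq_right (by omega), List.take_of_length_le (by simp)]
        show Forest σ (a.D ++ [(x, y)]) _ (a.T ++ [.inner (σ + a.D.length)])
          (a.D ++ [(x, y)]).length
        rw [hTA, show A ++ (l₁ ++ l₂) ++ [Node.inner (σ + a.D.length)] =
          A ++ (l₁ ++ l₂ ++ [Node.inner (σ + a.D.length)]) by simp]
        refine .snoc _ _ _ _ _ _ (hf0.append _) ?_
        simp only [List.length_append, List.length_singleton]
        exact .inner _ _ _ x y _ _ ⟨by omega, by simp⟩ (hp1.append _) (hp2.append _)
      · rw [r1, r2]; simp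
      · rw [r1, r2, hde, min_eq_right (by omega)]
        intro _ _
        show (S ++ [σ + a.D.length]).getD _ 0 + 1 = σ + (a.D ++ [(x, y)]).length
        simp
        omega
      · intro k' j' hkj
        exact absurd hkj (AState.replace_task_ne _ _ _ _ _ _ _ _)

/-- A state of the construction with hash function, for given hash-independent components. -/
structure Rel (P : Par) (a : AState) (st : State) : Prop where
  index : IndexOk P a.D a.T st.I
  queue : st.queue = a.queue
  stack : st.stack = a.stack
  done : st.done = a.done
  levels : st.levels = a.levels
  task : st.task = a.task

/-- Number of list entries visited in one step. -/
def AState.visited (P : Par) (a : AState) : ℕ :=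
  match a.task with
  | .idle => 0
  | .arrive _ => 0
  | .merge _ _ => bucketCount P a.D (max 1 (P.buckets a.D.length))
      (addr (max 1 (P.buckets a.D.length)) (P.hash a.top2.1 a.top2.2))
  | .create _ _ => bucketCount P (a.D ++ [a.top2]) (max 1 (P.buckets a.D.length))
      (max 1 (P.buckets a.D.length) - 2 ^ Nat.log2 (max 1 (P.buckets a.D.length)))

/-- The table grows by at most one entry for each new variable. -/
def Par.BucketsOk (P : Par) : Prop :=
  P.buckets 0 = 0 ∧ ∀ n, P.buckets n ≤ P.buckets (n + 1) ∧ P.buckets (n + 1) ≤ P.buckets n + 1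

/-- `V` bounds the lengths of tree positions and symbols, hence the heights of both search
structures. Handling a list entry costs at most `17 * V + 20` (a digram is retrieved and, in a
split, relinked), a new leaf accounts for `11 * V`, and relabelling for `2 * P.K`. -/
theorem State.perform_spec {P : Par} (hb : P.BucketsOk) (hw : 0 < P.w) {a : AState} {st : State}
    (h : Rel P a st) (hi : a.Inv P.σ P.K) (hs : a.Shape) {V : ℕ}
    (hV1 : Nat.size (a.T.length + 2) ≤ V) (hV2 : Nat.size (P.σ + a.D.length + 1) ≤ V) :
    Rel P (a.step P.σ P.K) (st.perform P).val ∧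
      (st.perform P).time ≤ a.visited P * (17 * V + 20) + 11 * V + 2 * P.K + 30 := by
  have hinv := hi.step hs
  obtain ⟨D, T, queue, stack, done, levels, task⟩ := a
  obtain ⟨I, queue', stack', done', levels', task'⟩ := st
  obtain ⟨hI, hq, hst, hd, hl, ht⟩ := h
  simp only at hI hq hst hd hl ht hV1 hV2
  subst hq hst hd hl ht
  have hszT : Nat.size (T.length + 1) ≤ V := (Nat.size_le_size (by omega)).trans hV1
  have hszD : Nat.size (P.σ + D.length) ≤ V := (Nat.size_le_size (by omega)).trans hV2
  set m := max 1 (P.buckets D.length) with hm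
  cases task' with
  | idle =>
    cases queue' with
    | nil =>
      simp only [State.perform, AState.step, op_val, op_time]
      exact ⟨⟨hI, rfl, rfl, rfl, rfl, rfl⟩, by omega⟩
    | cons c q =>
      simp only [State.perform, AState.step, Timed.bind_val, op_val, Timed.bind_time, op_time]
      exact ⟨⟨hI, rfl, rfl, rfl, rfl, rfl⟩, by omega⟩
  | arrive k =>
    have hlab := hi.labels_getD k
    simp only at hlab
    simp only [State.perform, AState.step, Timed.bind_val, op_val, Timed.bind_time, op_time,
      Level.arrive_time, hlab]
    exact ⟨⟨hI, rfl, rfl, rfl, rfl, rfl⟩, by omega⟩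
  | merge k j =>
    set x := stack'.getD (stack'.length - 2) 0 with hx
    set y := stack'.getD (stack'.length - 1) 0 with hy
    have hlv := Index.lookup_val hi.rules.nodup hi.tree hI.base (by omega) hI.hash x y
    have hlt := Index.lookup_time hI.base (by omega) hI.hash hszT (hI.base.Lh.trans hszD) x y
    simp only [← hm] at hlt
    have hvle : bucketCount P D m (addr m (P.hash x y)) * (17 * V + 18) ≤
        bucketCount P D m (addr m (P.hash x y)) * (17 * V + 20) :=
      Nat.mul_le_mul_left _ (by omega)
    simp only [State.perform, AState.step, AState.visited, AState.top2, Timed.bind_val, op_val,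
      Timed.bind_time, op_time, ← hx, ← hy, ← hm, hlv]
    by_cases hmem : (x, y) ∈ D
    · simp only [if_pos hmem, State.replace, Timed.bind_val, op_val, Timed.bind_time, op_time]
      exact ⟨⟨hI, rfl, rfl, rfl, rfl, rfl⟩, by omega⟩
    · simp only [if_neg hmem, op_val, op_time]
      exact ⟨⟨hI, rfl, rfl, rfl, rfl, rfl⟩, by omega⟩
  | create k j =>
    simp only [AState.step] at hinv
    by_cases hlt : done' < stack'.length
    · have hx : stack'.getD done' 0 < P.σ + D.length := by
        rw [List.getD_eq_getElem _ _ hlt]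
        exact hi.stack_lt _ (List.getElem_mem hlt)
      have := hI.addLeaf hi.tree hw hx hszT hszD
      simp only [State.perform, AState.step, if_pos hlt, Timed.bind_val, op_val, Timed.bind_time,
        op_time]
      exact ⟨⟨this.1, rfl, rfl, rfl, rfl, rfl⟩, by omega⟩
    · rw [if_neg hlt] at hinv
      obtain ⟨S, x, y, hS⟩ := exists_eq_append_pair (l := stack') (by
        simp only [AState.Shape] at hs; omega)
      have hx : x < P.σ + D.length := hi.stack_lt _ (by simp [hS])
      have hy : y < P.σ + D.length := hi.stack_lt _ (by simp [hS])
      have e1 : stack'.getD (stack'.length - 2) 0 = x := by simp [hS]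
      have e2 : stack'.getD (stack'.length - 1) 0 = y := by simp [hS]
      have htree := hinv.tree
      simp only [AState.replace, AState.top2, e1, e2] at htree
      have := hI.addVar hi.tree htree hx hy (hb.2 _).1 (hb.2 _).2 hV1 hV2
      have hn : I.n = D.length := hI.base.R_length
      simp only [← hm] at this
      simp only [State.perform, AState.step, AState.visited, AState.top2, AState.replace,
        if_neg hlt, Timed.bind_val, op_val, Timed.bind_time, op_time, State.replace, hn, e1, e2,
        ← hm]
      exact ⟨⟨this.1, rfl, rfl, rfl, rfl, rfl⟩, by omega⟩

theorem State.perform_peak (P : Par) (st : State) : (st.perform P).peak = 0 := by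
  unfold State.perform
  split
  · split <;> simp
  · simp [Level.arrive_peak]
  · simp only [Timed.bind_peak, op_peak, Index.lookup_peak]
    split <;> simp [State.replace]
  · split_ifs <;> simp [State.replace, Index.addLeaf_peak, Index.addVar_peak]

/-! # Online parsing of one level -/

theorem relabel_getD_zero (as : List ℕ) (x : ℕ) (h : 0 < as.length) :
    (relabel as x).val.getD 0 0 = x := by
  cases as with
  | nil => simp at h
  | cons a as => simp [relabel]

theorem relabel_getD_succ (as : List ℕ) (x j : ℕ) (h : j + 1 < as.length) :
    (relabel as x).val.getD (j + 1) 0 =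
      reduceLabel (as.getD j 0) ((relabel as x).val.getD j 0) := by
  induction as generalizing x j with
  | nil => simp at h
  | cons a as ih =>
    simp only [relabel, Timed.bind_val, op_val, List.getD_cons_succ]
    cases j with
    | zero =>
      rw [relabel_getD_zero _ _ (by simpa using h)]
      simp
    | succ j =>
      rw [List.getD_cons_succ, List.getD_cons_succ]
      exact ih _ _ (by simpa using h)

/-- The record `v` is correct after the first `n` symbols of the string `f`. -/
structure Level.Ok (K : ℕ) (f : ℕ → ℕ) (n : ℕ) (v : Level) : Prop where
  age : v.age = min n 2
  rep : v.rep = true ↔ 2 ≤ n ∧ f (n - 2) = f (n - 1)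
  rep' : v.rep' = true ↔ 3 ≤ n ∧ f (n - 3) = f (n - 2)
  off_le : v.off ≤ 2 * K
  off : ∀ m, 1 ≤ m → m ≤ 2 * K → (m ≤ v.off ↔
    m + 1 ≤ n ∧ ∀ j ≤ m, ¬ (2 ≤ n - j ∧ f (n - j - 2) = f (n - j - 1)))
  cut : v.cut = true ↔ Cut K f n
  up : K + 2 ≤ n → (v.up = true ↔ label f K (n - 2) < label f K (n - 1))
  labels_length : v.labels.length = K + 1
  labels : ∀ j ≤ K, j + 1 ≤ n → v.labels.getD j 0 = label f j (n - 1)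

theorem Level.Ok.init (K : ℕ) (f : ℕ → ℕ) : (Level.init K).Ok K f 0 := by
  refine ⟨rfl, by simp [Level.init], by simp [Level.init], by simp [Level.init], ?_, ?_, by omega,
    by simp [Level.init], by omega⟩
  · intro m hm1 hm2
    simp [Level.init]
    omega
  · simp [Level.init, Cut]

theorem getLastD_eq_getD {l : List ℕ} {K : ℕ} (h : l.length = K + 1) :
    l.getLastD 0 = l.getD K 0 := by
  rw [List.getLastD_eq_getLast?, List.getLast?_eq_getElem?, List.getD_eq_getElem?_getD, h]
  rfl

/-- Labels are claimed only for positions with enough left context, because the initial zeros of the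
record mean nothing. This does no harm: a landmark has `2 * K` symbols before it, and `1 ≤ K` makes
this enough for the comparison kept in `up`. -/
theorem Level.Ok.arrive {K : ℕ} (hK : 1 ≤ K) {f : ℕ → ℕ} {n : ℕ} {v : Level} (h : v.Ok K f n) :
    (v.arrive K (f n)).val.1.Ok K f (n + 1) ∧
      (v.arrive K (f n)).val.2 = (if v.pend = 0 then 0 else if v.pend = 1 then
        (if Cut K f (n + 1) ∧ ¬ Cut K f n then 0 else 1) else 2) ∧
      (v.arrive K (f n)).val.1.pend =
        if (v.arrive K (f n)).val.2 = 0 then v.pend + 1 else 0 := by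
  have h1 := h.age
  have h4 := h.off_le
  have h8 := h.labels_length
  have hlab : ∀ j ≤ K, j ≤ n → (relabel v.labels (f n)).val.getD j 0 = label f j n := by
    intro j
    induction j with
    | zero => intro _ _; exact relabel_getD_zero _ _ (by omega)
    | succ j ih =>
      intro hj hn
      rw [relabel_getD_succ _ _ _ (by omega), ih (by omega) (by omega), h.labels j (by omega) (by omega)]
      rfl
  have hrep : Nonempty ((decide (0 < v.age) && v.labels.headD 0 == f n) = true ↔
      2 ≤ n + 1 ∧ f (n + 1 - 2) = f (n + 1 - 1)) := by
    constructor
    rcases Nat.eq_zero_or_pos n with rfl | hn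
    · simp [h1]
    · have : v.labels.headD 0 = f (n - 1) := by
        have := h.labels 0 (by omega) (by omega)
        rw [List.headD_eq_head?_getD, List.head?_eq_getElem?, ← List.getD_eq_getElem?_getD, this]
        rfl
      simp only [this, h1, Bool.and_eq_true, decide_eq_true_eq, beq_iff_eq]
      have e1 : n + 1 - 2 = n - 1 := by omega
      have e2 : n + 1 - 1 = n := by omega
      rw [e1, e2]
      constructor
      · rintro ⟨-, h⟩; exact ⟨by omega, h⟩
      · rintro ⟨-, h⟩; exact ⟨by omega, h⟩
  generalize hrp : (decide (0 < v.age) && v.labels.headD 0 == f n) = rp at hrep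
  have hold : K + 1 ≤ n → v.labels.getLastD 0 = label f K (n - 1) := fun hn => by
    rw [getLastD_eq_getD h8, h.labels K le_rfl hn]
  have hnew : K ≤ n → (relabel v.labels (f n)).val.getLastD 0 = label f K n := fun hn => by
    rw [getLastD_eq_getD (K := K) (by rw [relabel_length, h8]), hlab K le_rfl hn]
  generalize hol : v.labels.getLastD 0 = old at hold
  generalize hnw : (relabel v.labels (f n)).val.getLastD 0 = new at hnew
  have hlm : 2 ≤ n → ((!v.rep && !rp && v.off == 2 * K && v.up && decide (new < old)) = true ↔
      Landmark K f (n - 1)) := by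
    intro hn
    simp only [Bool.and_eq_true, Bool.not_eq_true', beq_iff_eq, decide_eq_true_eq, Landmark]
    have hoff := h.off (2 * K) (by omega) le_rfl
    have hoff' : v.off = 2 * K ↔ 2 * K ≤ v.off := by omega
    rw [hoff', hoff]
    constructor
    · rintro ⟨⟨⟨⟨g1, g2⟩, g3, g4⟩, g5⟩, g6⟩
      refine ⟨by omega, ?_, ?_, ?_⟩
      · rintro d hd (⟨g7, g8⟩ | g7)
        · refine g4 d hd ⟨by omega, ?_⟩
          rw [show n - d - 2 = n - 1 - d - 1 by omega, show n - d - 1 = n - 1 - d by omega]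
          exact g8
        -- Here position `n - 1 - d` repeats in its right neighbour. For `d = 0` this is the
        -- arriving symbol, which `rp` checks; otherwise the recorded context one position further
        -- right excludes it.
        · rcases Nat.eq_zero_or_pos d with rfl | hd0
          · have : rp = true := by
              rw [hrep.some]
              refine ⟨by omega, ?_⟩
              rw [show n + 1 - 2 = n - 1 - 0 by omega, show n + 1 - 1 = n - 1 - 0 + 1 by omega]
              exact g7.symm
            rw [this] at g2
            exact absurd g2 (by simp)
          · refine g4 (d - 1) (by omega) ⟨by omega, ?_⟩
            rw [show n - (d - 1) - 2 = n - 1 - d by omega,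
              show n - (d - 1) - 1 = n - 1 - d + 1 by omega]
            exact g7.symm
      · rw [show n - 1 - 1 = n - 2 by omega]
        exact (h.up (by omega)).1 g5
      · rw [show n - 1 + 1 = n by omega]
        rw [← hold (by omega), ← hnew (by omega)]
        exact g6
    · rintro ⟨g1, g2, g3, g4⟩
      have g5 : ∀ j ≤ 2 * K, ¬ (2 ≤ n - j ∧ f (n - j - 2) = f (n - j - 1)) := by
        rintro j hj ⟨g6, g7⟩
        refine g2 j hj (Or.inl ⟨by omega, ?_⟩)
        rw [show n - 1 - j - 1 = n - j - 2 by omega, show n - 1 - j = n - j - 1 by omega]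
        exact g7
      refine ⟨⟨⟨⟨?_, ?_⟩, by omega, g5⟩, ?_⟩, ?_⟩
      · rw [← Bool.not_eq_true, h.rep]
        exact g5 0 (by omega)
      · rw [← Bool.not_eq_true, hrep.some]
        rintro ⟨-, g6⟩
        refine g2 0 (by omega) (Or.inr ?_)
        rw [show n - 1 - 0 + 1 = n + 1 - 1 by omega, show n - 1 - 0 = n + 1 - 2 by omega]
        exact g6.symm
      · rw [h.up (by omega), show n - 2 = n - 1 - 1 by omega]
        exact g3
      · rw [hold (by omega), hnew (by omega)]
        rw [show n - 1 + 1 = n by omega] at g4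
        exact g4
  have htb : 2 ≤ n → ((!v.rep && (v.rep' || rp)) = true ↔ TypeBoundary f (n - 2)) := by
    intro hn
    simp only [Bool.and_eq_true, Bool.not_eq_true', Bool.or_eq_true, h.rep', hrep.some, TypeBoundary, InRun,
      ← Bool.not_eq_true, h.rep]
    rw [show n + 1 - 2 = n - 1 by omega, show n + 1 - 1 = n by omega,
      show n - 2 + 1 = n - 1 by omega, show n - 2 - 1 = n - 3 by omega,
      show n - 1 + 1 = n by omega, show n - 1 - 1 = n - 2 by omega]
    constructor
    · rintro ⟨g1, g2⟩
      refine ⟨fun g => g1 ⟨hn, g⟩, ?_⟩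
      rcases g2 with ⟨g3, g4⟩ | ⟨-, g4⟩
      · exact Or.inl (Or.inl ⟨by omega, g4⟩)
      · exact Or.inr (Or.inr g4.symm)
    · rintro ⟨g1, g2⟩
      refine ⟨fun g => g1 g.2, ?_⟩
      rcases g2 with (⟨g3, g4⟩ | g4) | (⟨-, g4⟩ | g4)
      · exact Or.inl ⟨by omega, g4⟩
      · exact absurd g4.symm g1
      · exact absurd g4 g1
      · exact Or.inr ⟨by omega, g4.symm⟩
  have hcut : Nonempty ((v.age == 2 && ((!v.rep && (v.rep' || rp)) ||
      (!v.rep && !rp && v.off == 2 * K && v.up && decide (new < old)))) = true ↔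
      Cut K f (n + 1)) := by
    constructor
    rw [Bool.and_eq_true, beq_iff_eq, h1, Bool.or_eq_true]
    unfold Cut Boundary
    constructor
    · rintro ⟨g1, g2⟩
      have hn : 2 ≤ n := by omega
      rw [htb hn, hlm hn] at g2
      rw [show n + 1 - 3 = n - 2 by omega, show n - 2 + 1 = n - 1 by omega]
      exact ⟨by omega, g2⟩
    · rintro ⟨g1, g2⟩
      have hn : 2 ≤ n := by omega
      rw [show n + 1 - 3 = n - 2 by omega, show n - 2 + 1 = n - 1 by omega] at g2
      rw [htb hn, hlm hn]
      exact ⟨by omega, g2⟩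
  generalize hct : (v.age == 2 && ((!v.rep && (v.rep' || rp)) ||
      (!v.rep && !rp && v.off == 2 * K && v.up && decide (new < old)))) = ct at hcut
  have hm : (v.arrive K (f n)).val = (⟨if (if v.pend = 0 then 0 else if v.pend = 1 then
      (if ct && !v.cut then 0 else 1) else 2) = 0 then v.pend + 1 else 0, min (v.age + 1) 2, rp,
      v.rep, if rp || v.rep || v.age == 0 then 0 else min (v.off + 1) (2 * K), ct,
      decide (old < new), (relabel v.labels (f n)).val⟩,
      if v.pend = 0 then 0 else if v.pend = 1 then (if ct && !v.cut then 0 else 1) else 2) := by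
    subst hct hnw hol hrp
    simp only [Level.arrive, Timed.bind_val, op_val]
  rw [hm]
  clear hm hlm htb hrp hol hnw hct
  dsimp only
  refine ⟨?_, ?_, rfl⟩
  swap
  · have hcc : (ct && !v.cut) = true ↔ Cut K f (n + 1) ∧ ¬ Cut K f n := by
      rw [Bool.and_eq_true, Bool.not_eq_true', ← Bool.not_eq_true, hcut.some, h.cut]
    simp only [hcc]
  generalize (if (if v.pend = 0 then 0 else if v.pend = 1 then
      (if ct && !v.cut then 0 else 1) else 2) = 0 then v.pend + 1 else 0) = pd
  have e1 : n + 1 - 1 = n := rfl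
  constructor
  · simp only [h1]; omega
  · exact hrep.some
  · simp only [h.rep]
    rw [show n + 1 - 3 = n - 2 by omega, show n + 1 - 2 = n - 1 by omega]
    constructor <;> rintro ⟨g1, g2⟩ <;> exact ⟨by omega, g2⟩
  · simp only
    split_ifs <;> omega
  · intro m hm1 hm2
    simp only
    -- Looking `j` positions back after the arrival is looking `j - 1` positions back before it.
    have hA : ∀ j, 1 ≤ j → ((2 ≤ n + 1 - j ∧ f (n + 1 - j - 2) = f (n + 1 - j - 1)) ↔
        (2 ≤ n - (j - 1) ∧ f (n - (j - 1) - 2) = f (n - (j - 1) - 1))) := by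
      intro j hj
      rw [show n + 1 - j = n - (j - 1) by omega]
    split_ifs with hc
    · simp only [Bool.or_eq_true, beq_iff_eq] at hc
      constructor
      · intro g; omega
      · rintro ⟨g1, g2⟩
        exfalso
        rcases hc with (hc | hc) | hc
        · exact g2 0 (by omega) (hrep.some.1 hc)
        · exact g2 1 hm1 ((hA 1 le_rfl).2 (h.rep.1 hc))
        · omega
    · simp only [Bool.or_eq_true, beq_iff_eq, not_or] at hc
      obtain ⟨⟨hc1, hc2⟩, hc3⟩ := hc
      have hn : 1 ≤ n := by omega
      constructor
      · intro g
        rcases Nat.lt_or_ge 1 m with hm3 | hm3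
        · have := (h.off (m - 1) (by omega) (by omega)).1 (by omega)
          refine ⟨by omega, ?_⟩
          intro j hj
          rcases Nat.eq_zero_or_pos j with rfl | hj0
          · exact fun g => hc1 (hrep.some.2 g)
          · rw [hA j hj0]
            exact this.2 (j - 1) (by omega)
        · have : m = 1 := by omega
          subst this
          refine ⟨by omega, ?_⟩
          intro j hj
          rcases Nat.eq_zero_or_pos j with rfl | hj0
          · exact fun g => hc1 (hrep.some.2 g)
          · rw [hA j hj0, show j - 1 = 0 by omega]
            exact fun g => hc2 (h.rep.2 g)
      · rintro ⟨g1, g2⟩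
        refine le_min ?_ hm2
        rcases Nat.lt_or_ge 1 m with hm3 | hm3
        · have := (h.off (m - 1) (by omega) (by omega)).2 ⟨by omega, fun j hj => by
            have := g2 (j + 1) (by omega)
            rwa [hA (j + 1) (by omega)] at this⟩
          omega
        · omega
  · exact hcut.some
  · intro hn
    simp only [decide_eq_true_eq]
    rw [hold (by omega), hnew (by omega), show n + 1 - 2 = n - 1 by omega]
    rfl
  · simp only [relabel_length, h8]
  · intro j hj hn
    rw [e1]
    exact hlab j hj (by omega)

/-- One step of the online parsing of a level: the record, the finished blocks, and the
unfinished block. -/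
def runStep (K : ℕ) (s : Level × List (List ℕ) × List ℕ) (x : ℕ) :
    Level × List (List ℕ) × List ℕ :=
  if (s.1.arrive K x).val.2 = 0 then ((s.1.arrive K x).val.1, s.2.1, s.2.2 ++ [x])
  else ((s.1.arrive K x).val.1, s.2.1 ++ [s.2.2 ++ [x]], [])

/-- Online parsing of the string `l`. -/
def run (K : ℕ) (l : List ℕ) : Level × List (List ℕ) × List ℕ :=
  l.foldl (runStep K) (Level.init K, [], [])

theorem run_append_singleton (K : ℕ) (l : List ℕ) (x : ℕ) :
    run K (l ++ [x]) = runStep K (run K l) x := by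
  simp [run]

/-- The record of a level after the string `l`. -/
def lev (K : ℕ) (l : List ℕ) : Level := (run K l).1
/-- The finished blocks. -/
def comp (K : ℕ) (l : List ℕ) : List (List ℕ) := (run K l).2.1
/-- The unfinished block. -/
def pnd (K : ℕ) (l : List ℕ) : List ℕ := (run K l).2.2

theorem lev_append (K : ℕ) (l : List ℕ) (x : ℕ) :
    lev K (l ++ [x]) = ((lev K l).arrive K x).val.1 := by
  unfold lev
  rw [run_append_singleton, runStep]
  split_ifs <;> rfl

theorem comp_append (K : ℕ) (l : List ℕ) (x : ℕ) :
    comp K (l ++ [x]) = if ((lev K l).arrive K x).val.2 = 0 then comp K l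
      else comp K l ++ [pnd K l ++ [x]] := by
  unfold lev comp pnd
  rw [run_append_singleton, runStep]
  split_ifs <;> rfl

theorem pnd_append (K : ℕ) (l : List ℕ) (x : ℕ) :
    pnd K (l ++ [x]) = if ((lev K l).arrive K x).val.2 = 0 then pnd K l ++ [x] else [] := by
  unfold lev pnd
  rw [run_append_singleton, runStep]
  split_ifs <;> rfl

/-- `f` has to agree with the string on the symbols read, and nowhere else. So the record does not
depend on later symbols, and the same `f` may stand for any continuation. -/
theorem lev_ok {K : ℕ} (hK : 1 ≤ K) {f : ℕ → ℕ} {l : List ℕ}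
    (hf : ∀ i < l.length, f i = l.getD i 0) :
    (lev K l).Ok K f l.length ∧ (lev K l).pend = (pnd K l).length ∧ (pnd K l).length ≤ 2 := by
  induction l using List.reverseRecOn with
  | nil => exact ⟨Level.Ok.init K f, rfl, by simp [pnd, run]⟩
  | append_singleton l x ih =>
    obtain ⟨h1, h2, h3⟩ := ih fun i hi => by
      rw [hf i (by simp; omega), List.getD_append _ _ _ _ hi]
    have hx : f l.length = x := by
      rw [hf _ (by simp), List.getD_append_right _ _ _ _ le_rfl]; simp
    obtain ⟨g1, g2, g3⟩ := h1.arrive hK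
    rw [hx] at g1 g2 g3
    rw [lev_append, pnd_append, List.length_append, List.length_singleton]
    refine ⟨g1, ?_, ?_⟩
    · rw [g3]
      split_ifs
      · rw [List.length_append, h2]; rfl
      · rfl
    · split_ifs with hc
      · rw [g2] at hc
        have : (pnd K l).length ≠ 2 := by
          intro hp
          rw [h2, hp] at hc
          simp at hc
        simp; omega
      · simp

theorem arrive_merges {K : ℕ} (hK : 1 ≤ K) {f : ℕ → ℕ} {l : List ℕ}
    (hf : ∀ i < l.length, f i = l.getD i 0) {x : ℕ} (hx : f l.length = x) :
    ((lev K l).arrive K x).val.2 = (if (pnd K l).length = 0 then 0 else if (pnd K l).length = 1 then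
        (if Cut K f (l.length + 1) ∧ ¬ Cut K f l.length then 0 else 1) else 2) := by
  obtain ⟨h1, h2, -⟩ := lev_ok hK hf
  rw [← hx, (h1.arrive hK).2.1, h2]

/-- The parsing of a string, if the string ends here. -/
def finBlocks (K : ℕ) (l : List ℕ) : List (List ℕ) :=
  comp K l ++ if pnd K l = [] then [] else [pnd K l]

/-! ### Agreement of the online blocks with the parsing -/

/-- Induction over the rest of the string, at the moments when no symbol is pending: two or three
arrivals finish exactly the next block, and the situation is the same again. -/
theorem finBlocks_eq_blocks {K : ℕ} (hK : 1 ≤ K) (f : ℕ → ℕ) (n : ℕ) : ∀ (l pre : List ℕ),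
    l.length = n → pnd K pre = [] → (∀ i < (pre ++ l).length, f i = (pre ++ l).getD i 0) →
    finBlocks K (pre ++ l) = comp K pre ++ blocks K f pre.length l := by
  induction n using Nat.strong_induction_on with
  | _ n ih =>
  intro l pre hl hp hf
  have hfp : ∀ (l₁ l₂ : List ℕ), l = l₁ ++ l₂ → ∀ i < (pre ++ l₁).length,
      f i = (pre ++ l₁).getD i 0 := by
    rintro l₁ l₂ rfl i hi
    rw [hf i (by simp at *; omega), ← List.append_assoc, List.getD_append _ _ _ _ hi]
  have hfx : ∀ (l₁ l₂ : List ℕ) (x : ℕ), l = l₁ ++ x :: l₂ → f (pre ++ l₁).length = x := by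
    rintro l₁ l₂ x rfl
    rw [hf _ (by simp), ← List.append_assoc, List.getD_append_right _ _ _ _ le_rfl]
    simp
  -- The first symbol of a block never finishes it, so a cut right after it is ignored.
  have hcons : ∀ (x : ℕ) (l' : List ℕ), l = x :: l' →
      comp K (pre ++ [x]) = comp K pre ∧ pnd K (pre ++ [x]) = [x] := by
    rintro x l' rfl
    have hm := arrive_merges hK (l := pre) (by simpa using hfp [] (x :: l') rfl)
      (by simpa using hfx [] l' x rfl)
    rw [hp] at hm
    simp only [List.length_nil, if_true] at hm
    rw [comp_append, pnd_append, hm, hp]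
    simp
  match l, hl with
  | [], _ => simp [finBlocks, blocks, hp]
  | [x], _ =>
    obtain ⟨h1, h2⟩ := hcons x [] rfl
    simp [finBlocks, h1, h2, blocks]
  | x :: y :: l', hl =>
    obtain ⟨h1, h2⟩ := hcons x _ rfl
    have hm := arrive_merges hK (l := pre ++ [x]) (hfp [x] (y :: l') rfl) (hfx [x] l' y rfl)
    rw [h2] at hm
    simp only [List.length_singleton, one_ne_zero, if_false, if_true, List.length_append] at hm
    have e2 : pre ++ x :: y :: l' = (pre ++ [x] ++ [y]) ++ l' := by simp
    have hc := comp_append K (pre ++ [x]) y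
    have hq := pnd_append K (pre ++ [x]) y
    rw [hm, h1, h2] at hc
    rw [hm, h2] at hq
    -- A pair waits for a third symbol exactly if there is a cut after that symbol and none after
    -- the pair itself.
    by_cases hcut : Cut K f (pre.length + 1 + 1) ∧ ¬ Cut K f (pre.length + 1)
    · simp only [if_pos hcut, if_true] at hc hq
      cases l' with
      -- The string ends while the pair is waiting; then the pair is the last block.
      | nil =>
        rw [e2, List.append_nil, finBlocks, hc, hq]
        simp [blocks]
      | cons z l' =>
        have hm3 := arrive_merges hK (l := pre ++ [x] ++ [y])
          (by simpa using hfp [x, y] (z :: l') rfl) (by simpa using hfx [x, y] l' z rfl)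
        rw [hq] at hm3
        simp only [List.length_append, List.length_singleton] at hm3
        have hc3 := comp_append K (pre ++ [x] ++ [y]) z
        have hq3 := pnd_append K (pre ++ [x] ++ [y]) z
        rw [hm3, hc, hq] at hc3
        rw [hm3] at hq3
        simp at hc3 hq3
        have e3 : pre ++ x :: y :: z :: l' = (pre ++ [x, y, z]) ++ l' := by simp
        have hrec := ih l'.length (by simp at hl; omega) l' (pre ++ [x, y, z]) rfl hq3
          (by rw [← e3]; exact hf)
        rw [e3, hrec, hc3, blocks, if_pos hcut]
        simp
    · simp only [if_neg hcut, one_ne_zero, if_false] at hc hq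
      have hrec := ih l'.length (by simp at hl; omega) l' (pre ++ [x] ++ [y]) rfl hq
        (by rw [← e2]; exact hf)
      rw [e2, hrec, hc]
      cases l' with
      | nil => simp [blocks]
      | cons z l' =>
        conv_rhs => rw [blocks, if_neg hcut]
        simp

theorem espBlocks_eq {K : ℕ} (hK : 1 ≤ K) (l : List ℕ) : espBlocks K l = finBlocks K l := by
  have := finBlocks_eq_blocks hK (fun i => l.getD i 0) l.length l [] rfl rfl (by simp)
  simp only [List.nil_append, List.length_nil] at this
  rw [this]
  rfl

/-- Basic facts about the finished and the unfinished blocks. -/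
theorem comp_pnd {K : ℕ} (hK : 1 ≤ K) (l : List ℕ) :
    (comp K l).flatten ++ pnd K l = l ∧ (pnd K l).length ≤ 2 ∧
      (lev K l).pend = (pnd K l).length ∧
      ∀ b ∈ comp K l, b.length = 2 ∨ b.length = 3 := by
  obtain ⟨-, h2, h3⟩ := lev_ok hK (f := fun i => l.getD i 0) (l := l) (by simp)
  refine ⟨?_, h3, h2, ?_⟩
  · induction l using List.reverseRecOn with
    | nil => rfl
    | append_singleton l x ih =>
      obtain ⟨-, g2, g3⟩ := lev_ok hK (f := fun i => l.getD i 0) (l := l) (by simp)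
      rw [comp_append, pnd_append]
      split_ifs
      · rw [← List.append_assoc, ih g2 g3]
      · simp only [List.flatten_append, List.flatten_cons, List.flatten_nil, List.append_nil]
        rw [← List.append_assoc, ih g2 g3]
  · induction l using List.reverseRecOn with
    | nil => simp [comp, run]
    | append_singleton l x ih =>
      obtain ⟨-, g2, g3⟩ := lev_ok hK (f := fun i => l.getD i 0) (l := l) (by simp)
      have hm := arrive_merges hK (f := fun i => (l ++ [x]).getD i 0) (l := l)
        (fun i hi => List.getD_append _ _ _ _ hi) (x := x) (by simp)
      rw [comp_append]
      split_ifs with hc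
      · exact ih g2 g3
      · intro b hb
        rcases List.mem_append.1 hb with hb | hb
        · exact ih g2 g3 b hb
        · rw [List.mem_singleton.1 hb]
          have : (pnd K l).length ≠ 0 := fun h0 => by
            rw [h0] at hm
            exact hc (by simpa using hm)
          simp; omega

/-- The number of merges that an arrival causes. -/
theorem arrive_merges_eq {K : ℕ} (hK : 1 ≤ K) (l : List ℕ) (x : ℕ)
    (h : ((lev K l).arrive K x).val.2 ≠ 0) :
    ((lev K l).arrive K x).val.2 = (pnd K l).length := by
  have hm := arrive_merges hK (f := fun i => (l ++ [x]).getD i 0) (l := l)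
    (fun i hi => List.getD_append _ _ _ _ hi) (x := x) (by simp)
  have := (comp_pnd hK l).2.1
  rw [hm] at h ⊢
  split_ifs at h ⊢
  · contradiction
  · contradiction
  · omega
  · omega

/-! # Numbers of pending symbols, and progress -/

theorem Level.arrive_cases (K : ℕ) {v : Level} (x : ℕ) (hp : v.pend ≤ 2) :
    ((v.arrive K x).val.2 = 0 ∧ (v.arrive K x).val.1.pend = v.pend + 1 ∧ v.pend ≤ 1) ∨
      ((v.arrive K x).val.2 = v.pend ∧ 1 ≤ v.pend ∧ (v.arrive K x).val.1.pend = 0) := by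
  simp only [Level.arrive, Timed.bind_val, op_val]
  split_ifs <;> simp <;> omega

/-- Replace the entry `k` of the list of levels, or append it. -/
def putLevel (l : List Level) (k : ℕ) (v : Level) : List Level :=
  if k < l.length then l.set k v else l ++ [v]

theorem putLevel_length {l : List Level} {k : ℕ} (v : Level) (h : k ≤ l.length) :
    (putLevel l k v).length = max l.length (k + 1) := by
  unfold putLevel
  split_ifs <;> simp <;> omega

theorem putLevel_getD {l : List Level} {k : ℕ} (v : Level) (h : k ≤ l.length) (i : ℕ) (d : Level) :
    (putLevel l k v).getD i d = if i = k then v else l.getD i d := by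
  unfold putLevel
  split_ifs with h1 h2 h2
  · subst h2; simp [List.getD_eq_getElem?_getD, h1]
  · simp [List.getD_eq_getElem?_getD, List.getElem?_set_ne (Ne.symm h2)]
  · subst h2
    have : l.length = i := by omega
    subst this
    simp
  · rcases Nat.lt_or_ge i l.length with hi | hi
    · rw [List.getD_append _ _ _ _ hi]
    · rw [List.getD_eq_default _ _ hi, List.getD_eq_default]
      simp; omega

theorem mem_putLevel {l : List Level} {k : ℕ} {v w : Level} (h : w ∈ putLevel l k v) :
    w ∈ l ∨ w = v := by
  unfold putLevel at h
  split_ifs at h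
  · exact List.mem_or_eq_of_mem_set h
  · simpa using h

def pendSum (l : List Level) : ℕ := (l.map Level.pend).sum

/-- The pending symbols of the levels, where a symbol of level `k` counts `2 ^ k`. -/
def levelMass : List Level → ℕ
  | [] => 0
  | v :: l => v.pend + 2 * levelMass l

theorem putLevel_pendSum (K : ℕ) {l : List Level} {k : ℕ} (v : Level) (h : k ≤ l.length) :
    pendSum (putLevel l k v) + (l.getD k (Level.init K)).pend = pendSum l + v.pend := by
  induction l generalizing k with
  | nil =>
    have : k = 0 := by simpa using h
    subst this
    simp [putLevel, pendSum, Level.init]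
  | cons u l ih =>
    cases k with
    | zero => simp [putLevel, pendSum]; ring
    | succ k =>
      have := ih (k := k) (by simpa using h)
      have e : putLevel (u :: l) (k + 1) v = u :: putLevel l k v := by
        unfold putLevel; simp only [List.length_cons, Nat.add_lt_add_iff_right]; split_ifs <;> simp
      rw [e]
      simp only [pendSum, List.map_cons, List.sum_cons, List.getD_cons_succ] at this ⊢
      omega

theorem putLevel_levelMass (K : ℕ) {l : List Level} {k : ℕ} (v : Level) (h : k ≤ l.length) :
    levelMass (putLevel l k v) + (l.getD k (Level.init K)).pend * 2 ^ k =
      levelMass l + v.pend * 2 ^ k := by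
  induction l generalizing k with
  | nil =>
    have : k = 0 := by simpa using h
    subst this
    simp [putLevel, levelMass, Level.init]
  | cons u l ih =>
    cases k with
    | zero => simp [putLevel, levelMass]; ring
    | succ k =>
      have := ih (k := k) (by simpa using h)
      have e : putLevel (u :: l) (k + 1) v = u :: putLevel l k v := by
        unfold putLevel; simp only [List.length_cons, Nat.add_lt_add_iff_right]; split_ifs <;> simp
      rw [e]
      simp only [levelMass, List.getD_cons_succ, pow_succ]
      linarith

theorem pendSum_le {l : List Level} (h : ∀ v ∈ l, v.pend ≤ 2) : pendSum l ≤ 2 * l.length := by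
  induction l with
  | nil => simp [pendSum]
  | cons v l ih =>
    have h1 := ih fun w hw => h w (by simp [hw])
    have h2 := h v (by simp)
    simp only [pendSum, List.map_cons, List.sum_cons, List.length_cons] at h1 ⊢
    omega

theorem levelMass_le {l : List Level} (h : ∀ v ∈ l, v.pend ≤ 2) :
    levelMass l + 2 ≤ 2 ^ (l.length + 1) := by
  induction l with
  | nil => simp [levelMass]
  | cons v l ih =>
    have h1 := ih fun w hw => h w (by simp [hw])
    have h2 := h v (by simp)
    simp only [levelMass, List.length_cons, pow_succ] at h1 ⊢
    omega

/-- With the lowest `κ` levels empty, each pending symbol counts at least `2 ^ κ`. This limits the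
number of levels that have to be closed. -/
theorem pendSum_mul_le {l : List Level} {κ K : ℕ}
    (h : ∀ i < κ, (l.getD i (Level.init K)).pend = 0) : pendSum l * 2 ^ κ ≤ levelMass l := by
  induction l generalizing κ with
  | nil => simp [pendSum]
  | cons v l ih =>
    cases κ with
    | zero =>
      have := ih (κ := 0) (by simp)
      simp only [pendSum, levelMass, List.map_cons, List.sum_cons, pow_zero, mul_one] at this ⊢
      omega
    | succ κ =>
      have h0 := h 0 (by omega)
      have := ih (κ := κ) fun i hi => by simpa using h (i + 1) (by omega)
      simp only [List.getD_cons_zero] at h0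
      simp only [pendSum, levelMass, List.map_cons, List.sum_cons, h0, pow_succ, zero_add] at this ⊢
      linarith

/-- Number of symbols on the stack that do not belong to the levels. -/
def Task.flight : Task → ℕ
  | .idle => 0
  | .arrive _ => 1
  | .merge _ j => j + 1
  | .create _ j => j + 1

/-- The symbols that do not belong to the levels, where a symbol of level `k` counts `2 ^ k`, and
a block that is being merged counts as one symbol of the next level. -/
def Task.mass : Task → ℕ
  | .idle => 0
  | .arrive k => 2 ^ k
  | .merge k _ => 2 ^ (k + 1)
  | .create k _ => 2 ^ (k + 1)

/-- The task concerns one of the levels, and not one of the first `κ` ones, which are closed. -/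
def Task.Ready (κ L : ℕ) : Task → Prop
  | .idle => True
  | .arrive k => κ ≤ k ∧ k ≤ L
  | .merge k j => κ ≤ k + 1 ∧ k < L ∧ 1 ≤ j
  | .create k j => κ ≤ k + 1 ∧ k < L ∧ 1 ≤ j

/-- Invariant of the construction: numbers of pending symbols, when the first `κ` levels are
closed and `N` symbols have been read. -/
structure AState.Count (K κ N M : ℕ) (a : AState) : Prop where
  pend_le : ∀ v ∈ a.levels, v.pend ≤ 2
  stack : a.stack.length = pendSum a.levels + a.task.flight
  ready : a.task.Ready κ a.levels.length
  closed : ∀ i < κ, (a.levels.getD i (Level.init K)).pend = 0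
  mass : levelMass a.levels + a.task.mass + a.queue.length ≤ M
  levels : 2 ^ a.levels.length ≤ 2 * M + 1
  total : a.D.length + a.stack.length + a.queue.length ≤ N

theorem AState.Count.shape {K κ N M : ℕ} {a : AState} (h : a.Count K κ N M) : a.Shape := by
  have h1 := h.stack
  have h2 := h.ready
  unfold AState.Shape
  split <;> rename_i ht <;> rw [ht] at h1 h2 <;> simp only [Task.flight, Task.Ready] at h1 h2 <;>
    first | trivial | omega

theorem AState.replace_stack_length {a : AState} (h : 2 ≤ a.stack.length) (D : List (ℕ × ℕ))
    (T : List Node) (k j z : ℕ) :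
    (a.replace D T k j z).stack.length + 1 = a.stack.length ∧
      (a.replace D T k j z).done = min a.done (a.stack.length - 1) := by
  have : min (a.stack.length - 2) a.stack.length = a.stack.length - 2 := by omega
  simp only [AState.replace, List.length_append, List.length_take, List.length_singleton, this]
  refine ⟨by omega, ?_⟩
  congr 1
  omega

theorem AState.Count.replace {K κ N M k j : ℕ} {a : AState} (h : a.Count K κ N M)
    (ht : a.task = .merge k j ∨ a.task = .create k j) (D : List (ℕ × ℕ)) (T : List Node) (z : ℕ)
    (hD : D.length ≤ a.D.length + 1) : (a.replace D T k j z).Count K κ N M := by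
  have hf : a.task.flight = j + 1 := by rcases ht with ht | ht <;> simp [ht, Task.flight]
  have hm : a.task.mass = 2 ^ (k + 1) := by rcases ht with ht | ht <;> simp [ht, Task.mass]
  have hr : κ ≤ k + 1 ∧ k < a.levels.length ∧ 1 ≤ j := by
    have := h.ready
    rcases ht with ht | ht <;> simpa [ht, Task.Ready] using this
  have hs := h.stack
  have hms := h.mass
  rw [hf] at hs
  rw [hm] at hms
  have htot := h.total
  have hl := (AState.replace_stack_length (a := a) (by omega) D T k j z).1
  refine ⟨h.pend_le, ?_, ?_, h.closed, ?_, h.levels, ?_⟩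
  · show _ = pendSum a.levels + (if j ≤ 1 then Task.arrive (k + 1) else .merge k (j - 1)).flight
    split_ifs <;> simp only [Task.flight] <;> omega
  · show (if j ≤ 1 then Task.arrive (k + 1) else .merge k (j - 1)).Ready κ a.levels.length
    split_ifs <;> simp only [Task.Ready] <;> omega
  · show levelMass a.levels + (if j ≤ 1 then Task.arrive (k + 1) else .merge k (j - 1)).mass
      + a.queue.length ≤ M
    split_ifs <;> simpa only [Task.mass] using hms
  · show D.length + _ + a.queue.length ≤ N
    omega

/-- The mass does not grow: a finished block of level `k` has at least two symbols of mass `2 ^ k`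
and is counted as `2 ^ (k + 1)`. Once a level is closed nothing may enter at the bottom, which is
`hκ`. -/
theorem AState.Count.step {σ K κ N M : ℕ} {a : AState} (h : a.Count K κ N M)
    (hκ : κ = 0 ∨ a.queue = []) : (a.step σ K).Count K κ N M := by
  have h' := h
  obtain ⟨h1, h2, h3, h4, h5, h6, h7⟩ := h
  unfold AState.step
  split
  · rename_i ht
    rw [ht] at h2 h5
    simp only [Task.flight, Task.mass] at h2 h5
    split
    · exact h'
    · rename_i c q hq
      rw [hq] at h5 h7 hκ
      simp only [List.length_cons] at h5 h7
      refine ⟨h1, ?_, ?_, h4, ?_, h6, ?_⟩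
      · simp [Task.flight, h2]
      · have : κ = 0 := by simpa using hκ
        simp [Task.Ready, this]
      · simp only [Task.mass, pow_zero]; omega
      · simp only [List.length_append, List.length_singleton]; omega
  · rename_i k ht
    rw [ht] at h2 h3 h5
    simp only [Task.flight, Task.Ready, Task.mass] at h2 h3 h5
    set v := a.levels.getD k (Level.init K) with hv
    set x := a.stack.getLastD 0
    have hv2 : v.pend ≤ 2 := by
      rcases Nat.lt_or_ge k a.levels.length with hk | hk
      · rw [hv, List.getD_eq_getElem _ _ hk]; exact h1 _ (List.getElem_mem hk)
      · rw [hv, List.getD_eq_default _ _ hk]; simp [Level.init]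
    have hc := v.arrive_cases K x hv2
    show AState.Count K κ N M ⟨a.D, a.T, a.queue, a.stack, a.done,
      putLevel a.levels k (v.arrive K x).val.1, _⟩
    generalize (v.arrive K x).val = r at hc
    have hps := putLevel_pendSum K r.1 h3.2
    have hlm := putLevel_levelMass K r.1 h3.2
    rw [← hv] at hps hlm
    have hpos : 1 ≤ 2 ^ k := Nat.one_le_two_pow
    refine ⟨?_, ?_, ?_, ?_, ?_, ?_, h7⟩
    · intro w hw
      rcases mem_putLevel hw with hw | rfl
      · exact h1 w hw
      · omega
    · simp only
      rcases hc with ⟨e1, e2, e3⟩ | ⟨e1, e2, e3⟩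
      · rw [if_pos e1]; simp only [Task.flight]; omega
      · rw [if_neg (by omega)]; simp only [Task.flight]; omega
    · simp only
      rw [putLevel_length _ h3.2]
      split_ifs
      · trivial
      · simp only [Task.Ready]; omega
    · intro i hi
      simp only
      rw [putLevel_getD _ h3.2, if_neg (by omega)]
      exact h4 i hi
    · simp only
      rcases hc with ⟨e1, e2, e3⟩ | ⟨e1, e2, e3⟩
      · rw [e2, add_mul] at hlm
        rw [if_pos e1]; simp only [Task.mass]; omega
      · have : 1 * 2 ^ k ≤ v.pend * 2 ^ k := Nat.mul_le_mul_right _ e2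
        rw [e3] at hlm
        rw [if_neg (by omega)]; simp only [Task.mass, pow_succ]; omega
    · simp only
      rw [putLevel_length _ h3.2]
      rcases Nat.lt_or_ge k a.levels.length with hk | hk
      · rw [max_eq_left (by omega)]; exact h6
      -- A level `k` is created by a symbol whose mass `2 ^ k` is part of `M`, so the new number `k
      -- + 1` of levels satisfies the bound.
      · rw [max_eq_right (by omega), pow_succ]; omega
  · rename_i k j ht
    split_ifs
    · exact h'.replace (.inl ht) _ _ _ (by omega)
    · rw [ht] at h2 h3 h5
      exact ⟨h1, h2, h3, h4, h5, h6, h7⟩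
  · rename_i k j ht
    split_ifs
    · exact ⟨h1, h2, h3, h4, h5, h6, h7⟩
    · exact h'.replace (.inr ht) _ _ _ (by simp)

/-- Bound for the number of steps after which nothing remains to be done. -/
def AState.work (a : AState) : ℕ :=
  7 * a.queue.length + 3 * a.stack.length + (a.stack.length - a.done) +
    match a.task with
    | .idle => 0
    | .arrive _ => 2
    | .merge _ _ => 1
    | .create _ _ => 0

/-- Nothing remains to be done. -/
def AState.Resting (a : AState) : Prop := a.task = .idle ∧ a.queue = []

theorem AState.Resting.step {a : AState} (h : a.Resting) (σ K : ℕ) : a.step σ K = a := by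
  unfold AState.step
  rw [h.1, h.2]

theorem AState.work_replace {a : AState} (h : 2 ≤ a.stack.length) (D : List (ℕ × ℕ))
    (T : List Node) (k j z : ℕ) :
    (a.replace D T k j z).work + 1 ≤
      7 * a.queue.length + 3 * a.stack.length + (a.stack.length - a.done) := by
  obtain ⟨h1, h2⟩ := AState.replace_stack_length h D T k j z
  unfold AState.work
  rw [h2]
  show 7 * a.queue.length + _ + _ + _ + 1 ≤ _
  have : (match (a.replace D T k j z).task with
    | .idle => 0
    | .arrive _ => 2
    | .merge _ _ => 1
    | .create _ _ => 0) ≤ 2 := by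
    split <;> omega
  omega

/-- The weights are chosen for this. An input symbol releases 7, of which 3 + 1 are bound on the
stack and 2 by its arrival. A merge shortens the stack, which releases at least 3 and pays for the
next task of weight at most 2. A new leaf raises `done`, and a failed lookup lowers the weight of
the task. -/
theorem AState.work_step {σ K : ℕ} {a : AState} (hs : a.Shape) (hd : a.done ≤ a.stack.length)
    (hr : ¬ a.Resting) : (a.step σ K).work + 1 ≤ a.work := by
  unfold AState.step
  unfold AState.Shape at hs
  split
  · rename_i ht
    split
    · exact absurd ⟨ht, by assumption⟩ hr
    · rename_i c q hq
      simp only [AState.work, ht, hq, List.length_append, List.length_cons, List.length_nil]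
      omega
  · rename_i k ht
    simp only [AState.work, ht]
    split_ifs <;> simp only <;> omega
  · rename_i k j ht
    rw [ht] at hs
    split_ifs
    · refine (AState.work_replace (by simp only at hs; omega) _ _ _ _ _).trans ?_
      simp only [AState.work, ht]
      omega
    · simp only [AState.work, ht]
      omega
  · rename_i k j ht
    rw [ht] at hs
    split_ifs
    · simp only [AState.work, ht]
      omega
    · refine (AState.work_replace (by simp only at hs; omega) _ _ _ _ _).trans ?_
      simp only [AState.work, ht]
      omega

/-- At rest only pending symbols remain, at most two for each level, and each has weight at most 3 +
1. -/
theorem AState.Count.work_le {K κ N M : ℕ} {a : AState} (h : a.Count K κ N M) (hr : a.Resting) :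
    a.work ≤ 8 * a.levels.length := by
  have h1 := h.stack
  have h2 := pendSum_le h.pend_le
  rw [hr.1] at h1
  simp only [Task.flight] at h1
  simp only [AState.work, hr.1, hr.2, List.length_nil]
  omega

theorem AState.step_levels_length (σ K : ℕ) (a : AState) :
    a.levels.length ≤ (a.step σ K).levels.length := by
  unfold AState.step
  split
  · split <;> simp
  · simp only; split_ifs <;> simp
  · split_ifs <;> simp [AState.replace]
  · split_ifs <;> simp [AState.replace]

theorem AState.step_D_length (σ K : ℕ) (a : AState) :
    a.D.length ≤ (a.step σ K).D.length ∧ (a.step σ K).D.length ≤ a.D.length + 1 := by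
  unfold AState.step
  split
  · split <;> simp
  · simp
  · split_ifs <;> simp [AState.replace]
  · split_ifs <;> simp [AState.replace]

theorem AState.step_queue (σ K : ℕ) {a : AState} (h : a.queue = []) :
    (a.step σ K).queue = [] := by
  unfold AState.step
  split
  · rw [h]; exact h
  · exact h
  · split_ifs <;> exact h
  · split_ifs <;> exact h

/-! # The strings of the levels -/

/-- The strings `f (k + d - 1), …, f k` one after the other. -/
def gather (f : ℕ → List ℕ) : ℕ → ℕ → List ℕ
  | _, 0 => []
  | k, d + 1 => gather f (k + 1) d ++ f k

theorem gather_congr {f g : ℕ → List ℕ} {k : ℕ} (h : ∀ i, k ≤ i → f i = g i) (d : ℕ) :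
    gather f k d = gather g k d := by
  induction d generalizing k with
  | zero => rfl
  | succ d ih =>
    simp only [gather]
    rw [ih fun i hi => h i (by omega), h k le_rfl]

theorem gather_add {f : ℕ → List ℕ} {k e : ℕ} (h : ∀ i, k ≤ i → i < k + e → f i = []) (d : ℕ) :
    gather f k (e + d) = gather f (k + e) d := by
  induction e generalizing k with
  | zero => simp
  | succ e ih =>
    rw [show e + 1 + d = e + d + 1 by omega, gather, h k le_rfl (by omega), List.append_nil,
      ih fun i h1 h2 => h i (by omega) (by omega)]
    congr 1
    omega

theorem gather_eq_nil {f : ℕ → List ℕ} {k d : ℕ} (h : gather f k d = []) {i : ℕ} (h1 : k ≤ i)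
    (h2 : i < k + d) : f i = [] := by
  induction d generalizing k with
  | zero => omega
  | succ d ih =>
    rw [gather, List.append_eq_nil_iff] at h
    rcases Nat.eq_or_lt_of_le h1 with rfl | h1
    · exact h.2
    · exact ih h.1 h1 (by omega)

theorem gather_eq_singleton {f : ℕ → List ℕ} {k d x : ℕ} (h : gather f k d = [x]) :
    ∃ i, k ≤ i ∧ f i = [x] ∧ ∀ i', k ≤ i' → i' < k + d → i' ≠ i → f i' = [] := by
  induction d generalizing k with
  | zero => simp [gather] at h
  | succ d ih =>
    rw [gather] at h
    cases hf : f k with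
    | nil =>
      rw [hf, List.append_nil] at h
      obtain ⟨i, h1, h2, h3⟩ := ih h
      refine ⟨i, by omega, h2, fun i' h4 h5 h6 => ?_⟩
      rcases Nat.eq_or_lt_of_le h4 with rfl | h4
      · exact hf
      · exact h3 i' h4 (by omega) h6
    | cons y l =>
      have hlen := congrArg List.length h
      rw [hf] at h hlen
      simp only [List.length_append, List.length_cons, List.length_nil] at hlen
      have h0 : gather f (k + 1) d = [] := List.length_eq_zero_iff.1 (by omega)
      rw [h0, List.nil_append] at h
      exact ⟨k, le_rfl, by rw [hf, h], fun i' h1 h2 h3 => gather_eq_nil h0 (by omega) (by omega)⟩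

/-- The blocks of the level `j`, when the first `κ` levels are closed. -/
def blocksAt (K κ : ℕ) (s : ℕ → List ℕ) (j : ℕ) : List (List ℕ) :=
  if j < κ then espBlocks K (s j) else comp K (s j)

def pendAt (K κ : ℕ) (s : ℕ → List ℕ) (j : ℕ) : List ℕ := if j < κ then [] else pnd K (s j)

def Links (σ : ℕ) (D : List (ℕ × ℕ)) (bl : ℕ → List (List ℕ)) (s : ℕ → List ℕ) : Prop :=
  ∀ j, List.Forall₂ (BlockRoot σ D) (bl j) (s (j + 1))

theorem Links.append {σ : ℕ} {D : List (ℕ × ℕ)} {bl : ℕ → List (List ℕ)} {s : ℕ → List ℕ}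
    (h : Links σ D bl s) (E : List (ℕ × ℕ)) : Links σ (D ++ E) bl s :=
  fun j => (h j).imp fun _ _ hb => hb.append E

/-- Append the symbol `x` to the string of the level `k`. -/
def addAt (s : ℕ → List ℕ) (k x : ℕ) : ℕ → List ℕ := Function.update s k (s k ++ [x])

theorem addAt_self (s : ℕ → List ℕ) (k x : ℕ) : addAt s k x k = s k ++ [x] := by simp [addAt]

theorem addAt_ne (s : ℕ → List ℕ) {k j : ℕ} (x : ℕ) (h : j ≠ k) : addAt s k x j = s j := by
  simp [addAt, h]

/-- What is on the stack of a block for which `j` merges are still to be done. -/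
inductive InFlight (σ : ℕ) (D : List (ℕ × ℕ)) : List ℕ → List ℕ → ℕ → Prop
  | pair (x y : ℕ) : InFlight σ D [x, y] [x, y] 1
  | trigram (x y w : ℕ) : InFlight σ D [x, y, w] [x, y, w] 2
  | rest (x y w z : ℕ) : Rule σ D z y w → InFlight σ D [x, y, w] [x, z] 1

/-- During `arrive k` the symbol `x` is already a root for the blocks below, but not yet part of `s
k`. During `merge` and `create` the last finished block `b` of level `k` has no root yet, so the
links hold for `bs` only. The stack equation is required for all large `d`, since levels from `L` on
are empty; so the number of levels may grow without further care. -/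
def Task.Parses (σ K κ : ℕ) (D : List (ℕ × ℕ)) (input queue stack : List ℕ) (L : ℕ)
    (s : ℕ → List ℕ) : Task → Prop
  | .idle => Links σ D (blocksAt K κ s) s ∧ s 0 ++ queue = input ∧
      ∀ d, L ≤ d → stack = gather (pendAt K κ s) 0 d
  | .arrive k => ∃ x, Links σ D (blocksAt K κ s) (addAt s k x) ∧ addAt s k x 0 ++ queue = input ∧
      (∀ i < k, pendAt K κ s i = []) ∧
      ∀ d, L ≤ k + d → stack = gather (pendAt K κ s) k d ++ [x]
  | .merge k j => ∃ bs b ws, Links σ D (Function.update (blocksAt K κ s) k bs) s ∧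
      blocksAt K κ s k = bs ++ [b] ∧ InFlight σ D b ws j ∧ s 0 ++ queue = input ∧
      (∀ i < k + 1, pendAt K κ s i = []) ∧
      ∀ d, L ≤ k + 1 + d → stack = gather (pendAt K κ s) (k + 1) d ++ ws
  | .create k j => ∃ bs b ws, Links σ D (Function.update (blocksAt K κ s) k bs) s ∧
      blocksAt K κ s k = bs ++ [b] ∧ InFlight σ D b ws j ∧ s 0 ++ queue = input ∧
      (∀ i < k + 1, pendAt K κ s i = []) ∧
      ∀ d, L ≤ k + 1 + d → stack = gather (pendAt K κ s) (k + 1) d ++ ws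

/-- Invariant of the construction: the strings `s 0, s 1, …` of the levels. -/
structure AState.Parses (σ K κ : ℕ) (input : List ℕ) (a : AState) (s : ℕ → List ℕ) : Prop where
  levels : ∀ i, κ ≤ i → a.levels.getD i (Level.init K) = lev K (s i)
  nil : ∀ i, a.levels.length ≤ i → s i = []
  task : a.task.Parses σ K κ a.D input a.queue a.stack a.levels.length s

theorem AState.Parses.replace {σ K κ k j x y z : ℕ} {input S : List ℕ} {a : AState}
    {s : ℕ → List ℕ} (h : a.Parses σ K κ input s) (ht : a.task = .merge k j ∨ a.task = .create k j)
    (hS : a.stack = S ++ [x, y]) (E : List (ℕ × ℕ)) (T : List Node)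
    (hz : Rule σ (a.D ++ E) z x y) : (a.replace (a.D ++ E) T k j z).Parses σ K κ input s := by
  refine ⟨h.levels, h.nil, ?_⟩
  have h3 := h.task
  have : (Task.merge k j).Parses σ K κ a.D input a.queue a.stack a.levels.length s := by
    rcases ht with ht | ht <;> rw [ht] at h3 <;> exact h3
  obtain ⟨bs, b, ws, h1, h2, h3, h4, h5, h6⟩ := this
  have hr := (AState.replace_stack hS (a.D ++ E) T k j z).1
  rw [hr]
  show (if j ≤ 1 then Task.arrive (k + 1) else .merge k (j - 1)).Parses σ K κ (a.D ++ E) input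
    a.queue (S ++ [z]) a.levels.length s
  -- With the last merge of a block its root is known: the links become complete, and `z` is on the
  -- way to the next level.
  have hone : ∀ b, blocksAt K κ s k = bs ++ [b] → BlockRoot σ (a.D ++ E) b z →
      Links σ (a.D ++ E) (blocksAt K κ s) (addAt s (k + 1) z) := by
    intro b h2 hb i
    have h1 := h1.append E i
    by_cases hi : i = k
    · subst hi
      rw [Function.update_self] at h1
      rw [addAt_self, h2]
      exact List.rel_append h1 (.cons hb .nil)
    · rw [Function.update_of_ne hi] at h1
      rw [addAt_ne _ _ (by omega)]
      exact h1
  cases h3 with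
  | pair p q =>
    have hst := fun d hd => (h6 d hd).symm.trans hS
    have e : ∀ d, a.levels.length ≤ k + 1 + d → gather (pendAt K κ s) (k + 1) d = S ∧
      p = x ∧ q = y := fun d hd => by simpa using List.append_inj' (hst d hd) rfl
    obtain ⟨-, rfl, rfl⟩ := e a.levels.length (by omega)
    refine ⟨z, hone _ h2 (.two _ _ _ hz), ?_, h5, fun d hd => by rw [(e d hd).1]⟩
    rw [addAt_ne _ _ (by omega), h4]
  | rest p q r w hw =>
    have hst := fun d hd => (h6 d hd).symm.trans hS
    have e : ∀ d, a.levels.length ≤ k + 1 + d → gather (pendAt K κ s) (k + 1) d = S ∧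
      p = x ∧ w = y := fun d hd => by simpa using List.append_inj' (hst d hd) rfl
    obtain ⟨-, rfl, rfl⟩ := e a.levels.length (by omega)
    refine ⟨z, hone _ h2 (.three _ _ _ _ _ (hw.append E) hz), ?_, h5, fun d hd => by
      rw [(e d hd).1]⟩
    rw [addAt_ne _ _ (by omega), h4]
  | trigram p q r =>
    have hst := fun d hd => (h6 d hd).symm.trans hS
    have e : ∀ d, a.levels.length ≤ k + 1 + d → gather (pendAt K κ s) (k + 1) d ++ [p] = S ∧
      q = x ∧ r = y := fun d hd => by
        have := hst d hd
        rw [show gather (pendAt K κ s) (k + 1) d ++ [p, q, r] =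
          (gather (pendAt K κ s) (k + 1) d ++ [p]) ++ [q, r] by simp] at this
        simpa using List.append_inj' this rfl
    obtain ⟨-, rfl, rfl⟩ := e a.levels.length (by omega)
    refine ⟨bs, _, [p, z], h1.append E, h2, .rest p q r z hz, h4, h5, fun d hd => ?_⟩
    rw [← (e d hd).1]
    simp

theorem rule_idxOf {σ x y : ℕ} {D : List (ℕ × ℕ)} (h : (x, y) ∈ D) :
    Rule σ D (σ + D.idxOf (x, y)) x y := by
  have hi : D.idxOf (x, y) < D.length := List.idxOf_lt_length_iff.2 h
  refine ⟨by omega, ?_⟩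
  rw [Nat.add_sub_cancel_left, List.getElem?_eq_getElem hi, List.getElem_idxOf hi]

theorem rule_last (σ x y : ℕ) (D : List (ℕ × ℕ)) :
    Rule σ (D ++ [(x, y)]) (σ + D.length) x y := ⟨by omega, by simp⟩

theorem AState.Parses.arrive {σ K κ k : ℕ} {input : List ℕ} {a : AState} {s : ℕ → List ℕ}
    (hK : 1 ≤ K) (h : a.Parses σ K κ input s) (ht : a.task = .arrive k) (hκ : κ ≤ k)
    (hk : k ≤ a.levels.length) : ∃ s', (a.step σ K).Parses σ K κ input s' := by
  have h3 := h.task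
  rw [ht] at h3
  obtain ⟨x, h1, h2, h3, h4⟩ := h3
  have hx : a.stack.getLastD 0 = x := by rw [h4 a.levels.length (by omega)]; simp
  have hstep : a.step σ K = ⟨a.D, a.T, a.queue, a.stack, a.done,
      putLevel a.levels k ((lev K (s k)).arrive K x).val.1,
      if ((lev K (s k)).arrive K x).val.2 = 0 then .idle
        else .merge k ((lev K (s k)).arrive K x).val.2⟩ := by
    unfold AState.step
    rw [ht]
    simp only
    rw [hx, h.levels k hκ]
    rfl
  have hnk : ¬ k < κ := by omega
  have hb : ∀ j, j ≠ k → blocksAt K κ (addAt s k x) j = blocksAt K κ s j := fun j hj => by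
    unfold blocksAt; rw [addAt_ne _ _ hj]
  have hp : ∀ j, j ≠ k → pendAt K κ (addAt s k x) j = pendAt K κ s j := fun j hj => by
    unfold pendAt; rw [addAt_ne _ _ hj]
  have hbk : blocksAt K κ (addAt s k x) k = comp K (s k ++ [x]) := by
    rw [blocksAt, if_neg hnk, addAt_self]
  have hbk0 : blocksAt K κ s k = comp K (s k) := by rw [blocksAt, if_neg hnk]
  have hpk : pendAt K κ (addAt s k x) k = pnd K (s k ++ [x]) := by
    rw [pendAt, if_neg hnk, addAt_self]
  have hpk0 : pendAt K κ s k = pnd K (s k) := by rw [pendAt, if_neg hnk]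
  rw [comp_append] at hbk
  rw [pnd_append] at hpk
  have hg : ∀ d, gather (pendAt K κ (addAt s k x)) (k + 1) d = gather (pendAt K κ s) (k + 1) d :=
    gather_congr fun i hi => hp i (by omega)
  refine ⟨addAt s k x, ?_, ?_, ?_⟩
  · rw [hstep]
    intro i hi
    simp only
    rw [putLevel_getD _ hk]
    split_ifs with hik
    · rw [hik, addAt_self, lev_append]
    · rw [addAt_ne _ _ hik, h.levels i hi]
  · rw [hstep]
    intro i hi
    simp only at hi
    rw [putLevel_length _ hk] at hi
    rw [addAt_ne _ _ (by omega), h.nil i (by omega)]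
  · rw [hstep]
    simp only
    rw [putLevel_length _ hk]
    by_cases hm : ((lev K (s k)).arrive K x).val.2 = 0
    · rw [if_pos hm] at hbk hpk ⊢
      refine ⟨fun j => ?_, h2, fun d hd => ?_⟩
      · have := h1 j
        by_cases hj : j = k
        · subst hj; rw [hbk, ← hbk0]; exact this
        · rw [hb j hj]; exact this
      · obtain ⟨e, rfl⟩ : ∃ e, d = k + (e + 1) := ⟨d - k - 1, by omega⟩
        rw [gather_add fun i _ hi => by rw [hp i (by omega)]; exact h3 i (by omega), zero_add,
          gather, hg, hpk, h4 (e + 1) (by omega), gather, hpk0, List.append_assoc]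
    · rw [if_neg hm] at hbk hpk ⊢
      have hme := arrive_merges_eq hK (s k) x hm
      have hpl := (comp_pnd hK (s k)).2.1
      refine ⟨comp K (s k), pnd K (s k) ++ [x], pnd K (s k) ++ [x], fun j => ?_, hbk, ?_, h2, ?_,
        fun d hd => ?_⟩
      · have := h1 j
        by_cases hj : j = k
        · subst hj; rw [Function.update_self, ← hbk0]; exact this
        · rw [Function.update_of_ne hj, hb j hj]; exact this
      · rw [hme] at hm ⊢
        match hpn : pnd K (s k) with
        | [] => simp [hpn] at hm
        | [p] => exact .pair p x
        | [p, q] => exact .trigram p q x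
        | _ :: _ :: _ :: _ => simp [hpn] at hpl
      · intro i hi
        by_cases hik : i = k
        · rw [hik, hpk]
        · rw [hp i hik]; exact h3 i (by omega)
      · rw [hg, h4 (d + 1) (by omega), gather, hpk0, List.append_assoc]

theorem AState.Parses.step {σ K κ N M : ℕ} {input : List ℕ} {a : AState} {s : ℕ → List ℕ}
    (hK : 1 ≤ K) (h : a.Parses σ K κ input s) (hc : a.Count K κ N M) :
    ∃ s', (a.step σ K).Parses σ K κ input s' := by
  have hsh := hc.shape
  have hr := hc.ready
  unfold AState.Shape at hsh
  match ht : a.task with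
  | .idle =>
    have h3 := h.task
    rw [ht] at h3
    refine ⟨s, ?_⟩
    unfold AState.step
    rw [ht]
    simp only
    split
    · exact h
    · rename_i c q hq
      obtain ⟨h1, h2, h3⟩ := h3
      refine ⟨h.levels, h.nil, c, fun j => ?_, ?_, by omega, fun d hd => ?_⟩
      · rw [addAt_ne _ _ (by omega)]; exact h1 j
      · rw [addAt_self, ← h2, hq]; simp
      · rw [h3 d (by simpa using hd)]
  | .arrive k =>
    rw [ht] at hr
    exact h.arrive hK ht hr.1 hr.2
  | .merge k j =>
    rw [ht] at hsh
    refine ⟨s, ?_⟩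
    obtain ⟨S, x, y, hS⟩ := exists_eq_append_pair (l := a.stack) (by simp only at hsh; omega)
    unfold AState.step
    rw [ht]
    simp only
    rw [AState.top2_eq hS]
    split_ifs with hm
    · have := h.replace (.inl ht) hS [] a.T (z := σ + a.D.idxOf (x, y)) (by
        rw [List.append_nil]; exact rule_idxOf hm)
      rwa [List.append_nil] at this
    · have h3 := h.task
      rw [ht] at h3
      exact ⟨h.levels, h.nil, h3⟩
  | .create k j =>
    rw [ht] at hsh
    refine ⟨s, ?_⟩
    obtain ⟨S, x, y, hS⟩ := exists_eq_append_pair (l := a.stack) (by simp only at hsh; omega)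
    unfold AState.step
    rw [ht]
    simp only
    rw [AState.top2_eq hS]
    split_ifs with hm
    · have h3 := h.task
      rw [ht] at h3
      exact ⟨h.levels, h.nil, h3⟩
    · exact h.replace (.inr ht) hS _ _ (rule_last _ _ _ _)

/-- Close the level `k`: its last pending symbols form a block. -/
def AState.closeLevel (K k : ℕ) (a : AState) : AState :=
  { a with
    levels := a.levels.set k { a.levels.getD k (Level.init K) with pend := 0 }
    task := if (a.levels.getD k (Level.init K)).pend = 0 then .idle
      else if (a.levels.getD k (Level.init K)).pend = 1 then .arrive (k + 1) else .merge k 1 }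

/-- Counting level `κ` as closed makes its blocks those of the whole string, which adds the pending
symbols as a last block. A single symbol is its own root and moves up; a pair is still to be merged.
-/
theorem AState.Parses.closeLevel {σ K κ : ℕ} {input : List ℕ} {a : AState} {s : ℕ → List ℕ}
    (hK : 1 ≤ K) (h : a.Parses σ K κ input s) (ht : a.task = .idle) :
    (a.closeLevel K κ).Parses σ K (κ + 1) input s := by
  have h3 := h.task
  rw [ht] at h3
  obtain ⟨h1, h2, h3⟩ := h3
  obtain ⟨-, c2, c3, -⟩ := comp_pnd hK (s κ)
  rw [← h.levels κ le_rfl] at c3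
  have hb : ∀ j, j ≠ κ → blocksAt K (κ + 1) s j = blocksAt K κ s j := fun j hj => by
    unfold blocksAt; simp only [show j < κ + 1 ↔ j < κ by omega]
  have hp : ∀ j, j ≠ κ → pendAt K (κ + 1) s j = pendAt K κ s j := fun j hj => by
    unfold pendAt; simp only [show j < κ + 1 ↔ j < κ by omega]
  have hbk : blocksAt K (κ + 1) s κ =
      comp K (s κ) ++ if pnd K (s κ) = [] then [] else [pnd K (s κ)] := by
    rw [blocksAt, if_pos (by omega), espBlocks_eq hK]; rfl
  have hbk0 : blocksAt K κ s κ = comp K (s κ) := by rw [blocksAt, if_neg (by omega)]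
  have hpk0 : pendAt K κ s κ = pnd K (s κ) := by rw [pendAt, if_neg (by omega)]
  have hpl : ∀ i < κ + 1, pendAt K (κ + 1) s i = [] := fun i hi => by rw [pendAt, if_pos hi]
  have hg : ∀ d, gather (pendAt K (κ + 1) s) (κ + 1) d = gather (pendAt K κ s) (κ + 1) d :=
    gather_congr fun i hi => hp i (by omega)
  have hst : ∀ d, a.levels.length ≤ κ + 1 + d →
      a.stack = gather (pendAt K (κ + 1) s) (κ + 1) d ++ pnd K (s κ) := fun d hd => by
    rw [h3 (κ + (d + 1)) (by omega), gather_add fun i _ hi => by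
      rw [pendAt, if_pos (by omega)], zero_add, gather, hg, hpk0]
  refine ⟨fun i hi => ?_, fun i hi => ?_, ?_⟩
  · simp only [AState.closeLevel]
    rw [← h.levels i (by omega)]
    simp only [List.getD_eq_getElem?_getD]
    rw [List.getElem?_set_ne (by omega)]
  · exact h.nil i (by simpa [AState.closeLevel] using hi)
  · simp only [AState.closeLevel, List.length_set]
    rw [c3]
    match hpn : pnd K (s κ) with
    | [] =>
      simp only [List.length_nil, if_true]
      rw [hpn] at hbk hpk0 hst
      rw [if_pos rfl, List.append_nil, ← hbk0] at hbk
      refine ⟨fun j => ?_, h2, fun d hd => ?_⟩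
      · by_cases hj : j = κ
        · rw [hj, hbk]; exact h1 κ
        · rw [hb j hj]; exact h1 j
      · rw [h3 d hd]
        refine gather_congr (fun i _ => ?_) d
        by_cases hi : i = κ
        · rw [hi, hpl κ (by omega), hpk0]
        · rw [hp i hi]
    | [p] =>
      simp only [List.length_singleton, one_ne_zero, if_false, if_true]
      rw [hpn] at hbk hst
      rw [if_neg (by simp), ← hbk0] at hbk
      refine ⟨p, fun j => ?_, ?_, hpl, hst⟩
      · by_cases hj : j = κ
        · rw [hj, hbk, addAt_self]; exact List.rel_append (h1 κ) (.cons (.one p) .nil)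
        · rw [hb j hj, addAt_ne _ _ (by omega)]; exact h1 j
      · rw [addAt_ne _ _ (by omega), h2]
    | [p, q] =>
      simp only [List.length_cons, List.length_nil, zero_add, Nat.reduceAdd, OfNat.ofNat_ne_zero,
        OfNat.ofNat_ne_one, if_false]
      rw [hpn] at hbk hst
      rw [if_neg (by simp)] at hbk
      refine ⟨comp K (s κ), [p, q], [p, q], fun j => ?_, hbk, .pair p q, h2, hpl, hst⟩
      by_cases hj : j = κ
      · rw [hj, Function.update_self, ← hbk0]; exact h1 κ
      · rw [Function.update_of_ne hj, hb j hj]; exact h1 j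
    | _ :: _ :: _ :: _ => simp [hpn] at c2

/-! ### From the strings of the levels to the iterated parsing -/

theorem EspParse.ne_nil {σ K root : ℕ} {D : List (ℕ × ℕ)} {s : List ℕ}
    (h : EspParse σ K D s root) : s ≠ [] := by
  cases h with
  | single => simp
  | level s s' root h2 => intro h; simp [h] at h2

theorem espBlocks_singleton (K x : ℕ) : espBlocks K [x] = [[x]] := by
  simp [espBlocks, blocks]

theorem BlockRoot.singleton_inv {σ x z : ℕ} {D : List (ℕ × ℕ)} (h : BlockRoot σ D [x] z) :
    z = x := by cases h; rfl

/-- The levels may hand a single symbol upwards several times, for which `EspParse` has no step; a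
singleton is therefore identified with the string above it. -/
theorem EspParse.descend {σ K root : ℕ} {D : List (ℕ × ℕ)} {s s' : List ℕ}
    (h : EspParse σ K D s' root) (hf : List.Forall₂ (BlockRoot σ D) (espBlocks K s) s') :
    EspParse σ K D s root := by
  match s with
  | [] =>
    have : espBlocks K [] = [] := by simp [espBlocks, blocks]
    rw [this] at hf
    cases hf
    exact absurd rfl h.ne_nil
  | [x] =>
    rw [espBlocks_singleton] at hf
    cases hf with
    | cons h1 h2 =>
      cases h2
      rw [h1.singleton_inv] at h
      exact h
  | x :: y :: l => exact .level _ _ _ (by simp) hf h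

/-- The only symbol of the stack is pending on one level `m`, and all levels above are empty, so the
string of level `m` is this symbol. Below `m` nothing is pending, so there the finished blocks are
the complete parsing, and one can descend to the input. -/
theorem AState.Parses.espParse {σ K κ root : ℕ} {input : List ℕ} {a : AState} {s : ℕ → List ℕ}
    (hK : 1 ≤ K) (h : a.Parses σ K κ input s) (hr : a.Resting) (hs : a.stack = [root]) :
    EspParse σ K a.D input root := by
  have h3 := h.task
  rw [hr.1] at h3
  obtain ⟨h1, h2, h3⟩ := h3
  rw [hr.2, List.append_nil] at h2
  obtain ⟨m, -, hm, hne⟩ := gather_eq_singleton ((h3 _ le_rfl).symm.trans hs)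
  have hmκ : κ ≤ m := by
    by_contra hc
    rw [pendAt, if_pos (by omega)] at hm
    simp at hm
  rw [pendAt, if_neg (by omega)] at hm
  have hpnd : ∀ i, κ ≤ i → i ≠ m → pnd K (s i) = [] := by
    intro i hi him
    rcases Nat.lt_or_ge i a.levels.length with hl | hl
    · have := hne i (by omega) (by omega) him
      rwa [pendAt, if_neg (by omega)] at this
    · rw [h.nil i hl]; rfl
  have hcomp : ∀ i, κ ≤ i → s (i + 1) = [] → comp K (s i) = [] := by
    intro i hi h0
    have := h1 i
    rw [h0, blocksAt, if_neg (by omega)] at this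
    exact List.forall₂_nil_right_iff.1 this
  -- Induction downwards from the levels that do not exist: an empty string above means no finished
  -- block, and above `m` nothing is pending.
  have hup : ∀ d i, a.levels.length ≤ i + d → m < i → s i = [] := by
    intro d
    induction d with
    | zero => exact fun i hi _ => h.nil i hi
    | succ d ih =>
      intro i hi hmi
      have := (comp_pnd hK (s i)).1
      rw [hcomp i (by omega) (ih (i + 1) (by omega) (by omega)), hpnd i (by omega) (by omega)]
        at this
      simpa using this.symm
  have hsm : s m = [root] := by
    have := (comp_pnd hK (s m)).1
    rw [hcomp m hmκ (hup a.levels.length (m + 1) (by omega) (by omega)), hm] at this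
    simpa using this.symm
  have hdown : ∀ d ≤ m, EspParse σ K a.D (s (m - d)) root := by
    intro d
    induction d with
    | zero => intro _; rw [Nat.sub_zero, hsm]; exact .single _
    | succ d ih =>
      intro hd
      refine (ih (by omega)).descend ?_
      have := h1 (m - (d + 1))
      rw [show m - (d + 1) + 1 = m - d by omega] at this
      unfold blocksAt at this
      split_ifs at this with hlt
      · exact this
      · rw [espBlocks_eq hK, finBlocks, hpnd _ (by omega) (by omega), if_pos rfl, List.append_nil]
        exact this
  have := hdown m le_rfl
  rwa [Nat.sub_self, h2] at this

theorem AState.Parses.enqueue {σ K κ : ℕ} {input : List ℕ} {a : AState} {s : ℕ → List ℕ}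
    (h : a.Parses σ K κ input s) (c : ℕ) :
    ({ a with queue := a.queue ++ [c] } : AState).Parses σ K κ (input ++ [c]) s := by
  refine ⟨h.levels, h.nil, ?_⟩
  have h3 := h.task
  simp only
  match ht : a.task with
  | .idle =>
    rw [ht] at h3
    obtain ⟨h1, rfl, h3⟩ := h3
    exact ⟨h1, by simp, h3⟩
  | .arrive k =>
    rw [ht] at h3
    obtain ⟨x, h1, rfl, h3⟩ := h3
    exact ⟨x, h1, by simp, h3⟩
  | .merge k j =>
    rw [ht] at h3
    obtain ⟨bs, b, ws, h1, h2, h3, rfl, h4⟩ := h3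
    exact ⟨bs, b, ws, h1, h2, h3, by simp, h4⟩
  | .create k j =>
    rw [ht] at h3
    obtain ⟨bs, b, ws, h1, h2, h3, rfl, h4⟩ := h3
    exact ⟨bs, b, ws, h1, h2, h3, by simp, h4⟩

/-! # The strings derived from the symbols -/

/-- Invariant of the construction: the stack and the queue derive the input. -/
structure AState.Derives (σ : ℕ) (input : List ℕ) (a : AState) : Prop where
  stack : ∃ us, List.Forall₂ (Yields σ a.D) a.stack us ∧ us.flatten ++ a.queue = input
  vars : ∀ k < a.D.length, ∃ u, Yields σ a.D (σ + k) u ∧ u.length ≤ input.length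

theorem forall₂_append_pair {A B : Type*} {R : A → B → Prop} {l : List A} {x y : A} {us : List B}
    (h : List.Forall₂ R (l ++ [x, y]) us) :
    ∃ us' u v, us = us' ++ [u, v] ∧ List.Forall₂ R l us' ∧ R x u ∧ R y v := by
  have h1 := (List.forall₂_take_append us l [x, y] h.flip).flip
  have h2 := (List.forall₂_drop_append us l [x, y] h.flip).flip
  generalize hd : us.drop l.length = w at h2
  cases h2 with
  | cons hx h2 =>
    cases h2 with
    | cons hy h2 =>
      cases h2
      exact ⟨us.take l.length, _, _, by rw [← hd, List.take_append_drop], h1, hx, hy⟩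

/-- A new variable derives two adjacent parts of the input in one string, so its length is at most
that of the input. This bounds the entries of `R`. -/
theorem AState.Derives.replace {σ k j x y z : ℕ} {input S : List ℕ} {a : AState}
    (h : a.Derives σ input) (hS : a.stack = S ++ [x, y]) (E : List (ℕ × ℕ)) (T : List Node)
    (hz : Rule σ (a.D ++ E) z x y)
    (hE : ∀ k, a.D.length ≤ k → k < (a.D ++ E).length → σ + k = z) :
    (a.replace (a.D ++ E) T k j z).Derives σ input := by
  obtain ⟨⟨us, h1, h2⟩, h3⟩ := h
  rw [hS] at h1
  obtain ⟨us', u, v, rfl, h4, h5, h6⟩ := forall₂_append_pair h1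
  have hy : Yields σ (a.D ++ E) z (u ++ v) := .var _ _ _ _ _ hz (h5.append E) (h6.append E)
  have hlen := congrArg List.length h2
  simp only [List.flatten_append, List.length_append, List.flatten_cons, List.flatten_nil,
    List.length_nil] at hlen
  refine ⟨⟨us' ++ [u ++ v], ?_, ?_⟩, fun i hi => ?_⟩
  · rw [(AState.replace_stack hS (a.D ++ E) T k j z).1]
    exact List.rel_append (h4.imp fun _ _ hb => hb.append E) (.cons hy .nil)
  · rw [← h2]
    simp [AState.replace]
  · rcases Nat.lt_or_ge i a.D.length with hl | hl
    · obtain ⟨u, hu, hul⟩ := h3 i hl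
      exact ⟨u, hu.append E, hul⟩
    · refine ⟨u ++ v, ?_, by rw [List.length_append]; omega⟩
      rw [hE i hl hi]
      exact hy

theorem AState.Derives.step {σ K : ℕ} {input : List ℕ} {a : AState} (h : a.Derives σ input)
    (hi : a.Inv σ K) (hs : a.Shape) : (a.step σ K).Derives σ input := by
  have h' := h
  obtain ⟨⟨us, h1, h2⟩, h3⟩ := h
  unfold AState.step
  unfold AState.Shape at hs
  split
  · split
    · exact h'
    · rename_i c q hq
      refine ⟨⟨us ++ [[c]], ?_, ?_⟩, h3⟩
      · exact List.rel_append h1 (.cons (.term c (hi.queue_lt c (by simp [hq]))) .nil)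
      · rw [← h2, hq]; simp
  · exact ⟨⟨us, h1, h2⟩, h3⟩
  · rename_i k j ht
    rw [ht] at hs
    obtain ⟨S, x, y, hS⟩ := exists_eq_append_pair (l := a.stack) (by simp only at hs; omega)
    rw [AState.top2_eq hS]
    split_ifs with hm
    · have := h'.replace (k := k) (j := j) hS [] a.T (z := σ + a.D.idxOf (x, y))
        (by rw [List.append_nil]; exact rule_idxOf hm)
        (fun k h1 h2 => by rw [List.append_nil] at h2; omega)
      rwa [List.append_nil] at this
    · exact ⟨⟨us, h1, h2⟩, h3⟩
  · rename_i k j ht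
    rw [ht] at hs
    obtain ⟨S, x, y, hS⟩ := exists_eq_append_pair (l := a.stack) (by simp only at hs; omega)
    rw [AState.top2_eq hS]
    split_ifs
    · exact ⟨⟨us, h1, h2⟩, h3⟩
    · refine h'.replace hS _ _ (rule_last _ _ _ _) fun k h1 h2 => ?_
      simp only [List.length_append, List.length_singleton] at h2
      omega

theorem AState.Derives.enqueue {σ : ℕ} {input : List ℕ} {a : AState} (h : a.Derives σ input)
    (c : ℕ) : ({ a with queue := a.queue ++ [c] } : AState).Derives σ (input ++ [c]) := by
  obtain ⟨⟨us, h1, rfl⟩, h3⟩ := h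
  refine ⟨⟨us, h1, by simp⟩, fun k hk => ?_⟩
  obtain ⟨u, hu, hul⟩ := h3 k hk
  exact ⟨u, hu, by simp at hul ⊢; omega⟩

/-- A variable derives a string of bounded length. -/
theorem Yields.length_le {σ : ℕ} {D : List (ℕ × ℕ)} (hD : RulesOk σ D) {x : ℕ} {u : List ℕ}
    (h : Yields σ D x u) {k : ℕ} (hk : x < σ + k) : u.length ≤ 2 ^ k := by
  induction h generalizing k with
  | term x hx => exact Nat.one_le_two_pow
  | var z x y u v hr _ _ ih1 ih2 =>
    have := hD.lt _ _ _ hr.2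
    have hz := hr.1
    obtain ⟨k, rfl⟩ : ∃ k', k = k' + 1 := ⟨k - 1, by omega⟩
    have h1 := ih1 (k := k) (by omega)
    have h2 := ih2 (k := k) (by omega)
    rw [List.length_append, pow_succ]
    omega

/-! # The invariant of the construction -/

theorem reduceLabel_le {a b k : ℕ} (ha : a < 2 ^ k) (hb : b < 2 ^ k) :
    reduceLabel a b ≤ 2 * k + 1 := by
  have h : lowBit (a ^^^ b) ≤ k := by
    rcases Nat.eq_zero_or_pos (a ^^^ b) with h0 | h0
    -- Equal labels: no bit differs, and `lowBit 0 = 0` by convention.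
    · simp [lowBit, h0]
    · have h1 : 2 ^ lowBit (a ^^^ b) ≤ a ^^^ b := Nat.le_of_dvd h0 pow_padicValNat_dvd
      have h2 : a ^^^ b < 2 ^ k := Nat.xor_lt_two_pow ha hb
      exact (Nat.pow_lt_pow_iff_right (by norm_num)).1 (h1.trans_lt h2) |>.le
  unfold reduceLabel
  split_ifs <;> omega

/-- The entries of a level are small numbers, for labels of the symbols up to `m`. -/
structure Level.Small (K m : ℕ) (v : Level) : Prop where
  age : v.age ≤ 2
  off : v.off ≤ 2 * K
  label_zero : v.labels.getD 0 0 ≤ m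
  label_succ : ∀ i, v.labels.getD (i + 1) 0 ≤ 2 * Nat.size m + 7

theorem Level.Small.mono {K m m' : ℕ} {v : Level} (h : v.Small K m) (hm : m ≤ m') :
    v.Small K m' := by
  have := Nat.size_le_size hm
  exact ⟨h.age, h.off, h.label_zero.trans hm, fun i => (h.label_succ i).trans (by omega)⟩

theorem Level.Small.init (K m : ℕ) : (Level.init K).Small K m := by
  have : ∀ i, (Level.init K).labels.getD i 0 = 0 := fun i => by
    simp only [Level.init, List.getD_eq_getElem?_getD, List.getElem?_replicate]
    split_ifs <;> rfl
  exact ⟨by simp [Level.init], by simp [Level.init], by rw [this]; omega,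
    fun i => by rw [this]; omega⟩

theorem Level.Small.arrive {K m : ℕ} {v : Level} (h : v.Small K m) (hl : v.labels.length = K + 1)
    {x : ℕ} (hx : x ≤ m) : (v.arrive K x).val.1.Small K m := by
  have hm : m < 2 ^ Nat.size m := Nat.lt_size_self m
  -- The bound of a round reproduces itself: labels below `2 ^ (Nat.size m + 3)` lead to at most `2
  -- * (Nat.size m + 3) + 1`, which is `2 * Nat.size m + 7`.
  have hlog : 2 * Nat.size m + 7 < 2 ^ (Nat.size m + 3) := by
    have : Nat.size m + 1 ≤ 2 ^ Nat.size m := Nat.lt_two_pow_self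
    rw [pow_add]
    omega
  refine ⟨?_, ?_, ?_, ?_⟩
  · simp [Level.arrive]
  · simp only [Level.arrive, Timed.bind_val, op_val]
    split_ifs <;> omega
  · rw [Level.arrive_labels, relabel_getD_zero _ _ (by omega)]
    exact hx
  · intro i
    rw [Level.arrive_labels]
    induction i with
    | zero =>
      rcases Nat.lt_or_ge (0 + 1) v.labels.length with hi | hi
      · rw [relabel_getD_succ _ _ _ hi, relabel_getD_zero _ _ (by omega)]
        have := reduceLabel_le (h.label_zero.trans_lt hm) (hx.trans_lt hm)
        omega
      · rw [List.getD_eq_default _ _ (by rw [relabel_length]; omega)]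
        omega
    | succ i ih =>
      rcases Nat.lt_or_ge (i + 1 + 1) v.labels.length with hi | hi
      · rw [relabel_getD_succ _ _ _ hi]
        have := reduceLabel_le ((h.label_succ i).trans_lt hlog) (ih.trans_lt hlog)
        omega
      · rw [List.getD_eq_default _ _ (by rw [relabel_length]; omega)]
        omega

/-- The invariant of the construction for given closed levels and input. -/
structure AState.Good (σ K κ M : ℕ) (input : List ℕ) (a : AState) : Prop where
  inv : a.Inv σ K
  count : a.Count K κ input.length M
  parses : ∃ s, a.Parses σ K κ input s
  derives : a.Derives σ input
  small : ∀ v ∈ a.levels, v.Small K (σ + a.D.length)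
  queue : κ = 0 ∨ a.queue = []
  work : a.work ≤ 8 * a.levels.length + 7

theorem AState.Good.step {σ K κ M : ℕ} {input : List ℕ} {a : AState} (hK : 1 ≤ K)
    (h : a.Good σ K κ M input) : (a.step σ K).Good σ K κ M input := by
  have hsh := h.count.shape
  refine ⟨h.inv.step hsh, h.count.step h.queue, ?_, h.derives.step h.inv hsh, ?_,
    h.queue.imp id (AState.step_queue σ K), ?_⟩
  · obtain ⟨s, hs⟩ := h.parses
    exact hs.step hK h.count
  · have hmono : ∀ v ∈ a.levels, v.Small K (σ + (a.step σ K).D.length) := fun v hv =>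
      (h.small v hv).mono (by have := (AState.step_D_length σ K a).1; omega)
    intro v hv
    unfold AState.step at hv
    split at hv
    · split at hv
      · exact hmono v hv
      · exact hmono v hv
    · rename_i k ht
      change v ∈ putLevel a.levels k _ at hv
      rcases mem_putLevel hv with hv | rfl
      · exact hmono v hv
      · have hx : a.stack.getLastD 0 ≤ σ + (a.step σ K).D.length := by
          unfold AState.Shape at hsh
          rw [ht] at hsh
          have hne : a.stack ≠ [] := List.ne_nil_of_length_pos hsh
          have hx := h.inv.stack_lt _ (List.getLast_mem hne)
          have := (AState.step_D_length σ K a).1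
          rw [List.getLastD_eq_getLast?, List.getLast?_eq_some_getLast hne, Option.getD_some]
          omega
        refine Level.Small.arrive ?_ (h.inv.labels_getD k) hx
        rcases Nat.lt_or_ge k a.levels.length with hk | hk
        · rw [List.getD_eq_getElem _ _ hk]
          exact hmono _ (List.getElem_mem hk)
        · rw [List.getD_eq_default _ _ hk]
          exact .init _ _
    · split_ifs at hv
      · exact hmono v hv
      · exact hmono v hv
    · split_ifs at hv
      · exact hmono v hv
      · exact hmono v hv
  · by_cases hr : a.Resting
    · rw [hr.step]; exact h.work
    · have h1 := AState.work_step hsh h.inv.done_le hr (σ := σ) (K := K)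
      have h2 := AState.step_levels_length σ K a
      have := h.work
      omega

theorem AState.Good.stack_le {σ K κ M : ℕ} {input : List ℕ} {a : AState}
    (h : a.Good σ K κ M input) : a.stack.length ≤ 3 * a.levels.length + 3 ∧
      a.queue.length ≤ 2 * a.levels.length + 1 := by
  have := h.work
  unfold AState.work at this
  omega

theorem forall₂_flatten_length_le {A B : Type*} {R : A → List B → Prop} {c : ℕ} {l : List A}
    {us : List (List B)} (h : List.Forall₂ R l us) (hc : ∀ x ∈ l, ∀ u, R x u → u.length ≤ c) :
    us.flatten.length ≤ l.length * c := by
  induction h with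
  | nil => simp
  | cons h1 _ ih =>
    have := ih fun x hx => hc x (by simp [hx])
    have := hc _ (by simp) _ h1
    simp only [List.flatten_cons, List.length_append, List.length_cons, add_mul]
    omega

/-- The number `L` of levels is logarithmic in the input length, which in turn is at most the sum of
the strings derived by `O(L)` stack symbols, each at most `2 ^ n` long, and the `O(L)` waiting
symbols. This gives `2 ^ L ≤ (10 * L + 9) * 2 ^ n`. -/
theorem AState.Good.levels_le {σ K : ℕ} {input : List ℕ} {a : AState}
    (h : a.Good σ K 0 input.length input) : a.levels.length ≤ 2 * a.D.length + 10 := by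
  obtain ⟨h1, h2⟩ := h.stack_le
  obtain ⟨⟨us, h3, h4⟩, -⟩ := h.derives
  have h5 := forall₂_flatten_length_le h3 (c := 2 ^ a.D.length) fun x hx u hu =>
    hu.length_le h.inv.rules (h.inv.stack_lt x hx)
  have h6 := h.count.levels
  have h7 := congrArg List.length h4
  rw [List.length_append] at h7
  set L := a.levels.length
  set n := a.D.length
  have hn : 1 ≤ 2 ^ n := Nat.one_le_two_pow
  have h8 : a.stack.length * 2 ^ n ≤ (3 * L + 3) * 2 ^ n := Nat.mul_le_mul_right _ h1
  have h9 : 2 ^ L ≤ (10 * L + 9) * 2 ^ n := by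
    have : (10 * L + 9) * 2 ^ n = 2 * ((3 * L + 3) * 2 ^ n) + (4 * L + 3) * 2 ^ n := by ring
    have : (4 * L + 3) * 1 ≤ (4 * L + 3) * 2 ^ n := Nat.mul_le_mul_left _ hn
    omega
  by_contra hc
  obtain ⟨e, he⟩ : ∃ e, L = n + e := ⟨L - n, by omega⟩
  rw [he, pow_add, mul_comm] at h9
  have h10 := Nat.le_of_mul_le_mul_right h9 (by omega)
  -- With `L = n + e` the inequality reads `2 ^ e ≤ 10 * L + 9`; if `L > 2 * n + 10`, then `n ≤ e -
  -- 11` and the right side is at most `20 * e - 101`.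
  have hexp : ∀ e, 20 * e < 2 ^ e + 101 := by
    intro e
    induction e with
    | zero => norm_num
    | succ e ih =>
      rw [pow_succ]
      rcases Nat.lt_or_ge e 5 with h | h
      · have : 0 < 2 ^ e := by positivity
        omega
      · have : 2 ^ 5 ≤ 2 ^ e := Nat.pow_le_pow_right (by norm_num) h
        omega
  have := hexp e
  omega

/-- What holds for every state that occurs during the construction. -/
structure AState.Sound (σ K N : ℕ) (a : AState) : Prop where
  inv : a.Inv σ K
  shape : a.Shape
  small : ∀ v ∈ a.levels, v.Small K (σ + a.D.length)
  pend_le : ∀ v ∈ a.levels, v.pend ≤ 2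
  levels_le : a.levels.length ≤ 2 * a.D.length + 12
  stack_le : a.stack.length ≤ 6 * a.D.length + 39
  queue_le : a.queue.length ≤ 4 * a.D.length + 25
  task_le : a.task.Ready 0 a.levels.length
  total : a.D.length + a.stack.length + a.queue.length ≤ N
  vars : ∀ k < a.D.length, ∃ u, Yields σ a.D (σ + k) u ∧ u.length ≤ N

theorem AState.Good.sound {σ K κ M N : ℕ} {input : List ℕ} {a : AState}
    (h : a.Good σ K κ M input) (hL : a.levels.length ≤ 2 * a.D.length + 12)
    (hN : input.length ≤ N) : a.Sound σ K N := by
  obtain ⟨h1, h2⟩ := h.stack_le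
  refine ⟨h.inv, h.count.shape, h.small, h.count.pend_le, hL, by omega, by omega, ?_,
    h.count.total.trans hN, fun k hk => ?_⟩
  · have := h.count.ready
    revert this
    cases a.task <;> simp only [Task.Ready] <;> first | exact id | omega
  · obtain ⟨u, hu, hul⟩ := h.derives.vars k hk
    exact ⟨u, hu, hul.trans hN⟩

theorem AState.Good.enqueue {σ K : ℕ} {input : List ℕ} {a : AState}
    (h : a.Good σ K 0 input.length input) (hw : a.work ≤ 8 * a.levels.length) {c : ℕ}
    (hc : c < σ) : ({ a with queue := a.queue ++ [c] } : AState).Good σ K 0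
      (input ++ [c]).length (input ++ [c]) := by
  refine ⟨?_, ?_, ?_, h.derives.enqueue c, h.small, .inl rfl, ?_⟩
  · obtain ⟨h1, h2, h3, h4, h5, h6, h7, h8, h9⟩ := h.inv
    refine ⟨h1, h2, h3, ?_, h5, h6, h7, h8, h9⟩
    intro x hx
    rcases List.mem_append.1 hx with hx | hx
    · exact h4 x hx
    · rw [List.mem_singleton.1 hx]; exact hc
  · obtain ⟨h1, h2, h3, h4, h5, h6, h7⟩ := h.count
    refine ⟨h1, h2, h3, h4, ?_, ?_, ?_⟩ <;>
      simp only [List.length_append, List.length_singleton] <;> omega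
  · obtain ⟨s, hs⟩ := h.parses
    exact ⟨s, hs.enqueue c⟩
  · unfold AState.work at hw ⊢
    simp only [List.length_append, List.length_singleton] at hw ⊢
    omega

theorem AState.Good.init (σ K : ℕ) : AState.init.Good σ K 0 ([] : List ℕ).length [] := by
  refine ⟨?_, ?_, ⟨fun _ => [], ?_⟩, ⟨⟨[], by simp [AState.init], by simp [AState.init]⟩, by simp [AState.init]⟩,
    by simp [AState.init],
    .inl rfl, by simp [AState.init, AState.work]⟩
  · refine ⟨⟨by simp [AState.init], by simp [AState.init]⟩, .nil σ, by simp [AState.init],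
      by simp [AState.init], .nil, by simp [AState.init], by simp [AState.init],
      by simp [AState.init], by simp [AState.init]⟩
  · refine ⟨by simp [AState.init], by simp [AState.init, pendSum, Task.flight], trivial, by simp,
      by simp [AState.init, levelMass, Task.mass], by simp [AState.init], by simp [AState.init]⟩
  · refine ⟨fun i _ => by simp [AState.init, lev, run], fun i _ => rfl, fun j => ?_, rfl,
      fun d _ => ?_⟩
    · simp [blocksAt, comp, run]
    · have : ∀ d k, gather (pendAt K 0 fun _ => []) k d = [] := by
        intro d
        induction d with
        | zero => intro k; rfl
        | succ d ih => intro k; rw [gather, ih]; simp [pendAt, pnd, run]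
      rw [this]
      rfl

/-- A single leftover symbol moves from level `κ` to the next level and counts twice as much, so the
bound for the mass rises by `2 ^ κ`. Summed from `2 ^ (l + 1) - 2` on, this is `hM`. Two remaining
symbols, with nothing pending below level `κ`, have mass at least `2 ^ (κ + 1)`, which forces `κ ≤
l`. -/
theorem AState.Good.closeLevel {σ K κ l M : ℕ} {input : List ℕ} {a : AState} (hK : 1 ≤ K)
    (h : a.Good σ K κ M input) (hr : a.Resting) (hs : 2 ≤ a.stack.length)
    (hM : M + 3 = 2 ^ (l + 1) + 2 ^ κ) :
    κ ≤ l ∧ (a.closeLevel K κ).Good σ K (κ + 1) (M + 2 ^ κ) input ∧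
      (a.closeLevel K κ).work ≤ a.work + 2 := by
  have hpm := pendSum_mul_le h.count.closed
  have hst := h.count.stack
  have hms := h.count.mass
  have hwk := h.count.work_le hr
  rw [hr.1] at hst hms
  simp only [Task.flight, Task.mass, hr.2, List.length_nil, add_zero] at hst hms
  rw [← hst] at hpm
  have hκ : κ ≤ l := by
    by_contra hc
    have h1 : 2 ^ (l + 1) ≤ 2 ^ κ := Nat.pow_le_pow_right (by norm_num) (by omega)
    have h2 : 2 * 2 ^ κ ≤ a.stack.length * 2 ^ κ := Nat.mul_le_mul_right _ hs
    omega
  have hwork : (a.closeLevel K κ).work ≤ a.work + 2 := by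
    unfold AState.work AState.closeLevel
    rw [hr.1]
    simp only
    split_ifs <;> simp
  have hget : ∀ i, i ≠ κ → (a.closeLevel K κ).levels.getD i (Level.init K) =
      a.levels.getD i (Level.init K) := fun i hi => by
    simp only [AState.closeLevel, List.getD_eq_getElem?_getD]
    rw [List.getElem?_set_ne (Ne.symm hi)]
  have hmem : ∀ v ∈ (a.closeLevel K κ).levels, v ∈ a.levels ∨
      (κ < a.levels.length ∧ v = { a.levels.getD κ (Level.init K) with pend := 0 }) := by
    intro v hv
    rcases Nat.lt_or_ge κ a.levels.length with hk | hk
    · rcases List.mem_or_eq_of_mem_set hv with hv | rfl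
      · exact .inl hv
      · exact .inr ⟨hk, rfl⟩
    · left
      simpa [AState.closeLevel, List.set_eq_of_length_le hk] using hv
  have hgm : κ < a.levels.length → a.levels.getD κ (Level.init K) ∈ a.levels := fun hk => by
    rw [List.getD_eq_getElem _ _ hk]; exact List.getElem_mem hk
  refine ⟨hκ, ⟨?_, ?_, ?_, ⟨h.derives.stack, h.derives.vars⟩, ?_, .inr hr.2, ?_⟩, hwork⟩
  · obtain ⟨h1, h2, h3, h4, h5, h6, h7, h8, h9⟩ := h.inv
    refine ⟨h1, h2, h3, h4, h5, h6, fun _ => h7 (by simp [hr.1]), ?_, ?_⟩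
    · intro k j hkj
      simp only [AState.closeLevel] at hkj
      split_ifs at hkj
    · intro v hv
      rcases hmem v hv with hv | ⟨hk, rfl⟩
      · exact h9 v hv
      · exact h.inv.labels_getD κ
  · have hp := h.count.pend_le
    rcases Nat.lt_or_ge κ a.levels.length with hk | hk
    · have hput : (a.closeLevel K κ).levels =
          putLevel a.levels κ { a.levels.getD κ (Level.init K) with pend := 0 } := by
        unfold putLevel; rw [if_pos hk]; rfl
      have hps := putLevel_pendSum K { a.levels.getD κ (Level.init K) with pend := 0 } hk.le
      have hlm := putLevel_levelMass K { a.levels.getD κ (Level.init K) with pend := 0 } hk.le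
      rw [← hput] at hps hlm
      simp only [zero_mul, add_zero] at hps hlm
      have hp2 := hp _ (hgm hk)
      have hpos : 1 ≤ 2 ^ κ := Nat.one_le_two_pow
      have htask : (a.closeLevel K κ).task =
        if (a.levels.getD κ (Level.init K)).pend = 0 then .idle
          else if (a.levels.getD κ (Level.init K)).pend = 1 then .arrive (κ + 1)
          else .merge κ 1 := rfl
      have hcl : (a.closeLevel K κ).levels.length = a.levels.length := by
        simp [AState.closeLevel]
      generalize hd : (a.levels.getD κ (Level.init K)).pend = d at *
      refine ⟨?_, ?_, ?_, ?_, ?_, ?_, h.count.total⟩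
      · intro v hv
        rcases hmem v hv with hv | ⟨hk, rfl⟩
        · exact hp v hv
        · simp
      · show a.stack.length = _
        rw [htask]
        split_ifs <;> simp only [Task.flight] <;> omega
      · rw [htask, hcl]
        split_ifs <;> simp only [Task.Ready] <;> omega
      · intro i hi
        by_cases hik : i = κ
        · rw [hput, putLevel_getD _ hk.le, if_pos hik]
        · rw [hget i hik]
          exact h.count.closed i (by omega)
      · show _ + _ + a.queue.length ≤ _
        rw [htask, hr.2]
        have : d = 0 ∨ d = 1 ∨ d = 2 := by omega
        rcases this with rfl | rfl | rfl <;>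
          simp only [Task.mass, List.length_nil, if_true, one_ne_zero, if_false,
            OfNat.ofNat_ne_zero, OfNat.ofNat_ne_one, pow_succ] <;> omega
      · rw [hcl]
        have := h.count.levels
        omega
    · have hinit : a.levels.getD κ (Level.init K) = Level.init K := List.getD_eq_default _ _ hk
      have hlv : (a.closeLevel K κ).levels = a.levels := by
        simp [AState.closeLevel, List.set_eq_of_length_le hk]
      have htask : (a.closeLevel K κ).task = .idle := by
        simp [AState.closeLevel, Level.init, hk]
      have hc := h.count
      refine ⟨by rwa [hlv], ?_, by rw [htask]; trivial, ?_, ?_, ?_, hc.total⟩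
      · show a.stack.length = _
        rw [htask, hlv, hst]
        rfl
      · intro i hi
        rw [hlv]
        by_cases hik : i = κ
        · rw [hik, hinit]; rfl
        · exact hc.closed i (by omega)
      · rw [htask, hlv]
        show _ + 0 + a.queue.length ≤ _
        rw [hr.2, List.length_nil]
        exact hms.trans (Nat.le_add_right _ _)
      · rw [hlv]
        have : 0 ≤ 2 ^ κ := Nat.zero_le _
        exact hc.levels.trans (by gcongr; exact Nat.le_add_right _ _)
  · obtain ⟨s, hs⟩ := h.parses
    exact ⟨s, hs.closeLevel hK hr.1⟩
  · intro v hv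
    rcases hmem v hv with hv | ⟨hk, rfl⟩
    · exact h.small v hv
    · obtain ⟨h1, h2, h3, h4⟩ := h.small _ (hgm hk)
      exact ⟨h1, h2, h3, h4⟩
  · have : (a.closeLevel K κ).levels.length = a.levels.length := by simp [AState.closeLevel]
    omega

/-! # Simulation of the construction -/

/-- Parameters with a word length and table sizes for which the analysis holds. -/
structure Par.Std (σ K : ℕ) (P : Par) : Prop where
  σ : P.σ = σ
  K : P.K = K
  buckets : P.BucketsOk
  w : 0 < P.w

/-- Bound for the length of a position in the tree and of a symbol, for `n` variables. -/
def width (σ n : ℕ) : ℕ := Nat.size (8 * n + σ + 41)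

/-- Bound for the time of one step. -/
def AState.cost (P : Par) (V : ℕ) (a : AState) : ℕ :=
  a.visited P * (17 * V + 20) + (11 * V + 2 * P.K + 30)

/-- The computation `F` leads from states for `a` to states for `a'` by steps in the states `tr`
and `e` other operations. -/
structure Sim (σ K N : ℕ) (a : AState) (tr : List AState) (e : ℕ) (a' : AState)
    (F : Par → State → Timed State) : Prop where
  sound : ∀ b ∈ tr, ∀ c, (c = b ∨ c = b.step σ K) → c.Sound σ K N ∧ c.D.length ≤ a'.D.length
  mono : a.D.length ≤ a'.D.length
  rel : ∀ P : Par, P.Std σ K → ∀ st, Rel P a st → Rel P a' (F P st).val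
  time : ∀ P : Par, P.Std σ K → ∀ st, Rel P a st → ∀ n, a'.D.length ≤ n →
    (F P st).time ≤ (tr.map (AState.cost P (width σ n))).sum + e
  peak : ∀ P : Par, P.Std σ K → ∀ st, Rel P a st → ∀ m,
    (∀ b ∈ tr, ∀ c, (c = b ∨ c = b.step σ K) → ∀ st, Rel P c st → st.size P ≤ m) →
    (F P st).peak ≤ m

theorem Sim.trans {σ K N e₁ e₂ : ℕ} {a a' a'' : AState} {tr₁ tr₂ : List AState}
    {F G : Par → State → Timed State} (h₁ : Sim σ K N a tr₁ e₁ a' F)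
    (h₂ : Sim σ K N a' tr₂ e₂ a'' G) :
    Sim σ K N a (tr₁ ++ tr₂) (e₁ + e₂) a'' (fun P st => F P st >>= G P) := by
  refine ⟨?_, h₁.mono.trans h₂.mono, ?_, ?_, ?_⟩
  · intro b hb c hc
    rcases List.mem_append.1 hb with hb | hb
    · obtain ⟨h3, h4⟩ := h₁.sound b hb c hc
      exact ⟨h3, h4.trans h₂.mono⟩
    · exact h₂.sound b hb c hc
  · intro P hP st hst
    exact h₂.rel P hP _ (h₁.rel P hP st hst)
  · intro P hP st hst n hn
    have h3 := h₁.time P hP st hst n (h₂.mono.trans hn)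
    have h4 := h₂.time P hP _ (h₁.rel P hP st hst) n hn
    rw [Timed.bind_time, List.map_append, List.sum_append]
    omega
  · intro P hP st hst m hm
    rw [Timed.bind_peak]
    refine max_le (h₁.peak P hP st hst m fun b hb => hm b ?_)
      (h₂.peak P hP _ (h₁.rel P hP st hst) m fun b hb => hm b ?_)
    · exact List.mem_append_left _ hb
    · exact List.mem_append_right _ hb

theorem Sim.congr {σ K N e e' : ℕ} {a a' : AState} {tr : List AState}
    {F G : Par → State → Timed State} (h : Sim σ K N a tr e a' F) (he : e ≤ e')
    (hFG : ∀ P : Par, P.Std σ K → ∀ st, Rel P a st → F P st = G P st) : Sim σ K N a tr e' a' G := by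
  refine ⟨h.sound, h.mono, ?_, ?_, ?_⟩
  · intro P hP st hst
    rw [← hFG P hP st hst]
    exact h.rel P hP st hst
  · intro P hP st hst n hn
    rw [← hFG P hP st hst]
    exact (h.time P hP st hst n hn).trans (by omega)
  · intro P hP st hst m hm
    rw [← hFG P hP st hst]
    exact h.peak P hP st hst m hm

/-- A computation that is none of the steps of the construction. -/
theorem Sim.other {σ K N : ℕ} {a a' : AState} {F : Par → State → Timed State} (e : ℕ)
    (hD : a'.D.length = a.D.length)
    (h : ∀ P : Par, P.Std σ K → ∀ st, Rel P a st →
      Rel P a' (F P st).val ∧ (F P st).time ≤ e ∧ (F P st).peak = 0) :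
    Sim σ K N a [] e a' F := by
  refine ⟨by simp, hD.ge, fun P hP st hst => (h P hP st hst).1, ?_, ?_⟩
  · intro P hP st hst n _
    simpa using (h P hP st hst).2.1
  · intro P hP st hst m _
    rw [(h P hP st hst).2.2]
    exact Nat.zero_le m

theorem AState.Sound.tree_length {σ K N : ℕ} {a : AState} (h : a.Sound σ K N) :
    a.T.length = 2 * a.D.length + a.done := by
  have := h.inv.forest.length
  rwa [List.length_take, min_eq_left h.inv.done_le] at this

theorem Sim.step {σ K N : ℕ} {a : AState} (h : a.Sound σ K N)
    (h' : (a.step σ K).Sound σ K N) : Sim σ K N a [a] 0 (a.step σ K) (fun P st => st.step P) := by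
  have hmono := (AState.step_D_length σ K a).1
  have hstep : ∀ P st, (State.step P st).val = (st.perform P).val ∧
      (State.step P st).time = (st.perform P).time ∧
      (State.step P st).peak = (st.perform P).val.size P := by
    intro P st
    refine ⟨rfl, by simp [State.step], ?_⟩
    simp [State.step, State.perform_peak]
  have hspec : ∀ P : Par, P.Std σ K → ∀ st, Rel P a st → ∀ n, a.D.length ≤ n →
      Rel P (a.step σ K) (st.perform P).val ∧ (st.perform P).time ≤ a.cost P (width σ n) := by
    intro P hP st hst n hn
    have h1 := h.tree_length
    have h2 := h.inv.done_le
    have h3 := h.stack_le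
    -- The tree has `2n + done` nodes and the stack at most `6n + 39` symbols; this explains the
    -- constants 8 and 41 in `width`.
    have hV1 : Nat.size (a.T.length + 2) ≤ width σ n := Nat.size_le_size (by omega)
    have hV2 : Nat.size (P.σ + a.D.length + 1) ≤ width σ n :=
      Nat.size_le_size (by rw [hP.σ]; omega)
    have := State.perform_spec hP.buckets hP.w hst (by rw [hP.σ, hP.K]; exact h.inv) h.shape hV1 hV2
    rw [hP.σ, hP.K] at this
    refine ⟨this.1, this.2.trans ?_⟩
    unfold AState.cost
    rw [hP.K]
    omega
  refine ⟨?_, hmono, ?_, ?_, ?_⟩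
  · intro b hb c hc
    rw [List.mem_singleton.1 hb] at hc
    rcases hc with rfl | rfl
    · exact ⟨h, hmono⟩
    · exact ⟨h', le_rfl⟩
  · intro P hP st hst
    rw [(hstep P st).1]
    exact (hspec P hP st hst _ le_rfl).1
  · intro P hP st hst n hn
    rw [(hstep P st).2.1]
    simpa using (hspec P hP st hst n (hmono.trans hn)).2
  · intro P hP st hst m hm
    rw [(hstep P st).2.2]
    exact hm a (by simp) _ (.inr rfl) _ (hspec P hP st hst _ le_rfl).1

/-- The bound for the number of levels is left as the hypothesis `hL`, because it has one proof
while input is read and another while levels are closed. -/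
theorem AState.Good.sim_step {σ K κ M N n₀ : ℕ} {input : List ℕ} {a : AState} (hK : 1 ≤ K)
    (hN : input.length ≤ N)
    (hL : ∀ b : AState, b.Good σ K κ M input → n₀ ≤ b.D.length →
      b.levels.length ≤ 2 * b.D.length + 12)
    (h : a.Good σ K κ M input) (hn : n₀ ≤ a.D.length) :
    Sim σ K N a [a] 0 (a.step σ K) (fun P st => st.step P) :=
  .step (h.sound (hL a h hn) hN)
    ((h.step hK).sound (hL _ (h.step hK) (hn.trans (AState.step_D_length σ K a).1)) hN)

theorem AState.Good.sim_steps {σ K κ M N n₀ : ℕ} {input : List ℕ} (hK : 1 ≤ K)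
    (hN : input.length ≤ N)
    (hL : ∀ b : AState, b.Good σ K κ M input → n₀ ≤ b.D.length →
      b.levels.length ≤ 2 * b.D.length + 12) (f : ℕ) {a : AState}
    (h : a.Good σ K κ M input) (hn : n₀ ≤ a.D.length) :
    ∃ tr a', Sim σ K N a tr 0 a' (fun P st => st.steps P f) ∧ a'.Good σ K κ M input ∧
      tr.length = f ∧ a'.D.length ≤ a.D.length + f ∧ (a'.Resting ∨ a'.work + f ≤ a.work) ∧
      a.levels.length ≤ a'.levels.length ∧ (0 < f → a ∈ tr) ∧ (a.Resting → a'.Resting) := by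
  induction f generalizing a with
  | zero =>
    exact ⟨[], a, .other 0 rfl fun P _ st hst => ⟨hst, le_rfl, rfl⟩, h, rfl, le_rfl, .inr le_rfl,
      le_rfl, by simp, id⟩
  | succ f ih =>
    have hD := AState.step_D_length σ K a
    obtain ⟨tr, a', h1, h2, h3, h4, h5, h6, -, h8⟩ := ih (h.step hK) (hn.trans hD.1)
    refine ⟨a :: tr, a', ((h.sim_step hK hN hL hn).trans h1).congr le_rfl fun P _ st _ => rfl, h2,
      by simp [h3], by omega, ?_, (AState.step_levels_length σ K a).trans h6, by simp,
      fun hr => h8 (by rwa [hr.step])⟩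
    by_cases hr : a.Resting
    · exact .inl (h8 (by rwa [hr.step]))
    · have := AState.work_step h.count.shape h.inv.done_le hr (σ := σ) (K := K)
      rcases h5 with h5 | h5
      · exact .inl h5
      · right; omega

/-- The state between two updates. -/
structure AState.Ready (σ K : ℕ) (input : List ℕ) (a : AState) : Prop where
  good : a.Good σ K 0 input.length input
  work : a.work ≤ 8 * a.levels.length

theorem AState.Ready.init (σ K : ℕ) : AState.init.Ready σ K [] :=
  ⟨.init σ K, by simp [AState.init, AState.work]⟩

theorem Rel.enqueue {P : Par} {a : AState} {st : State} (h : Rel P a st) (c : ℕ) :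
    Rel P { a with queue := a.queue ++ [c] } { st with queue := st.queue ++ [c] } := by
  obtain ⟨h1, h2, h3, h4, h5, h6⟩ := h
  exact ⟨h1, by rw [h2], h3, h4, h5, h6⟩

theorem State.update_val (P : Par) (st : State) (c : ℕ) : (st.update P c).val =
    (State.steps P 16 { st with queue := st.queue ++ [c] }).val := by
  simp [State.update]

theorem State.update_time (P : Par) (st : State) (c : ℕ) : (st.update P c).time =
    (State.steps P 16 { st with queue := st.queue ++ [c] }).time + 1 := by
  simp [State.update, add_comm]

theorem State.update_peak (P : Par) (st : State) (c : ℕ) : (st.update P c).peak =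
    max (State.size P { st with queue := st.queue ++ [c] })
      (State.steps P 16 { st with queue := st.queue ++ [c] }).peak := by
  simp [State.update]

/-- The new symbol raises the work by 7. The 16 steps either bring the machine to rest or lower the
work by 16; in both cases the work is again at most 8 for each level. -/
theorem AState.Ready.sim_update {σ K N : ℕ} (hK : 1 ≤ K) {input : List ℕ} {a : AState}
    (h : a.Ready σ K input) {c : ℕ} (hc : c < σ) (hN : input.length < N) :
    ∃ tr a', Sim σ K N a tr 1 a' (fun P st => st.update P c) ∧ a'.Ready σ K (input ++ [c]) ∧
      tr.length = 16 ∧ a'.D.length ≤ a.D.length + 16 := by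
  have h1 := h.good.enqueue h.work hc
  obtain ⟨tr, a', h2, h3, h4, h5, h6, h7, h8, -⟩ := h1.sim_steps hK (N := N) (n₀ := 0)
    (by simp; omega) (fun b hb _ => hb.levels_le.trans (by omega)) 16 (Nat.zero_le _)
  -- The state just after the symbol has entered the queue heads the trace, so the memory reported
  -- there is covered.
  have hmem := h8 (by norm_num)
  refine ⟨tr, a', ⟨h2.sound, h2.mono, ?_, ?_, ?_⟩, ⟨h3, ?_⟩, h4, h5⟩
  · intro P hP st hst
    rw [State.update_val]
    exact h2.rel P hP _ (hst.enqueue c)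
  · intro P hP st hst n hn
    rw [State.update_time]
    exact Nat.add_le_add_right (h2.time P hP _ (hst.enqueue c) n hn) 1
  · intro P hP st hst m hm
    rw [State.update_peak]
    exact max_le (hm _ hmem _ (.inl rfl) _ (hst.enqueue c)) (h2.peak P hP _ (hst.enqueue c) m hm)
  · rcases h6 with h6 | h6
    · exact h3.count.work_le h6
    · have := h.work
      have hw : ({ a with queue := a.queue ++ [c] } : AState).work = a.work + 7 := by
        simp only [AState.work, List.length_append, List.length_singleton]
        ring
      rw [hw] at h6
      simp only at h7
      omega

theorem AState.Ready.sim_read {σ K N : ℕ} (hK : 1 ≤ K) (s : List ℕ) {input : List ℕ} {a : AState}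
    (h : a.Ready σ K input) (hs : ∀ c ∈ s, c < σ) (hN : input.length + s.length ≤ N) :
    ∃ tr a', Sim σ K N a tr s.length a' (fun P st => st.read P s) ∧ a'.Ready σ K (input ++ s) ∧
      tr.length = 16 * s.length := by
  induction s generalizing input a with
  | nil =>
    exact ⟨[], a, .other 0 rfl fun P _ st hst => ⟨hst, le_rfl, rfl⟩, by simpa using h, rfl⟩
  | cons c s ih =>
    simp only [List.length_cons] at hN
    obtain ⟨tr₁, a₁, h1, h2, h3, -⟩ := h.sim_update hK (hs c (by simp)) (N := N) (by omega)
    obtain ⟨tr₂, a₂, h4, h5, h6⟩ := ih h2 (fun x hx => hs x (by simp [hx])) (by simp; omega)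
    refine ⟨tr₁ ++ tr₂, a₂, (h1.trans h4).congr (by simp; omega) fun P _ st _ => rfl,
      by simpa using h5, ?_⟩
    simp only [List.length_append, List.length_cons]
    omega

/-! ### The end of the input: draining and closing -/

theorem State.drain_resting {P : Par} {a : AState} {st : State} (h : Rel P a st) (hr : a.Resting)
    (f : ℕ) : st.drain P (f + 1) = op st := by
  unfold State.drain
  rw [h.task, h.queue, hr.1, hr.2]

theorem State.drain_step {P : Par} {a : AState} {st : State} (h : Rel P a st) (hr : ¬ a.Resting)
    (f : ℕ) : st.drain P (f + 1) = st.step P >>= fun st => st.drain P f := by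
  have : ¬ (st.task = .idle ∧ st.queue = []) := by rwa [h.task, h.queue]
  rw [State.drain.eq_def]
  simp only
  split
  · rename_i h1 h2
    exact absurd ⟨h1, h2⟩ this
  · rfl

theorem AState.Good.sim_drain {σ K κ M N n₀ : ℕ} {input : List ℕ} (hK : 1 ≤ K)
    (hN : input.length ≤ N)
    (hL : ∀ b : AState, b.Good σ K κ M input → n₀ ≤ b.D.length →
      b.levels.length ≤ 2 * b.D.length + 12) (f : ℕ) {a : AState}
    (h : a.Good σ K κ M input) (hn : n₀ ≤ a.D.length) (hf : a.work < f) :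
    ∃ tr a', Sim σ K N a tr 1 a' (fun P st => st.drain P f) ∧ a'.Good σ K κ M input ∧
      a'.Resting ∧ tr.length + a'.work ≤ a.work := by
  induction f generalizing a with
  | zero => omega
  | succ f ih =>
    by_cases hr : a.Resting
    · refine ⟨[], a, .other 1 rfl fun P _ st hst => ?_, h, hr, by simp⟩
      simp only [State.drain_resting hst hr]
      exact ⟨hst, le_rfl, rfl⟩
    · have hw := AState.work_step h.count.shape h.inv.done_le hr (σ := σ) (K := K)
      have hD := AState.step_D_length σ K a
      obtain ⟨tr, a', h1, h2, h3, h4⟩ := ih (h.step hK) (hn.trans hD.1) (by omega)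
      refine ⟨a :: tr, a', ((h.sim_step hK hN hL hn).trans h1).congr (by omega) fun P _ st hst =>
        (State.drain_step hst hr f).symm, h2, h3, ?_⟩
      simp only [List.length_cons]
      omega

theorem Rel.fuel {P : Par} {a : AState} {st : State} (h : Rel P a st) :
    st.fuel = 100 * (a.queue.length + a.stack.length + a.levels.length + 1) := by
  rw [State.fuel, h.queue, h.stack, h.levels]

theorem State.close_resting {P : Par} {a : AState} {st : State} (h : Rel P a st)
    (hs : a.stack.length ≤ 1) (f k : ℕ) : st.close P (f + 1) k = op st := by
  rw [← h.stack] at hs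
  rw [State.close, if_pos hs]

theorem Timed.eq_of_eq {A : Type} {x y : Timed A} (h₁ : x.val = y.val) (h₂ : x.time = y.time)
    (h₃ : x.peak = y.peak) : x = y := by
  cases x; cases y
  simp only at h₁ h₂ h₃
  rw [h₁, h₂, h₃]

/-- Close a level, without the steps that follow. -/
def State.closeLevel (P : Par) (k : ℕ) (st : State) : Timed State := do
  let v ← op (st.levels.getD k (Level.init P.K))
  let levels ← op (st.levels.set k { v with pend := 0 })
  let task ← op (if v.pend = 0 then Task.idle else if v.pend = 1 then .arrive (k + 1)
    else .merge k 1)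
  pure { st with levels := levels, task := task }

theorem Rel.closeLevel {P : Par} {a : AState} {st : State} (h : Rel P a st) (k : ℕ) :
    Rel P (a.closeLevel P.K k) (st.closeLevel P k).val := by
  obtain ⟨h1, h2, h3, h4, h5, h6⟩ := h
  refine ⟨h1, h2, h3, h4, ?_, ?_⟩
  · simp [State.closeLevel, AState.closeLevel, h5]
  · simp [State.closeLevel, AState.closeLevel, h5]

/-- Each level costs three operations for closing and one at the end of draining, besides the steps,
and adds at most 2 to the work. After `l + 1` levels a single symbol is left, so `l + 2` rounds
suffice. -/
theorem AState.Good.sim_close {σ K N n₀ l : ℕ} {input : List ℕ} (hK : 1 ≤ K)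
    (hN : input.length ≤ N) (hl : l ≤ 2 * n₀ + 10) (f : ℕ) {κ M : ℕ} {a : AState}
    (h : a.Good σ K κ M input) (hr : a.Resting) (hM : M + 3 = 2 ^ (l + 1) + 2 ^ κ)
    (hf : f + κ = l + 2) (hf1 : 1 ≤ f) (hn : n₀ ≤ a.D.length) :
    ∃ tr a' κ' M', Sim σ K N a tr (4 * f) a' (fun P st => st.close P f κ) ∧
      a'.Good σ K κ' M' input ∧ a'.Resting ∧ a'.stack.length ≤ 1 ∧
      a'.levels.length ≤ 2 * a'.D.length + 12 ∧
      tr.length + a'.work ≤ a.work + 2 * f := by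
  induction f generalizing a κ M with
  | zero => omega
  | succ f ih =>
    rcases Nat.lt_or_ge 1 a.stack.length with hs | hs
    · obtain ⟨hκ, h1, h2⟩ := h.closeLevel hK hr hs hM
      have hLl : (a.closeLevel K κ).levels.length = a.levels.length := by
        simp [AState.closeLevel]
      have hw := h.count.work_le hr
      -- Here `M + 2 ^ κ < 2 ^ (l + 2)`, so at most `l + 2` levels can exist; and `l` was bounded by
      -- the number of variables when closing began.
      have hL : ∀ b : AState, b.Good σ K (κ + 1) (M + 2 ^ κ) input → n₀ ≤ b.D.length →
          b.levels.length ≤ 2 * b.D.length + 12 := by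
        intro b hb hnb
        have hlev := hb.count.levels
        by_contra hc
        have h3 : 2 ^ (l + 3) ≤ 2 ^ b.levels.length := Nat.pow_le_pow_right (by norm_num) (by omega)
        have h4 : 2 ^ κ ≤ 2 ^ l := Nat.pow_le_pow_right (by norm_num) hκ
        rw [pow_add] at h3 hM
        omega
      obtain ⟨tr₁, a₁, h3, h4, h5, h6⟩ := h1.sim_drain hK hN hL
        (100 * (a.queue.length + a.stack.length + a.levels.length + 1)) hn (by omega)
      have hmono := h3.mono
      change a.D.length ≤ _ at hmono
      obtain ⟨tr₂, a₂, κ', M', h7, h8, h9, h10, h12, h11⟩ := ih h4 h5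
        (by rw [pow_succ]; omega) (by omega) (by omega) (hn.trans hmono)
      refine ⟨tr₁ ++ tr₂, a₂, κ', M', ?_, h8, h9, h10, h12, ?_⟩
      · have hc : Sim σ K N a [] 3 (a.closeLevel K κ) (fun P st => st.closeLevel P κ) :=
          .other 3 rfl fun P hP st hst => by
            have := hst.closeLevel κ
            rw [hP.K] at this
            exact ⟨this, by simp [State.closeLevel], by simp [State.closeLevel]⟩
        refine (hc.trans (h3.trans h7)).congr (by omega) fun P _ st hst => ?_
        rw [← hst.fuel, State.close, if_neg (by rw [hst.stack]; omega)]
        refine Timed.eq_of_eq rfl ?_ ?_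
        · simp [State.closeLevel]; ring
        · simp [State.closeLevel]
      · rw [List.length_append]
        omega
    · refine ⟨[], a, κ, M, .other _ rfl fun P _ st hst => ?_, h, hr, hs, ?_, by simp⟩
      · simp only [State.close_resting hst hs]
        refine ⟨hst, ?_, rfl⟩
        simp only [op_time]
        omega
      · have hlev := h.count.levels
        by_contra hc
        have h3 : 2 ^ (l + 3) ≤ 2 ^ a.levels.length := Nat.pow_le_pow_right (by norm_num) (by omega)
        have h4 : 2 ^ κ ≤ 2 ^ (l + 1) := Nat.pow_le_pow_right (by norm_num) (by omega)
        rw [pow_add] at h3 hM h4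
        omega

/-! # The finished index -/

/-- Complete the POPPT by its virtual node, and by its only leaf if it has no variable. -/
def State.complete (P : Par) (st : State) : Timed State := do
  let I ← if st.done < st.stack.length then st.I.addLeaf P (st.stack.getD st.done 0) else op st.I
  let B ← I.B.push true
  note ({ st with I := { I with B := B } }.size P)
  op { st with I := { I with B := B } }

theorem State.finish_eq (P : Par) (st : State) : st.finish P =
    (st.drain P st.fuel >>= fun st => st.close P (st.levels.length + 2) 0) >>=
      fun st => st.complete P := by
  refine Timed.eq_of_eq rfl ?_ ?_
  · simp [State.finish, State.complete, add_assoc]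
  · simp [State.finish, State.complete, max_assoc]

theorem State.complete_eq (P : Par) (st : State) : st.complete P =
    (if st.done < st.stack.length then st.I.addLeaf P (st.stack.getD st.done 0) else op st.I) >>=
      (fun I => do
        let B ← I.B.push true
        note ({ st with I := { I with B := B } }.size P)
        op { st with I := { I with B := B } }) := by
  unfold State.complete
  split_ifs <;> rfl

/-- The properties of an index from which its size is found. -/
structure Index.Fits (P : Par) (D : List (ℕ × ℕ)) (N : ℕ) (I : Index) : Prop where
  B : ∃ l, I.B.Represents l ∧ l.length ≤ 8 * D.length + 40
  L : ∃ l, I.L.Ok P.w l ∧ l.length ≤ 8 * D.length + 40 ∧ l.length ≤ N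
  Lh : I.L.h ≤ Nat.size (P.σ + D.length)
  R : List.Forall₂ (fun k r => ∃ u, Yields P.σ D (P.σ + k) u ∧ u.length = r)
      (List.range D.length) I.R
  hash : HashOk P D (max 1 (P.buckets D.length)) I.heads I.next

theorem Rel.fits {P : Par} {σ K N : ℕ} {a : AState} {st : State}
    (h : Rel P a st) (hs : a.Sound σ K N) : st.I.Fits P a.D N := by
  have h1 := hs.tree_length
  have h2 := hs.inv.done_le
  have h3 := hs.stack_le
  have h4 := hs.total
  have h5 := hs.inv.forest.count.2
  rw [List.length_take, min_eq_left h2] at h5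
  refine ⟨⟨_, h.index.base.B, by rw [List.length_map]; omega⟩, ⟨_, h.index.base.L, ?_, ?_⟩,
    h.index.base.Lh, h.index.base.R, h.index.hash⟩
  · rw [filterMap_leafLabel_length]; omega
  · rw [filterMap_leafLabel_length]; omega

/-- The outcome of the construction. -/
structure Outcome (σ K N : ℕ) (input : List ℕ) (a : AState) (P : Par) (r : Timed State) : Prop where
  isIndex : IsIndex P input r.val.I
  n : r.val.I.n = a.D.length
  fits : r.val.I.Fits P a.D N
  stack : r.val.stack = a.stack
  queue : r.val.queue = a.queue
  done : r.val.done = a.done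
  levels : r.val.levels = a.levels
  task : r.val.task = a.task
  time : r.time ≤ 20 * width σ a.D.length + 20
  peak : r.peak = r.val.size P

/-- If the remaining symbol is not yet a node, the forest is empty. Then there is no variable at
all, and the tree is one leaf; this is the input of a single symbol. -/
theorem AState.Sound.exists_poppt {σ K N : ℕ} {a : AState} (h : a.Sound σ K N) {root : ℕ}
    (hs : a.stack = [root]) :
    Poppt σ a.D 0 root (if a.done < 1 then a.T ++ [.leaf root] else a.T) a.D.length ∧
      (a.done < 1 → a.T = [] ∧ a.D.length = 0) := by
  have hf := h.inv.forest
  have hd := h.inv.done_le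
  have hlt := h.inv.stack_lt root (by rw [hs]; simp)
  rw [hs] at hf hd
  simp only [List.length_singleton] at hd
  split_ifs with h1
  · have h0 : a.done = 0 := by omega
    rw [h0, List.take_zero] at hf
    have hc := hf.count.1
    have hT := hf.length
    generalize hT2 : a.T = T at *
    have : a.D.length = 0 ∧ T = [] := by
      generalize a.D.length = m at *
      generalize hw : ([] : List ℕ) = ws at hf
      cases hf with
      | nil => exact ⟨rfl, rfl⟩
      | snoc => simp at hw
    rw [this.1, this.2]
    refine ⟨.leaf 0 root (by omega), fun _ => ⟨rfl, rfl⟩⟩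
  · have h0 : a.done = 1 := by omega
    rw [h0, List.take_of_length_le (by simp), ← List.nil_append [root]] at hf
    obtain ⟨T₀, l, m₀, hT, hf0, hp⟩ := hf.snoc_inv
    have : T₀ = [] ∧ m₀ = 0 := by
      generalize hw : ([] : List ℕ) = ws at hf0
      cases hf0 with
      | nil => exact ⟨rfl, rfl⟩
      | snoc => simp at hw
    rw [this.1, List.nil_append] at hT
    rw [this.2] at hp
    rw [hT]
    exact ⟨hp, fun h => absurd h h1⟩

theorem State.complete_spec {σ K κ M N : ℕ} (hK : 1 ≤ K) {input : List ℕ} {a : AState}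
    (hg : a.Good σ K κ M input) (hsd : a.Sound σ K N) (hr : a.Resting)
    (hs : a.stack.length ≤ 1) (hin : input ≠ []) {P : Par} (hP : P.Std σ K) {st : State}
    (h : Rel P a st) : Outcome σ K N input a P (st.complete P) := by
  obtain ⟨⟨us, hd1, hd2⟩, -⟩ := hg.derives
  rw [hr.2, List.append_nil] at hd2
  obtain ⟨root, hroot⟩ : ∃ root, a.stack = [root] := by
    match hst : a.stack with
    | [] =>
      rw [hst] at hd1
      cases hd1
      exact absurd hd2.symm hin
    | [root] => exact ⟨root, rfl⟩
    | _ :: _ :: _ => rw [hst] at hs; simp at hs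
  have hy : Yields σ a.D root input := by
    rw [hroot] at hd1
    cases hd1 with
    | cons h1 h2 => cases h2; simpa [← hd2] using h1
  obtain ⟨s, hps⟩ := hg.parses
  have hesp := hps.espParse hK hr hroot
  have hroot_lt := hsd.inv.stack_lt root (by rw [hroot]; simp)
  obtain ⟨hpop, hzero⟩ := hsd.exists_poppt hroot
  have htl := hsd.tree_length
  have hdl := hsd.inv.done_le
  have htot := hsd.total
  rw [hroot, List.length_singleton] at hdl htot
  have hWT : Nat.size (a.T.length + 1) ≤ width σ a.D.length := Nat.size_le_size (by omega)
  have hWD : Nat.size (P.σ + a.D.length) ≤ width σ a.D.length :=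
    Nat.size_le_size (by rw [hP.σ]; omega)
  set T' := if a.done < 1 then a.T ++ [Node.leaf root] else a.T with hT'
  set J : Timed Index := if st.done < st.stack.length then
    st.I.addLeaf P (st.stack.getD st.done 0) else op st.I with hJ
  have hJspec : IndexOk P a.D T' J.val ∧ TreeOk σ a.D T' ∧ T'.length ≤ 2 * a.D.length + 1 ∧
      J.time ≤ 11 * width σ a.D.length + 7 ∧ J.peak = 0 := by
    have e : st.stack.length = 1 := by rw [h.stack, hroot]; rfl
    rw [hT', hJ, e, h.done]
    split_ifs with h1
    · have h0 : a.done = 0 := by omega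
      have hget : st.stack.getD a.done 0 = root := by rw [h.stack, hroot, h0]; rfl
      rw [hget]
      have := h.index.addLeaf (by rw [hP.σ]; exact hsd.inv.tree) hP.w (by rw [hP.σ]; exact hroot_lt)
        hWT hWD
      refine ⟨this.1, hsd.inv.tree.push_leaf _, ?_, this.2, Index.addLeaf_peak _ _ _⟩
      rw [List.length_append, List.length_singleton]
      omega
    · exact ⟨h.index, hsd.inv.tree, by omega, by simp, rfl⟩
  obtain ⟨hI, hT, hTl, hJt, hJp⟩ := hJspec
  have hpush := hI.base.B.push hT.bal true
  have hval : (st.complete P).val = { st with I := { J.val with B := (J.val.B.push true).val } } := by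
    rw [State.complete_eq]
    rfl
  have hcount := hpop.count_true
  have hcount2 := hpop.count_eq
  refine ⟨?_, ?_, ?_, ?_, ?_, ?_, ?_, ?_, ?_, ?_⟩
  · rw [hval]
    refine ⟨a.D, root, T', hsd.inv.rules.nodup, by rwa [hP.σ], by rwa [hP.σ, hP.K],
      by rwa [hP.σ], hpush.1, hI.base.L.represents, hI.base.R, hI.hash.heads_length,
      hI.hash.next_length, ?_⟩
    intro i hi
    change i < J.val.heads.length at hi
    rw [hI.hash.heads_length] at hi
    obtain ⟨l, hl1, hl2⟩ := hI.hash.chains i hi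
    have hll : l.length ≤ a.D.length + 1 := by
      have := length_le_of_nodup_lt hl2.1 hl2.lt
      omega
    show (chain J.val.next _ (J.val.heads.getD i 0)).Nodup ∧
      ∀ k, k ∈ chain J.val.next _ (J.val.heads.getD i 0) ↔
        ∃ x y, a.D[k]? = some (x, y) ∧ addr J.val.heads.length (P.hash x y) = i
    rw [hl1.chain_eq hll, hI.hash.heads_length]
    exact hl2
  · rw [hval]
    exact hI.base.R_length
  · rw [hval]
    refine ⟨⟨_, hpush.1, ?_⟩, ⟨_, hI.base.L, ?_, ?_⟩, hI.base.Lh, hI.base.R, hI.hash⟩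
    · simp; omega
    · rw [filterMap_leafLabel_length]; omega
    · rw [filterMap_leafLabel_length]; omega
  · rw [hval]; exact h.stack
  · rw [hval]; exact h.queue
  · rw [hval]; exact h.done
  · rw [hval]; exact h.levels
  · rw [hval]; exact h.task
  · have h1 : (st.complete P).time = J.time + ((J.val.B.push true).time + 1) := by
      rw [State.complete_eq, ← hJ]
      simp
    have h2 := hpush.2
    have h3 : Nat.size ((T'.map Node.bit).length + 1) ≤ width σ a.D.length :=
      Nat.size_le_size (by rw [List.length_map]; omega)
    rw [h1]
    omega
  · have : (st.complete P).peak = max J.peak (max (J.val.B.push true).peak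
      (max ((st.complete P).val.size P) 0)) := by
      rw [hval, State.complete_eq, ← hJ]
      rfl
    rw [this, hJp, Succ.push_peak]
    simp

/-- The states and the outcome of the construction. -/
theorem exists_sim_construct {σ K : ℕ} (hK : 1 ≤ K) (s : List ℕ) (hs : ∀ c ∈ s, c < σ)
    (hne : s ≠ []) : ∃ (tr : List AState) (e : ℕ) (a : AState),
      e ≤ 10 * s.length + 20 ∧ tr.length ≤ 30 * s.length + 30 ∧
      a.Sound σ K s.length ∧ s.length ≤ 2 ^ a.D.length ∧
      (∀ b ∈ tr, ∀ c : AState, (c = b ∨ c = b.step σ K) →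
        c.Sound σ K s.length ∧ c.D.length ≤ a.D.length) ∧
      ∀ P : Par, P.Std σ K → ∃ r : Timed State,
        Outcome σ K s.length s a P r ∧ (construct P s).val = r.val ∧
        (construct P s).time ≤ (tr.map (AState.cost P (width σ a.D.length))).sum + e + r.time ∧
        ∀ m, (∀ b ∈ tr, ∀ c, (c = b ∨ c = b.step σ K) → ∀ st, Rel P c st → st.size P ≤ m) →
          (construct P s).peak ≤ max m r.peak := by
  obtain ⟨tr₁, a₁, h1, h2, h3⟩ := (AState.Ready.init σ K).sim_read hK s hs (N := s.length) (by simp)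
  rw [List.nil_append] at h2
  have hL₁ := h2.good.count.levels
  have hLe : ∀ L, 2 ^ L ≤ 2 * s.length + 1 → L ≤ s.length + 1 := by
    intro L hL
    have : L < 2 ^ L := Nat.lt_two_pow_self
    rcases L with _ | L
    · omega
    · have : L < 2 ^ L := Nat.lt_two_pow_self
      rw [pow_succ] at hL
      omega
  obtain ⟨tr₂, a₂, h4, h5, h6, h7⟩ := h2.good.sim_drain hK le_rfl (n₀ := 0)
    (fun b hb _ => hb.levels_le.trans (by omega))
    (100 * (a₁.queue.length + a₁.stack.length + a₁.levels.length + 1)) (Nat.zero_le _)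
    (by have := h2.work; omega)
  have hL₂ := h5.count.levels
  have hlev := h5.levels_le
  have hmass := levelMass_le h5.count.pend_le
  have hwk := h5.count.work_le h6
  set l := a₂.levels.length with hl
  have hpos : 2 ≤ 2 ^ (l + 1) := by
    have : 1 ≤ 2 ^ l := Nat.one_le_two_pow
    rw [pow_succ]; omega
  -- The bound for the mass is replaced: no longer the input length, but the largest mass of `l`
  -- levels with two pending symbols each. This is the starting value for the closing phase.
  have hg₂ : a₂.Good σ K 0 (2 ^ (l + 1) - 2) s := by
    refine ⟨h5.inv, ⟨h5.count.pend_le, h5.count.stack, h5.count.ready, h5.count.closed, ?_, ?_,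
      h5.count.total⟩, h5.parses, h5.derives, h5.small, .inl rfl, h5.work⟩
    · rw [h6.1, h6.2]
      simp only [Task.mass, List.length_nil]
      omega
    · rw [← hl]
      rw [pow_succ] at hpos ⊢
      omega
  obtain ⟨tr₃, a₃, κ', M', h8, h9, h10, h11, h13, h12⟩ := hg₂.sim_close hK le_rfl hlev (l + 2) h6
    (by rw [pow_zero]; omega) (by omega) (by omega) le_rfl
  have hsim := (h1.trans h4).trans h8
  have hL2 := hLe l hL₂
  have hL1 := hLe _ hL₁
  have hwork1 := h2.work
  have hsd : a₃.Sound σ K s.length := h9.sound h13 le_rfl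
  refine ⟨tr₁ ++ tr₂ ++ tr₃, s.length + 1 + 4 * (l + 2), a₃, by omega, ?_, hsd, ?_, hsim.sound, ?_⟩
  · simp only [List.length_append]
    omega
  -- A single symbol is left, and it derives the whole input.
  · obtain ⟨⟨us, hd1, hd2⟩, -⟩ := h9.derives
    rw [h10.2, List.append_nil] at hd2
    have := forall₂_flatten_length_le hd1 (c := 2 ^ a₃.D.length) fun x hx u hu =>
      hu.length_le h9.inv.rules (h9.inv.stack_lt x hx)
    rw [hd2] at this
    exact this.trans (by simpa using Nat.mul_le_mul_right (2 ^ a₃.D.length) h11)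
  · intro P hP
    have h0 : Rel P AState.init State.init :=
      ⟨IndexOk.empty P hP.buckets.1, rfl, rfl, rfl, rfl, rfl⟩
    have hr₁ := h1.rel P hP _ h0
    have hr₂ := h4.rel P hP _ hr₁
    have hr₃ := h8.rel P hP _ hr₂
    have heq : construct P s = ((State.init.read P s >>= fun st => st.drain P
        (100 * (a₁.queue.length + a₁.stack.length + a₁.levels.length + 1))) >>=
          fun st => st.close P (l + 2) 0) >>= fun st => st.complete P := by
      have e1 := hr₁.fuel
      have e2 : ((State.drain P (100 * (a₁.queue.length + a₁.stack.length + a₁.levels.length + 1))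
        (State.init.read P s).val).val).levels.length = l := by rw [hr₂.levels]
      generalize 100 * (a₁.queue.length + a₁.stack.length + a₁.levels.length + 1) = f at e1 e2 ⊢
      refine Timed.eq_of_eq ?_ ?_ ?_ <;>
        simp only [construct, State.finish_eq, Timed.bind_val, Timed.bind_time, Timed.bind_peak,
          e1, e2, add_assoc, max_assoc]
    refine ⟨_, State.complete_spec hK h9 hsd h10 h11 hne hP hr₃, ?_, ?_, ?_⟩
    · rw [heq]; rfl
    · rw [heq]
      have := hsim.time P hP _ h0 _ le_rfl
      rw [Timed.bind_time]
      exact Nat.add_le_add_right (this.trans (by omega)) _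
    · intro m hm
      rw [heq, Timed.bind_peak]
      exact max_le_max (hsim.peak P hP _ h0 m hm) le_rfl

/-! # The hash function -/

theorem card_filter_mod_le (p r c : ℕ) :
    ((Finset.range p).filter fun v => v % r = c).card ≤ p / r + 1 := by
  rw [← Finset.card_range (p / r + 1)]
  refine Finset.card_le_card_of_injOn (fun v => v / r) ?_ ?_
  · intro v hv
    simp only [Finset.coe_filter, Finset.mem_range, Set.mem_ofPred_eq] at hv
    simp only [Finset.coe_range, Set.mem_Iio]
    have := Nat.div_le_div_right (c := r) hv.1.le
    omega
  · intro v hv v' hv' h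
    simp only [Finset.coe_filter, Finset.mem_range, Set.mem_ofPred_eq] at hv hv' h
    rw [← Nat.div_add_mod v r, ← Nat.div_add_mod v' r, h, hv.2, hv'.2]

theorem addr_mod (m v : ℕ) : addr m v % 2 ^ Nat.log2 m = v % 2 ^ Nat.log2 m := by
  unfold addr
  split_ifs
  · exact Nat.mod_mod_of_dvd _ (pow_dvd_pow 2 (by omega))
  · exact Nat.mod_mod _ _

/-- The address fixes the residue modulo `2 ^ log2 m`, and `m` is at most twice this modulus;
rounding up costs another `m ≤ p`. -/
theorem card_addr_le {p m : ℕ} (hmp : m ≤ p) (i : ℕ) :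
    ((Finset.range p).filter fun v => addr m v = i).card * m ≤ 3 * p := by
  have h1 : ((Finset.range p).filter fun v => addr m v = i).card ≤ p / 2 ^ Nat.log2 m + 1 := by
    refine le_trans (Finset.card_le_card ?_) (card_filter_mod_le p _ (i % 2 ^ Nat.log2 m))
    intro v hv
    simp only [Finset.mem_filter] at hv ⊢
    exact ⟨hv.1, by rw [← hv.2, addr_mod]⟩
  have h2 : m ≤ 2 * 2 ^ Nat.log2 m := by
    have := Nat.lt_log2_self (n := m)
    rw [pow_succ] at this
    omega
  have h3 : p / 2 ^ Nat.log2 m * 2 ^ Nat.log2 m ≤ p := Nat.div_mul_le_self _ _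
  calc _ ≤ (p / 2 ^ Nat.log2 m + 1) * m := Nat.mul_le_mul_right _ h1
    _ = p / 2 ^ Nat.log2 m * m + m := by ring
    _ ≤ p / 2 ^ Nat.log2 m * (2 * 2 ^ Nat.log2 m) + p := by gcongr
    _ ≤ 3 * p := by linarith

/-- The hash function. -/
def hashOf (p : ℕ) (h : Fin p × Fin p × Fin p) (d : ℕ × ℕ) : ℕ :=
  ((h.1 : ℕ) * d.1 + h.2.1 * d.2 + h.2.2) % p

theorem hashOf_lt {p : ℕ} (hp : 0 < p) (h : Fin p × Fin p × Fin p) (d : ℕ × ℕ) :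
    hashOf p h d < p := Nat.mod_lt _ hp

theorem natCast_hashOf (p : ℕ) (h : Fin p × Fin p × Fin p) (d : ℕ × ℕ) :
    ((hashOf p h d : ℕ) : ZMod p) = (h.1 : ℕ) * (d.1 : ℕ) + (h.2.1 : ℕ) * (d.2 : ℕ) + (h.2.2 : ℕ) := by
  rw [hashOf, ZMod.natCast_mod]
  push_cast
  rfl

theorem natCast_inj_of_lt {p a b : ℕ} (ha : a < p) (hb : b < p) (h : (a : ZMod p) = b) : a = b := by
  rw [ZMod.natCast_eq_natCast_iff'] at h
  rwa [Nat.mod_eq_of_lt ha, Nat.mod_eq_of_lt hb] at h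

/-- For fixed multipliers the shift `b` is determined by the hash value, so every hash value is
taken equally often. -/
theorem card_hash_addr_le {p m : ℕ} (hp : 0 < p) (hmp : m ≤ p) (d : ℕ × ℕ) (i : ℕ) :
    (Finset.univ.filter fun h => addr m (hashOf p h d) = i).card * m ≤ 3 * p ^ 3 := by
  have h1 : (Finset.univ.filter fun h => addr m (hashOf p h d) = i).card ≤
      ((Finset.univ : Finset (Fin p × Fin p)) ×ˢ
        (Finset.range p).filter fun v => addr m v = i).card := by
    refine Finset.card_le_card_of_injOn (fun h => ((h.1, h.2.1), hashOf p h d)) ?_ ?_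
    · intro h hh
      simp only [Finset.coe_filter, Finset.mem_univ, true_and, Set.mem_ofPred_eq] at hh
      simp [hh, hashOf_lt hp]
    · rintro ⟨a₁, a₂, b⟩ _ ⟨a₁', a₂', b'⟩ _ h
      simp only [Prod.mk.injEq] at h
      obtain ⟨⟨rfl, rfl⟩, h⟩ := h
      have := congrArg (Nat.cast : ℕ → ZMod p) h
      rw [natCast_hashOf, natCast_hashOf] at this
      have := natCast_inj_of_lt b.2 b'.2 (add_left_cancel this)
      rw [Fin.ext this]
  rw [Finset.card_product, Finset.card_univ, Fintype.card_prod, Fintype.card_fin] at h1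
  calc _ ≤ p * p * _ * m := Nat.mul_le_mul_right _ h1
    _ = p * p * (((Finset.range p).filter fun v => addr m v = i).card * m) := by ring
    _ ≤ p * p * (3 * p) := Nat.mul_le_mul_left _ (card_addr_le hmp i)
    _ = 3 * p ^ 3 := by ring

theorem card_addr_eq_le {p m : ℕ} (hmp : m ≤ p) :
    ((Finset.range p ×ˢ Finset.range p).filter fun v => addr m v.1 = addr m v.2).card * m ≤
      3 * p ^ 2 := by
  rw [Finset.card_filter, Finset.sum_product, Finset.sum_mul]
  calc _ ≤ ∑ _x ∈ Finset.range p, 3 * p := by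
        refine Finset.sum_le_sum fun x _ => ?_
        rw [← Finset.card_filter]
        simp only [eq_comm (a := addr m x)]
        exact card_addr_le hmp _
    _ = 3 * p ^ 2 := by simp; ring

/-- One multiplier and the two hash values determine the hash function: the difference of the two
linear equations gives the other multiplier modulo the prime, then `b` follows. So the collisions
number at most `p` times the pairs of values with the same address. -/
theorem card_hash_collision_le {p m : ℕ} (hp : p.Prime) (hmp : m ≤ p) {d e : ℕ × ℕ}
    (hd : d.1 < p ∧ d.2 < p) (he : e.1 < p ∧ e.2 < p) (hne : d ≠ e) :
    (Finset.univ.filter fun h => addr m (hashOf p h d) = addr m (hashOf p h e)).card * m ≤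
      3 * p ^ 3 := by
  have : Fact p.Prime := ⟨hp⟩
  have key : ∀ f : Fin p × Fin p × Fin p → Fin p,
      (∀ h h', f h = f h' → hashOf p h d = hashOf p h' d → hashOf p h e = hashOf p h' e → h = h') →
      (Finset.univ.filter fun h => addr m (hashOf p h d) = addr m (hashOf p h e)).card * m ≤
        3 * p ^ 3 := by
    intro f hf
    have h1 : (Finset.univ.filter fun h => addr m (hashOf p h d) = addr m (hashOf p h e)).card ≤
        ((Finset.univ : Finset (Fin p)) ×ˢ
          (Finset.range p ×ˢ Finset.range p).filter fun v => addr m v.1 = addr m v.2).card := by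
      refine Finset.card_le_card_of_injOn (fun h => (f h, hashOf p h d, hashOf p h e)) ?_ ?_
      · intro h hh
        simp only [Finset.coe_filter, Finset.mem_univ, true_and, Set.mem_ofPred_eq] at hh
        simp [hh, hashOf_lt hp.pos]
      · intro h _ h' _ hh
        simp only [Prod.mk.injEq] at hh
        exact hf h h' hh.1 hh.2.1 hh.2.2
    rw [Finset.card_product, Finset.card_univ, Fintype.card_fin] at h1
    calc _ ≤ p * _ * m := Nat.mul_le_mul_right _ h1
      _ = p * (((Finset.range p ×ˢ Finset.range p).filter fun v =>
            addr m v.1 = addr m v.2).card * m) := by ring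
      _ ≤ p * (3 * p ^ 2) := Nat.mul_le_mul_left _ (card_addr_eq_le hmp)
      _ = 3 * p ^ 3 := by ring
  -- The multiplier to be recovered must belong to a component in which the two digrams differ; the
  -- other multiplier is kept as `f`.
  by_cases hx : d.1 = e.1
  · have hy : d.2 ≠ e.2 := fun hy => hne (Prod.ext hx hy)
    refine key (fun h => h.1) ?_
    rintro ⟨a₁, a₂, b⟩ ⟨a₁', a₂', b'⟩ h h1 h2
    simp only at h
    subst h
    have h1 := congrArg (Nat.cast : ℕ → ZMod p) h1
    have h2 := congrArg (Nat.cast : ℕ → ZMod p) h2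
    rw [natCast_hashOf, natCast_hashOf] at h1 h2
    simp only at h1 h2
    have h3 : (((a₂ : ℕ) : ZMod p) - ((a₂' : ℕ) : ZMod p)) *
        (((d.2 : ℕ) : ZMod p) - ((e.2 : ℕ) : ZMod p)) = 0 := by
      rw [hx] at h1
      linear_combination h1 - h2
    rcases mul_eq_zero.1 h3 with h3 | h3
    · have ha := natCast_inj_of_lt a₂.2 a₂'.2 (sub_eq_zero.1 h3)
      rw [ha] at h1
      have hb := natCast_inj_of_lt b.2 b'.2 (add_left_cancel h1)
      rw [Fin.ext ha, Fin.ext hb]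
    · exact absurd (natCast_inj_of_lt hd.2 he.2 (sub_eq_zero.1 h3)) hy
  · refine key (fun h => h.2.1) ?_
    rintro ⟨a₁, a₂, b⟩ ⟨a₁', a₂', b'⟩ h h1 h2
    simp only at h
    subst h
    have h1 := congrArg (Nat.cast : ℕ → ZMod p) h1
    have h2 := congrArg (Nat.cast : ℕ → ZMod p) h2
    rw [natCast_hashOf, natCast_hashOf] at h1 h2
    simp only at h1 h2
    have h3 : (((a₁ : ℕ) : ZMod p) - ((a₁' : ℕ) : ZMod p)) *
        (((d.1 : ℕ) : ZMod p) - ((e.1 : ℕ) : ZMod p)) =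
        ((a₂ : ℕ) : ZMod p) * (((e.2 : ℕ) : ZMod p) - ((d.2 : ℕ) : ZMod p)) -
        ((a₂ : ℕ) : ZMod p) * (((e.2 : ℕ) : ZMod p) - ((d.2 : ℕ) : ZMod p)) := by
      linear_combination h1 - h2
    rw [sub_self] at h3
    rcases mul_eq_zero.1 h3 with h3 | h3
    · have ha := natCast_inj_of_lt a₁.2 a₁'.2 (sub_eq_zero.1 h3)
      rw [ha] at h1
      have hb := natCast_inj_of_lt b.2 b'.2 (add_left_cancel h1)
      rw [Fin.ext ha, Fin.ext hb]
    · exact absurd (natCast_inj_of_lt hd.1 he.1 (sub_eq_zero.1 h3)) hx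

theorem sum_countP_mul_le {A B : Type*} [Fintype A] (q : A → B → Bool) {c m : ℕ} {l : List B}
    (h : ∀ d ∈ l, (Finset.univ.filter fun a => q a d = true).card * m ≤ c) :
    (∑ a, l.countP (q a)) * m ≤ l.length * c := by
  induction l with
  | nil => simp
  | cons d l ih =>
    have h1 := ih fun d hd => h d (by simp [hd])
    have h2 := h d (by simp)
    simp only [List.countP_cons, Finset.sum_add_distrib, add_mul, List.length_cons]
    rw [Finset.card_filter] at h2
    omega

theorem sum_bucketCount_mul_le {p m : ℕ} (hp : 0 < p) (hmp : m ≤ p) (σ K : ℕ) (α : ℝ)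
    (D : List (ℕ × ℕ)) (i : ℕ) :
    (∑ h : Fin p × Fin p × Fin p, bucketCount (par σ K α h) D m i) * m ≤
      D.length * (3 * p ^ 3) := by
  refine sum_countP_mul_le _ fun d _ => ?_
  simp only [decide_eq_true_eq]
  exact card_hash_addr_le hp hmp d i

/-- If the digram sought is itself a rule, it is in its list for all `p ^ 3` hash functions, hence
the last term; the other rules are covered by the collision bound. -/
theorem sum_bucketCount_collision_mul_le {p m : ℕ} (hp : p.Prime) (hmp : m ≤ p)
    (σ K : ℕ) (α : ℝ) {D : List (ℕ × ℕ)} (hD : D.Nodup) (hlt : ∀ d ∈ D, d.1 < p ∧ d.2 < p)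
    {e : ℕ × ℕ} (he : e.1 < p ∧ e.2 < p) :
    (∑ h : Fin p × Fin p × Fin p, bucketCount (par σ K α h) D m (addr m (hashOf p h e))) * m ≤
      D.length * (3 * p ^ 3) + p ^ 3 * m := by
  have key : ∀ E : List (ℕ × ℕ), e ∉ E → (∀ d ∈ E, d ∈ D) →
      (∑ h : Fin p × Fin p × Fin p, bucketCount (par σ K α h) E m (addr m (hashOf p h e))) * m ≤
        E.length * (3 * p ^ 3) := by
    intro E heE hE
    refine sum_countP_mul_le _ fun d hd => ?_
    simp only [decide_eq_true_eq]
    exact card_hash_collision_le hp hmp (hlt d (hE d hd)) he fun h => heE (h ▸ hd)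
  by_cases hmem : e ∈ D
  · have h1 := key (D.erase e) (fun h => (hD.mem_erase_iff.1 h).1 rfl) fun d hd =>
      List.mem_of_mem_erase hd
    have h2 : ∀ h : Fin p × Fin p × Fin p,
        bucketCount (par σ K α h) D m (addr m (hashOf p h e)) ≤
          bucketCount (par σ K α h) (D.erase e) m (addr m (hashOf p h e)) + 1 := by
      intro h
      unfold bucketCount
      rw [(List.perm_cons_erase hmem).countP_eq, List.countP_cons]
      split_ifs <;> omega
    have h3 := Finset.sum_le_sum fun h (_ : h ∈ Finset.univ) => h2 h
    rw [Finset.sum_add_distrib] at h3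
    have h4 : ∑ _h : Fin p × Fin p × Fin p, 1 = p ^ 3 := by
      simp [Fintype.card_prod]; ring
    rw [h4] at h3
    have h5 : (D.erase e).length ≤ D.length := List.length_erase_le
    calc _ ≤ _ * m := Nat.mul_le_mul_right _ h3
      _ ≤ (D.erase e).length * (3 * p ^ 3) + p ^ 3 * m := by rw [add_mul]; omega
      _ ≤ _ := by gcongr
  · exact (key D hmem fun d hd => hd).trans (Nat.le_add_right _ _)

/-- The expected number of list entries visited in one step. -/
theorem mean_visited_le {p : ℕ} (hp : p.Prime) (σ K : ℕ) {α : ℝ} (hα : 0 < α) (hα1 : α ≤ 1)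
    {a : AState} (hi : a.Inv σ K) (hs : a.Shape) (hn : a.D.length + σ < p) :
    mean (fun h : Fin p × Fin p × Fin p => a.visited (par σ K α h)) ≤ 6 / α := by
  set n := a.D.length with hnd
  set m := max 1 ⌈α * n⌉₊ with hm
  have hm1 : 1 ≤ m := le_max_left _ _
  have hceil : ⌈α * (n : ℝ)⌉₊ ≤ n := Nat.ceil_le.2 (by nlinarith [Nat.cast_nonneg (α := ℝ) n])
  have hmp : m ≤ p := max_le hp.one_lt.le (by omega)
  -- The average list is short because the load `n / m` is at most `1 / α`.
  have hmα : α * n ≤ m := (Nat.le_ceil _).trans (by exact_mod_cast le_max_right _ _)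
  have hp3 : (0 : ℝ) < (p : ℝ) ^ 3 := by have := hp.pos; positivity
  have hm0 : (0 : ℝ) < m := by exact_mod_cast hm1
  have hm1' : (1 : ℝ) ≤ m := by exact_mod_cast hm1
  have hconv : ∀ (f : Fin p × Fin p × Fin p → ℕ) (c : ℝ),
      ((∑ h, f h : ℕ) : ℝ) * m ≤ c * (p : ℝ) ^ 3 * m → mean f ≤ c := by
    intro f c h
    rw [mean, div_le_iff₀ hp3]
    have := le_of_mul_le_mul_right h hm0
    exact_mod_cast this
  have hα6 : 0 ≤ 6 / α := by positivity
  have hstack : ∀ x ∈ a.stack, x < p := fun x hx => (hi.stack_lt x hx).trans (by omega)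
  have hlt : ∀ d ∈ a.D, d.1 < p ∧ d.2 < p := by
    intro d hd
    obtain ⟨k, hk, rfl⟩ := List.mem_iff_getElem.1 hd
    have := hi.rules.lt k a.D[k].1 a.D[k].2 (by rw [List.getElem?_eq_getElem hk])
    omega
  have hinv : (1 : ℝ) ≤ 1 / α := by rw [le_div_iff₀ hα]; linarith
  have hnm : (n : ℝ) ≤ 1 / α * m := by
    rw [div_mul_eq_mul_div, le_div_iff₀ hα]; linarith
  have h1m : (1 : ℝ) * m ≤ 1 / α * m := by gcongr
  rw [show 6 / α = 6 * (1 / α) by ring]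
  unfold AState.visited
  unfold AState.Shape at hs
  split
  · exact (by simp [mean]; positivity)
  · exact (by simp [mean]; positivity)
  · rename_i k j ht
    rw [ht] at hs
    obtain ⟨S, x, y, hS⟩ := exists_eq_append_pair (l := a.stack) (by simp only at hs; omega)
    have htop := AState.top2_eq hS
    have := sum_bucketCount_collision_mul_le hp hmp σ K α hi.rules.nodup hlt (e := a.top2)
      (by rw [htop]; exact ⟨hstack x (by simp [hS]), hstack y (by simp [hS])⟩)
    refine hconv _ _ ?_
    have h' := (Nat.cast_le (α := ℝ)).2 this
    push_cast at h'
    refine le_trans (le_of_eq ?_) (h'.trans ?_)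
    · push_cast
      rfl
    -- The mean is at most `3 * n / m + 1`, hence at most `3 / α + 1`.
    · rw [← hnd]
      nlinarith
  · rename_i k j ht
    have := sum_bucketCount_mul_le hp.pos hmp σ K α (a.D ++ [a.top2]) (m - 2 ^ Nat.log2 m)
    refine hconv _ _ ?_
    have h' := (Nat.cast_le (α := ℝ)).2 this
    push_cast at h'
    refine le_trans (le_of_eq ?_) (h'.trans ?_)
    · push_cast
      rfl
    -- A fixed entry of the table holds on average at most `3 * (n + 1) / m` of the `n + 1` rules,
    -- hence at most `3 / α + 3`.
    · simp only [List.length_append, List.length_singleton, ← hnd]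
      push_cast
      nlinarith

/-! ### Parameters, and averages over the hash function -/

/-- As `α ≤ 1`, a new variable raises `⌈α n⌉` by at most one, so one split for each variable is
enough. -/
theorem par_bucketsOk {p : ℕ} (σ K : ℕ) {α : ℝ} (hα : 0 < α) (hα1 : α ≤ 1)
    (h : Fin p × Fin p × Fin p) : (par σ K α h).BucketsOk := by
  refine ⟨by simp [par], fun n => ⟨?_, ?_⟩⟩
  · exact Nat.ceil_mono (by push_cast; nlinarith)
  · simp only [par]
    rw [Nat.ceil_le]
    push_cast
    have := Nat.le_ceil (α * (n : ℝ))
    nlinarith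

theorem par_std {p : ℕ} (hp : p.Prime) (σ K : ℕ) {α : ℝ} (hα : 0 < α) (hα1 : α ≤ 1)
    (h : Fin p × Fin p × Fin p) : (par σ K α h).Std σ K :=
  ⟨rfl, rfl, par_bucketsOk σ K hα hα1 h, Nat.size_pos.2 hp.pos⟩

theorem mean_mono {p : ℕ} {f g : Fin p × Fin p × Fin p → ℕ} (h : ∀ x, f x ≤ g x) :
    mean f ≤ mean g := by
  unfold mean
  gcongr with x
  exact_mod_cast h x

theorem mean_add {p : ℕ} (f g : Fin p × Fin p × Fin p → ℕ) :
    mean (fun h => f h + g h) = mean f + mean g := by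
  simp [mean, Finset.sum_add_distrib, add_div]

theorem mean_mul_const {p : ℕ} (f : Fin p × Fin p × Fin p → ℕ) (c : ℕ) :
    mean (fun h => f h * c) = mean f * c := by
  simp [mean, ← Finset.sum_mul, div_mul_eq_mul_div]

theorem mean_const {p : ℕ} (hp : 0 < p) (c : ℕ) :
    mean (fun _ : Fin p × Fin p × Fin p => c) = c := by
  have : (p : ℝ) ≠ 0 := by positivity
  simp [mean, Fintype.card_prod]
  field_simp

/-- The expected time of the steps in the states of a list. -/
theorem mean_cost_le {p : ℕ} (hp : p.Prime) (σ K : ℕ) {α : ℝ} (hα : 0 < α) (hα1 : α ≤ 1) (V : ℕ)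
    {tr : List AState} (htr : ∀ a ∈ tr, a.Inv σ K ∧ a.Shape ∧ a.D.length + σ < p) :
    mean (fun h : Fin p × Fin p × Fin p => (tr.map (AState.cost (par σ K α h) V)).sum) ≤
      tr.length * (6 / α * (17 * V + 20) + (11 * V + 2 * K + 30)) := by
  induction tr with
  | nil => simp [mean]
  | cons a tr ih =>
    have h1 := ih fun b hb => htr b (by simp [hb])
    obtain ⟨h2, h3, h4⟩ := htr a (by simp)
    have h5 := mean_visited_le hp σ K hα hα1 h2 h3 h4
    simp only [List.map_cons, List.sum_cons, mean_add, List.length_cons]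
    have h6 : mean (fun h : Fin p × Fin p × Fin p => a.cost (par σ K α h) V) ≤
        6 / α * (17 * V + 20) + (11 * V + 2 * K + 30) := by
      have : ∀ h : Fin p × Fin p × Fin p, a.cost (par σ K α h) V =
        a.visited (par σ K α h) * (17 * V + 20) + (11 * V + 2 * K + 30) := fun h => rfl
      simp only [this, mean_add, mean_mul_const, mean_const hp.pos]
      push_cast
      gcongr
    push_cast
    linarith

/-! # Sizes -/

theorem size_le_self (n : ℕ) : Nat.size n ≤ n := by
  rw [Nat.size_le]; exact Nat.lt_two_pow_self

theorem two_pow_size_le (n : ℕ) : 2 ^ Nat.size n ≤ 2 * n + 1 := by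
  rcases Nat.eq_zero_or_pos (Nat.size n) with h | h
  · rw [h, pow_zero]; omega
  · have : 2 ^ (Nat.size n - 1) ≤ n := Nat.lt_size.1 (by omega)
    obtain ⟨k, hk⟩ : ∃ k, Nat.size n = k + 1 := ⟨Nat.size n - 1, by omega⟩
    rw [hk] at this ⊢
    rw [Nat.add_sub_cancel] at this
    rw [pow_succ]; omega

theorem IsChain.next_le {next : List ℕ} {c : ℕ} {l : List ℕ} (h : IsChain next c l) :
    c ≤ next.length ∧ ∀ k ∈ l, next.getD k 0 ≤ next.length := by
  induction h with
  | nil => simp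
  | cons k l hk _ ih =>
    refine ⟨hk, fun j hj => ?_⟩
    rcases List.mem_cons.1 hj with rfl | hj
    · exact ih.1
    · exact ih.2 j hj

theorem HashOk.heads_le {P : Par} {D : List (ℕ × ℕ)} {m : ℕ} {heads next : List ℕ}
    (h : HashOk P D m heads next) : ∀ c ∈ heads, c ≤ D.length := by
  intro c hc
  obtain ⟨i, hi, rfl⟩ := List.mem_iff_getElem.1 hc
  obtain ⟨l, h1, -⟩ := h.chains i (by rw [← h.heads_length]; exact hi)
  have := h1.next_le.1
  rwa [List.getD_eq_getElem _ _ hi, h.next_length] at this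

theorem HashOk.next_le {P : Par} {D : List (ℕ × ℕ)} {m : ℕ} (hm : 0 < m) {heads next : List ℕ}
    (h : HashOk P D m heads next) : ∀ c ∈ next, c ≤ D.length := by
  intro c hc
  obtain ⟨k, hk, rfl⟩ := List.mem_iff_getElem.1 hc
  have hkD : k < D.length := by rw [← h.next_length]; exact hk
  obtain ⟨l, h1, -, h2⟩ := h.chains (addr m (P.hash D[k].1 D[k].2)) (addr_lt hm _)
  have := h1.next_le.2 k ((h2 k).2 ⟨_, _, List.getElem?_eq_getElem hkD, rfl⟩)
  rwa [List.getD_eq_getElem _ _ hk, h.next_length] at this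

theorem Par.BucketsOk.le {P : Par} (h : P.BucketsOk) (n : ℕ) : P.buckets n ≤ n := by
  induction n with
  | zero => rw [h.1]
  | succ n ih => have := (h.2 n).2; omega

/-- The hash function has parameters below the prime, which exceeds the length of the input. -/
structure Par.Small (N : ℕ) (P : Par) : Prop where
  N : N < P.p
  a₁ : P.a₁ ≤ P.p
  a₂ : P.a₂ ≤ P.p
  b : P.b ≤ P.p

/-- An upper bound for the number of nodes, symbols and stored numbers. -/
def scale (σ n : ℕ) : ℕ := 8 * n + σ + 41

theorem size_scale (σ n : ℕ) : Nat.size (scale σ n) = width σ n := rfl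

theorem width_le_scale (σ n : ℕ) : width σ n ≤ scale σ n := size_le_self _

theorem six_le_width (σ n : ℕ) : 6 ≤ width σ n := by
  have : Nat.size 41 ≤ width σ n := Nat.size_le_size (by omega)
  have h : Nat.size 41 = 6 := by decide
  omega

theorem size_le_width {σ n m : ℕ} (h : m ≤ scale σ n) : Nat.size m ≤ width σ n :=
  Nat.size_le_size h

theorem scale_mono (σ : ℕ) {n m : ℕ} (h : n ≤ m) : scale σ n ≤ scale σ m := by
  unfold scale; omega

theorem width_mono (σ : ℕ) {n m : ℕ} (h : n ≤ m) : width σ n ≤ width σ m :=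
  Nat.size_le_size (scale_mono σ h)

theorem arrBits_le_of {l : List ℕ} {Q V m W : ℕ} (hl : l.length ≤ Q) (hQ : Nat.size Q ≤ V)
    (h : ∀ x ∈ l, x ≤ m) (hm : Nat.size m ≤ W) : arrBits l ≤ Q * W + V := by
  refine (arrBits_le h).trans ?_
  gcongr
  exact (Nat.size_le_size hl).trans hQ

/-- Apart from the hash parameters, only `R` has entries that are not bounded by the scale; they are
at most `N`, which gives the leading term. All other arrays and trees are charged to `scale *
width`. -/
theorem Index.Fits.size_le {P : Par} {σ K N : ℕ} (hP : P.Std σ K) (hsm : P.Small N)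
    {D : List (ℕ × ℕ)} {I : Index} (h : I.Fits P D N)
    (hvars : ∀ k < D.length, ∃ u, Yields σ D (σ + k) u ∧ u.length ≤ N) :
    I.size P ≤ D.length * Nat.size N + 4 * Nat.size P.p +
      60 * (scale σ D.length * width σ D.length) := by
  obtain ⟨⟨lB, hB, hBl⟩, ⟨lL, hL, hLl, hLN⟩, hLh, hR, hH⟩ := h
  rw [hP.σ] at hLh hR
  set n := D.length with hn
  have hVQ := width_le_scale σ n
  have hV6 := six_le_width σ n
  have hQs := size_scale σ n
  have hQ : scale σ n = 8 * n + σ + 41 := rfl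
  set Q := scale σ n
  set V := width σ n
  have hQV : V * 1 ≤ V * Q := Nat.mul_le_mul_left _ (by omega)
  have hQV' : Q * 1 ≤ Q * V := Nat.mul_le_mul_left _ (by omega)
  have hVV : V * V ≤ Q * V := Nat.mul_le_mul_right _ hVQ
  have hcomm : V * Q = Q * V := mul_comm _ _
  have eB : I.B.size ≤ 7 * (Q * V) := by
    have h1 : Nat.size (lB.length + 1) ≤ V := size_le_width (by show _ ≤ 8 * n + σ + 41; omega)
    have h2 : 2 * (lB.length + 1) * Nat.size (lB.length + 1) ≤ 2 * Q * V := by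
      gcongr; omega
    have h3 : Nat.size (lB.length + 1) ^ 2 ≤ V * V := by
      rw [sq]; gcongr
    have := hB.size_le
    have h4 : 2 * Q * V = 2 * (Q * V) := by ring
    omega
  have eL : I.L.size ≤ 28 * (Q * V) := by
    have hw : Nat.size lL.length ≤ P.w := Nat.size_le_size (hLN.trans hsm.N.le)
    have h1 := hL.size_le le_rfl hw
    have h2 : Nat.size lL.length ≤ V := size_le_width (by show _ ≤ 8 * n + σ + 41; omega)
    have h3 : I.L.h ≤ V := hLh.trans (size_le_width (by show _ ≤ 8 * n + σ + 41; omega))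
    -- The height of the wavelet tree is at most the length of a symbol, so even a complete tree has
    -- only `O(n + σ)` nodes.
    have h4 : 2 ^ I.L.h ≤ 2 * Q := by
      refine (Nat.pow_le_pow_right (by norm_num) hLh).trans ((two_pow_size_le _).trans ?_)
      omega
    have h5 : 2 ^ I.L.h * (3 * Nat.size lL.length + 3 * (I.L.h + 1)) ≤ 2 * Q * (9 * V) := by
      gcongr; omega
    have h6 : 2 * I.L.h * lL.length ≤ 2 * V * Q := by
      gcongr; omega
    have h7 : 2 * Q * (9 * V) = 18 * (Q * V) := by ring
    have h8 : 2 * V * Q = 2 * (Q * V) := by ring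
    omega
  have eR : arrBits I.R ≤ n * Nat.size N + V := by
    have hlen : I.R.length = n := by rw [← hR.length_eq, List.length_range]
    refine arrBits_le_of hlen.le (size_le_width (by show _ ≤ 8 * n + σ + 41; omega)) ?_ le_rfl
    intro r hr
    obtain ⟨k, hk, rfl⟩ := List.mem_iff_getElem.1 hr
    obtain ⟨u, hu, hul⟩ := List.forall₂_iff_get.1 hR |>.2 k (by rw [List.length_range]; omega) hk
    simp only [List.get_eq_getElem, List.getElem_range] at hu hul
    obtain ⟨u', hu', hul'⟩ := hvars k (by omega)
    -- A symbol derives only one string, so the stored length is the one bounded by `hvars`.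
    rw [hu.unique hu'] at hul
    omega
  have hm := hP.buckets.le n
  have eH : arrBits I.heads ≤ Q * V + V := by
    refine arrBits_le_of ?_ hQs.le hH.heads_le (size_le_width ?_)
    · rw [hH.heads_length]
      exact max_le (by omega) (by omega)
    · show _ ≤ 8 * n + σ + 41; omega
  have eN : arrBits I.next ≤ Q * V + V := by
    refine arrBits_le_of ?_ hQs.le (hH.next_le (by omega)) (size_le_width ?_)
    · rw [hH.next_length]; omega
    · show _ ≤ 8 * n + σ + 41; omega
  have p1 : Nat.size P.a₁ ≤ Nat.size P.p := Nat.size_le_size hsm.a₁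
  have p2 : Nat.size P.a₂ ≤ Nat.size P.p := Nat.size_le_size hsm.a₂
  have p3 : Nat.size P.b ≤ Nat.size P.p := Nat.size_le_size hsm.b
  unfold Index.size
  omega

/-- Stack, queue and levels have `O(n)` entries, so the critical component is the table of labels,
`K + 1` for each level; `hK` says that the labels of one level need `O(V)` bits. -/
theorem AState.Sound.size_le {P : Par} {σ K N : ℕ} (hP : P.Std σ K) (hsm : P.Small N)
    {a : AState} (h : a.Sound σ K N) {st : State} (hI : st.I.Fits P a.D N)
    (hs : st.stack = a.stack) (hq : st.queue = a.queue) (hd : st.done = a.done)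
    (hl : st.levels = a.levels) (ht : st.task = a.task)
    {n : ℕ} (hn : a.D.length ≤ n)
    (hK : (K + 1) * Nat.size (2 * width σ n + 7) ≤ 25 * width σ n) :
    st.size P ≤ n * Nat.size N + 4 * Nat.size P.p + 300 * (scale σ n * width σ n) := by
  have hIs := (hI.size_le hP hsm h.vars).trans (Nat.add_le_add (Nat.add_le_add_right
    (Nat.mul_le_mul_right (Nat.size N) hn) _) (Nat.mul_le_mul_left 60
      (Nat.mul_le_mul (scale_mono σ hn) (width_mono σ hn))))
  obtain ⟨hinv, hsh, hsmall, hpend, hL, hst, hqu, htk, -, -⟩ := h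
  have hVQ := width_le_scale σ n
  have hV6 := six_le_width σ n
  have hQs := size_scale σ n
  have hQ : scale σ n = 8 * n + σ + 41 := rfl
  have hsn : Nat.size (σ + a.D.length) ≤ width σ n := size_le_width (by rw [hQ]; omega)
  have hσV : Nat.size σ ≤ width σ n := size_le_width (by rw [hQ]; omega)
  have hdV : Nat.size a.done ≤ width σ n := size_le_width (by have := hinv.done_le; omega)
  set Q := scale σ n
  set V := width σ n
  have hQV : V * 1 ≤ V * Q := Nat.mul_le_mul_left _ (by omega)
  have hQV' : Q * 6 ≤ Q * V := Nat.mul_le_mul_left _ (by omega)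
  have hcomm : V * Q = Q * V := mul_comm _ _
  have hK1 : K + 1 ≤ 25 * V := by
    refine le_trans ?_ hK
    exact Nat.le_mul_of_pos_right _ (Nat.size_pos.2 (by omega))
  have hlev : ∀ f : Level → ℕ, (a.levels.map f).length ≤ Q := fun f => by
    rw [List.length_map]; omega
  have hmap : ∀ (f : Level → ℕ) (m W : ℕ), (∀ v ∈ a.levels, f v ≤ m) → Nat.size m ≤ W →
      arrBits (a.levels.map f) ≤ Q * W + V := fun f m W h1 h2 =>
    arrBits_le_of (hlev f) hQs.le (by simpa using h1) h2
  have s1 : Nat.size 1 ≤ 1 := by decide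
  have s2 : Nat.size 2 ≤ 2 := by decide
  have e1 : arrBits a.queue ≤ Q * V + V :=
    arrBits_le_of (by omega) hQs.le (fun x hx => (hinv.queue_lt x hx).le) hσV
  have e2 : arrBits a.stack ≤ Q * V + V :=
    arrBits_le_of (by omega) hQs.le (fun x hx => (hinv.stack_lt x hx).le) hsn
  have e3 := hmap Level.pend 2 2 hpend s2
  have e4 := hmap Level.age 2 2 (fun v hv => (hsmall v hv).age) s2
  have e5 := hmap (fun v => v.rep.toNat) 1 1 (fun v _ => Bool.toNat_le _) s1
  have e6 := hmap (fun v => v.rep'.toNat) 1 1 (fun v _ => Bool.toNat_le _) s1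
  -- A crude estimate is enough: the length of `2 * K` is at most `2 * K` itself.
  have e7 := hmap Level.off (2 * K) (50 * V) (fun v hv => (hsmall v hv).off)
    ((size_le_self _).trans (by omega))
  have e8 := hmap (fun v => v.cut.toNat) 1 1 (fun v _ => Bool.toNat_le _) s1
  have e9 := hmap (fun v => v.up.toNat) 1 1 (fun v _ => Bool.toNat_le _) s1
  -- Round 0 keeps symbols of `V` bits. The other `K` rounds keep labels of only `W` bits, and `hK`
  -- bounds `(K + 1) * W`.
  have e10 : (∑ j ∈ Finset.range (K + 1), arrBits (a.levels.map fun v => v.labels.getD j 0)) ≤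
      51 * (Q * V) + Q * V := by
    rw [Finset.sum_range_succ']
    have h0 := hmap (fun v => v.labels.getD 0 0) (σ + a.D.length) V
      (fun v hv => (hsmall v hv).label_zero) hsn
    set W := Nat.size (2 * V + 7) with hW
    have h1 : ∀ j ∈ Finset.range K, arrBits (a.levels.map fun v => v.labels.getD (j + 1) 0) ≤
        Q * W + V := by
      intro j _
      refine hmap _ (2 * V + 7) W (fun v hv => ((hsmall v hv).label_succ j).trans (by omega)) le_rfl
    have h2 := Finset.sum_le_sum h1
    rw [Finset.sum_const, Finset.card_range, smul_eq_mul] at h2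
    have h3 : K * (Q * W + V) + Q * W + V = Q * ((K + 1) * W) + (K + 1) * V := by ring
    have h4 : Q * ((K + 1) * W) ≤ Q * (25 * V) := Nat.mul_le_mul_left _ hK
    have h5 : (K + 1) * V ≤ 25 * V * Q := Nat.mul_le_mul hK1 hVQ
    have h6 : Q * (25 * V) = 25 * (Q * V) := by ring
    have h7 : 25 * V * Q = 25 * (Q * V) := by ring
    omega
  have e7' : Q * (50 * V) = 50 * (Q * V) := by ring
  have e11 : (match a.task with
    | .idle => 2
    | .arrive k => 2 + Nat.size k
    | .merge k j => 2 + Nat.size k + Nat.size j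
    | .create k j => 2 + Nat.size k + Nat.size j) ≤ 2 + 2 * V := by
    unfold AState.Shape at hsh
    split <;> rename_i ht' <;> rw [ht'] at hsh htk <;> simp only [Task.Ready] at hsh htk
    · omega
    · rename_i k
      have : Nat.size k ≤ V := size_le_width (by omega)
      omega
    · rename_i k j
      have : Nat.size k ≤ V := size_le_width (by omega)
      have : Nat.size j ≤ V := size_le_width (by omega)
      omega
    · rename_i k j
      have : Nat.size k ≤ V := size_le_width (by omega)
      have : Nat.size j ≤ V := size_le_width (by omega)
      omega
  have e12 : Nat.size K ≤ 25 * V := (size_le_self _).trans (by omega)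
  unfold State.size
  rw [hs, hq, hd, hl, ht, hP.K, hP.σ]
  refine (Nat.add_le_add_left e11 _).trans ?_
  omega

/-! # The iterated logarithm -/

/-- Since `m + 1 ≤ 2 ^ m`, each logarithm lowers the bound by at least one. -/
theorem exists_iterate_logb_le_one_of_le (m : ℕ) {x : ℝ} (h : x ≤ m) :
    ∃ i ≤ m, (Real.logb 2)^[i] x ≤ 1 := by
  induction m generalizing x with
  | zero => exact ⟨0, le_rfl, by simp only [Nat.cast_zero] at h; simp; linarith⟩
  | succ m ih =>
    rcases le_or_gt x 1 with hx | hx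
    · exact ⟨0, Nat.zero_le _, hx⟩
    · have h1 : Real.logb 2 x ≤ m := by
        rw [Real.logb_le_iff_le_rpow (by norm_num) (by linarith), Real.rpow_natCast]
        refine h.trans ?_
        have : m + 1 ≤ 2 ^ m := Nat.lt_two_pow_self
        exact_mod_cast this
      obtain ⟨i, hi, h2⟩ := ih h1
      exact ⟨i + 1, by omega, by rwa [Function.iterate_succ_apply]⟩

/-- Stopping at the first value that is at most 1 avoids logarithms of numbers that are not
positive. -/
theorem exists_iterate_logb_succ {b : ℕ} {x y : ℝ} (hxy : x ≤ 2 ^ y)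
    (h : ∀ z ≤ y, ∃ i ≤ b, (Real.logb 2)^[i] z ≤ 1) :
    ∃ i ≤ b + 1, (Real.logb 2)^[i] x ≤ 1 := by
  rcases le_or_gt x 1 with hx | hx
  · exact ⟨0, Nat.zero_le _, hx⟩
  · have h1 : Real.logb 2 x ≤ y := by
      rwa [Real.logb_le_iff_le_rpow (by norm_num) (by linarith)]
    obtain ⟨i, hi, h2⟩ := h _ h1
    exact ⟨i + 1, by omega, by rwa [Function.iterate_succ_apply]⟩

/-- Three logarithms bring `2 ^ n` below `m = Nat.size (Nat.size n)`, and `m` more iterations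
certainly suffice. This crude bound is good enough, because `K` is only multiplied by the doubly
logarithmic length of a label. -/
theorem lgStar_le {u n : ℕ} (hu : 2 ≤ u) (h : u ≤ 2 ^ n) :
    1 ≤ lgStar u ∧ lgStar u ≤ 3 + Nat.size (Nat.size n) := by
  have key : ∃ i ≤ 3 + Nat.size (Nat.size n), (Real.logb 2)^[i] (u : ℝ) ≤ 1 := by
    set m := Nat.size (Nat.size n) with hm
    have h1 : ∀ z : ℝ, z ≤ (2 : ℝ) ^ (m : ℝ) → ∃ i ≤ m + 1, (Real.logb 2)^[i] z ≤ 1 :=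
      fun z hz => exists_iterate_logb_succ hz fun w hw => exists_iterate_logb_le_one_of_le m hw
    have h2 : ∀ z : ℝ, z ≤ (2 : ℝ) ^ ((2 : ℝ) ^ (m : ℝ)) →
        ∃ i ≤ m + 1 + 1, (Real.logb 2)^[i] z ≤ 1 := fun z hz => exists_iterate_logb_succ hz h1
    obtain ⟨i, hi, h3⟩ := exists_iterate_logb_succ (x := u) (y := (2 : ℝ) ^ ((2 : ℝ) ^ (m : ℝ)))
      (by
        have e1 : n ≤ 2 ^ Nat.size n := (Nat.lt_size_self n).le
        have e2 : Nat.size n ≤ 2 ^ m := (Nat.lt_size_self _).le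
        have e3 : u ≤ 2 ^ 2 ^ 2 ^ m := h.trans (Nat.pow_le_pow_right (by norm_num)
          (e1.trans (Nat.pow_le_pow_right (by norm_num) e2)))
        have e4 : ((u : ℕ) : ℝ) ≤ ((2 ^ 2 ^ 2 ^ m : ℕ) : ℝ) := by exact_mod_cast e3
        refine e4.trans (le_of_eq ?_)
        rw [Real.rpow_natCast, show ((2 : ℝ) ^ m) = ((2 ^ m : ℕ) : ℝ) by push_cast; rfl,
          Real.rpow_natCast, show ((2 : ℝ) ^ 2 ^ m) = ((2 ^ 2 ^ m : ℕ) : ℝ) by push_cast; rfl,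
          Real.rpow_natCast]
        push_cast
        rfl) h2
    exact ⟨i, by omega, h3⟩
  obtain ⟨i, hi, h1⟩ := key
  have hmem : i ∈ {i : ℕ | 1 ≤ i ∧ (Real.logb 2)^[i] (u : ℝ) ≤ 1} := by
    refine ⟨?_, h1⟩
    by_contra hc
    -- The definition of `lgStar` asks for `1 ≤ i`; the index 0 is impossible because `u ≥ 2`.
    have h0 : i = 0 := by omega
    rw [h0] at h1
    have : (2 : ℝ) ≤ u := by exact_mod_cast hu
    simp only [Function.iterate_zero, id] at h1
    linarith
  exact ⟨(Nat.sInf_mem ⟨i, hmem⟩).1, (Nat.sInf_le hmem).trans hi⟩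

/-- With `s = Nat.size V` the factors are at most `s + 4` and `s + 2`, while `V` is exponential in
`s`: `2 * (s + 4) * (s + 2) ≤ 25 * 2 ^ s ≤ 50 * V`. -/
theorem lgStar_mul_size_le {σ u n : ℕ} (hu : 2 ≤ u) (h : u ≤ 2 ^ n) :
    (lgStar u + 1) * Nat.size (2 * width σ n + 7) ≤ 25 * width σ n := by
  have h1 := (lgStar_le hu h).2
  have h2 := six_le_width σ n
  have h3 : Nat.size n ≤ width σ n := size_le_width (by unfold scale; omega)
  set V := width σ n
  have h4 : Nat.size (Nat.size n) ≤ Nat.size V := Nat.size_le_size h3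
  have h5 : Nat.size (2 * V + 7) ≤ Nat.size V + 2 := by
    rw [Nat.size_le, pow_add]
    have := Nat.lt_size_self V
    omega
  set s := Nat.size V with hs
  have h6 : 2 ^ s ≤ 2 * V := by
    have : 2 ^ (s - 1) ≤ V := Nat.lt_size.1 (by have := Nat.size_pos.2 (show 0 < V by omega); omega)
    have hs0 := Nat.size_pos.2 (show 0 < V by omega)
    obtain ⟨k, hk⟩ : ∃ k, s = k + 1 := ⟨s - 1, by omega⟩
    rw [hk, Nat.add_sub_cancel] at this
    rw [hk, pow_succ]; omega
  have h7 : ∀ s : ℕ, 2 * ((s + 4) * (s + 2)) ≤ 25 * 2 ^ s := by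
    intro s
    induction s with
    | zero => norm_num
    | succ s ih => rw [pow_succ]; nlinarith
  have h8 : (lgStar u + 1) * Nat.size (2 * V + 7) ≤ (s + 4) * (s + 2) :=
    Nat.mul_le_mul (by omega) h5
  have := h7 s
  omega

/-! # Estimates by logarithms -/

theorem size_le_logb {m : ℕ} (hm : 0 < m) : (Nat.size m : ℝ) ≤ Real.logb 2 m + 1 := by
  have h0 := Nat.size_pos.2 hm
  have h1 : 2 ^ (Nat.size m - 1) ≤ m := Nat.lt_size.1 (by omega)
  have h2 : ((Nat.size m - 1 : ℕ) : ℝ) ≤ Real.logb 2 m := by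
    rw [Real.le_logb_iff_rpow_le (by norm_num) (by exact_mod_cast hm), Real.rpow_natCast]
    exact_mod_cast h1
  rw [Nat.cast_sub (by omega)] at h2
  push_cast at h2
  linarith

theorem one_le_logb {x : ℕ} (hx : 2 ≤ x) : 1 ≤ Real.logb 2 x := by
  rw [Real.le_logb_iff_rpow_le (by norm_num) (by positivity), Real.rpow_one]
  exact_mod_cast hx

theorem width_le_logb {σ n x c : ℕ} (hx : 2 ≤ x) (h : scale σ n ≤ 2 ^ c * x) :
    (width σ n : ℝ) ≤ (c + 2) * Real.logb 2 x := by
  have hl := one_le_logb hx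
  have h0 : 0 < scale σ n := by unfold scale; omega
  have h1 := size_le_logb h0
  rw [size_scale] at h1
  have h2 : Real.logb 2 (scale σ n) ≤ c + Real.logb 2 x := by
    have : Real.logb 2 ((2 : ℝ) ^ c * x) = c + Real.logb 2 x := by
      rw [Real.logb_mul (by positivity) (by positivity), ← Real.rpow_natCast,
        Real.logb_rpow (by norm_num) (by norm_num)]
    rw [← this]
    refine Real.logb_le_logb_of_le (by norm_num) (by exact_mod_cast h0) ?_
    exact_mod_cast h
  have h3 : (c : ℝ) * 1 ≤ c * Real.logb 2 x := by gcongr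
  nlinarith

/-- The prime has at most `2 * (n + σ) + 1` bits because `N ≤ 2 ^ n`, and rounding `lg N` up costs
at most `n` bits in all. Both are absorbed by `(n + σ) lg (n + σ)`. -/
theorem bits_le {σ n N p b : ℕ} (hN : 2 ≤ N) (hσ : 1 ≤ σ) (hNn : N ≤ 2 ^ n) (hp : p ≤ (N + σ) ^ 2)
    (hb : b ≤ n * Nat.size N + 4 * Nat.size p + 300 * (scale σ n * width σ n)) :
    (b : ℝ) ≤ n * Real.logb 2 N + 100000 * ((n + σ) * Real.logb 2 (n + σ)) := by
  have hn : 1 ≤ n := by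
    by_contra hc
    have : n = 0 := by omega
    rw [this, pow_zero] at hNn
    omega
  have hx : 2 ≤ n + σ := by omega
  have hl := one_le_logb hx
  have h1 := size_le_logb (show 0 < N by omega)
  have h2 : Nat.size p ≤ 2 * (n + σ) + 1 := by
    rw [Nat.size_le]
    have e1 : N + σ ≤ 2 ^ (n + σ) := by
      have : σ + 1 ≤ 2 ^ σ := Nat.lt_two_pow_self
      have h3 : 2 ^ n * (σ + 1) ≤ 2 ^ n * 2 ^ σ := Nat.mul_le_mul_left _ this
      have h4 : 1 * σ ≤ 2 ^ n * σ := Nat.mul_le_mul_right _ Nat.one_le_two_pow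
      rw [pow_add]
      rw [mul_add] at h3
      omega
    calc p ≤ (N + σ) ^ 2 := hp
      _ ≤ (2 ^ (n + σ)) ^ 2 := by gcongr
      _ = 2 ^ (2 * (n + σ)) := by rw [← pow_mul, mul_comm]
      _ < 2 ^ (2 * (n + σ) + 1) := Nat.pow_lt_pow_right (by norm_num) (by omega)
  have h3 := width_le_logb (σ := σ) (n := n) (c := 5) hx (by unfold scale; omega)
  have h4 : ((scale σ n : ℕ) : ℝ) ≤ 32 * ((n + σ : ℕ) : ℝ) := by
    have : scale σ n ≤ 32 * (n + σ) := by unfold scale; omega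
    exact_mod_cast this
  have hb' : (b : ℝ) ≤ n * Nat.size N + 4 * Nat.size p + 300 * (scale σ n * width σ n) := by
    exact_mod_cast hb
  have h2' : (Nat.size p : ℝ) ≤ 2 * ((n + σ : ℕ) : ℝ) + 1 := by exact_mod_cast h2
  have hx' : (2 : ℝ) ≤ ((n + σ : ℕ) : ℝ) := by exact_mod_cast hx
  have hnx : (n : ℝ) ≤ ((n + σ : ℕ) : ℝ) := by exact_mod_cast Nat.le_add_right n σ
  rw [← Nat.cast_add]
  set x : ℝ := ((n + σ : ℕ) : ℝ)
  set l := Real.logb 2 x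
  have h5 : (n : ℝ) * Nat.size N ≤ n * Real.logb 2 N + n := by
    have : (n : ℝ) * Nat.size N ≤ n * (Real.logb 2 N + 1) := by gcongr
    linarith
  have h6 : ((scale σ n : ℕ) : ℝ) * width σ n ≤ 32 * x * ((((5 : ℕ) : ℝ) + 2) * l) := by gcongr
  have h7 : x * 1 ≤ x * l := by gcongr
  push_cast at h6
  nlinarith

theorem step_time_le {σ n x c K : ℕ} {α : ℝ} (hα : 0 < α) (hα1 : α ≤ 1) (hK : 1 ≤ K) (hx : 2 ≤ x)
    (h : scale σ n ≤ 2 ^ c * x) (hc : c ≤ 7) :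
    6 / α * (17 * (width σ n : ℝ) + 20) + (11 * width σ n + 2 * K + 30) ≤
      1200 * (1 / α * Real.logb 2 x * K) := by
  have hl := one_le_logb hx
  have hw := width_le_logb hx h
  have hc' : (c : ℝ) ≤ 7 := by exact_mod_cast hc
  set l := Real.logb 2 x
  have hw' : (width σ n : ℝ) ≤ 9 * l := hw.trans (by nlinarith)
  have hK' : (1 : ℝ) ≤ K := by exact_mod_cast hK
  have hi : 1 ≤ 1 / α := by rw [le_div_iff₀ hα]; linarith
  set i := 1 / α with hidef
  have e : 6 / α = 6 * i := by rw [hidef]; ring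
  have hil : i * l ≤ i * l * K := le_mul_of_one_le_right (by positivity) hK'
  have hl' : l ≤ i * l := le_mul_of_one_le_left (by linarith) hi
  have hKl : (K : ℝ) ≤ i * l * K := le_mul_of_one_le_left (by positivity) (by nlinarith)
  have h1 : i * (width σ n : ℝ) ≤ i * (9 * l) := by gcongr
  have h2 : i * 1 ≤ i * l := by gcongr
  rw [e]
  nlinarith

theorem par_small {p N : ℕ} (σ K : ℕ) (α : ℝ) (hN : N < p) (h : Fin p × Fin p × Fin p) :
    (par σ K α h).Small N :=
  ⟨hN, h.1.2.le, h.2.1.2.le, h.2.2.2.le⟩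

/-- The abstract state is chosen before the parameters `P`; so its number of variables is the same
for every hash function. -/
theorem exists_stateAfter {σ K : ℕ} (hK : 1 ≤ K) (s : List ℕ) (hs : ∀ c ∈ s, c < σ) :
    ∃ a : AState, a.Ready σ K s ∧ ∀ P : Par, P.Std σ K → Rel P a (stateAfter P s) := by
  obtain ⟨tr, a, h1, h2, -⟩ := (AState.Ready.init σ K).sim_read hK s hs (N := s.length) (by simp)
  exact ⟨a, h2, fun P hP => h1.rel P hP _ ⟨IndexOk.empty P hP.buckets.1, rfl, rfl, rfl, rfl, rfl⟩⟩

end Oesp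

/-! ### The theorem -/

theorem mainTheorem1 :
    ∃ C : ℝ, 0 < C ∧
      ∀ (σ : ℕ) (S : List (Fin σ)) (α : ℝ) (p : ℕ),
        2 ≤ S.length → 0 < α → α ≤ 1 →
        p.Prime → S.length + σ < p → p ≤ (S.length + σ) ^ 2 →
        ∃ (n : ℕ) (ν : ℕ → ℕ),
          -- at every time, ending the input makes the state the index of the string read so far
          (∀ (h : Fin p × Fin p × Fin p) (t : ℕ), 1 ≤ t → t ≤ S.length →
            Oesp.IsIndex (Oesp.par σ (Oesp.lgStar S.length) α h) ((S.map Fin.val).take t)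
              (Oesp.construct (Oesp.par σ (Oesp.lgStar S.length) α h)
                ((S.map Fin.val).take t)).val.I) ∧
          -- `n` and `ν t` are the numbers of variables at the end and after `t` symbols
          (∀ h : Fin p × Fin p × Fin p,
            (Oesp.construct (Oesp.par σ (Oesp.lgStar S.length) α h)
              (S.map Fin.val)).val.I.n = n) ∧
          (∀ (h : Fin p × Fin p × Fin p) (t : ℕ), t ≤ S.length →
            (Oesp.stateAfter (Oesp.par σ (Oesp.lgStar S.length) α h)
              ((S.map Fin.val).take t)).I.n = ν t) ∧
          -- size of the index
          (∀ h : Fin p × Fin p × Fin p,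
            ((Oesp.construct (Oesp.par σ (Oesp.lgStar S.length) α h)
              (S.map Fin.val)).val.I.size (Oesp.par σ (Oesp.lgStar S.length) α h) : ℝ) ≤
                n * Real.logb 2 S.length + C * ((n + σ) * Real.logb 2 (n + σ))) ∧
          -- working memory of the construction
          (∀ h : Fin p × Fin p × Fin p,
            ((Oesp.construct (Oesp.par σ (Oesp.lgStar S.length) α h)
              (S.map Fin.val)).peak : ℝ) ≤
                n * Real.logb 2 S.length + C * ((n + σ) * Real.logb 2 (n + σ))) ∧
          -- expected construction time
          Oesp.mean (fun h : Fin p × Fin p × Fin p =>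
            (Oesp.construct (Oesp.par σ (Oesp.lgStar S.length) α h) (S.map Fin.val)).time) ≤
              C * (1 / α * S.length * Real.logb 2 (n + σ) * Oesp.lgStar S.length) ∧
          -- expected time of the update for the next input symbol
          ∀ (t : ℕ) (ht : t < S.length), 2 ≤ ν t + σ →
            Oesp.mean (fun h : Fin p × Fin p × Fin p =>
              ((Oesp.stateAfter (Oesp.par σ (Oesp.lgStar S.length) α h)
                ((S.map Fin.val).take t)).update
                  (Oesp.par σ (Oesp.lgStar S.length) α h) (S[t] : ℕ)).time) ≤
              C * (1 / α * Real.logb 2 (ν t + σ) * Oesp.lgStar S.length) := by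
  -- The space needs `300 * 32 * 7` and some lower terms, the construction time `45 * 1200` and some
  -- lower terms.
  refine ⟨100000, by norm_num, ?_⟩
  intro σ S α p hN hα hα1 hp hSp hpS
  set s := S.map Fin.val with hsdef
  set K := Oesp.lgStar S.length with hKdef
  have hslen : s.length = S.length := by simp [hsdef]
  have hs : ∀ c ∈ s, c < σ := by
    intro c hc
    obtain ⟨x, -, rfl⟩ := List.mem_map.1 hc
    exact x.2
  have hσ : 1 ≤ σ := by
    obtain ⟨x, hx⟩ := List.exists_mem_of_length_pos (show 0 < S.length by omega)
    exact Nat.one_le_of_lt x.2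
  have hK : 1 ≤ K := (Oesp.lgStar_le hN Nat.lt_two_pow_self.le).1
  have hstd := fun h : Fin p × Fin p × Fin p => Oesp.par_std hp σ K hα hα1 h
  have hsmall := fun h : Fin p × Fin p × Fin p =>
    Oesp.par_small (N := s.length) σ K α (by omega) h
  have htake : ∀ t, ∀ c ∈ s.take t, c < σ := fun t c hc => hs c (List.mem_of_mem_take hc)
  have hne : s ≠ [] := List.ne_nil_of_length_pos (by omega)
  obtain ⟨tr, e, a, he, htr, hsd, hlen, hsound, hcon⟩ := Oesp.exists_sim_construct hK s hs hne
  choose A hA1 hA2 using fun t => Oesp.exists_stateAfter hK (s.take t) (htake t)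
  have hin : ∀ (tr : List Oesp.AState), (∀ b ∈ tr, b.Sound σ K s.length) →
      ∀ b ∈ tr, b.Inv σ K ∧ b.Shape ∧ b.D.length + σ < p := fun tr h b hb => by
    have := (h b hb).total
    exact ⟨(h b hb).inv, (h b hb).shape, by omega⟩
  have hn : 1 ≤ a.D.length := by
    by_contra hc
    have : a.D.length = 0 := by omega
    rw [this, pow_zero] at hlen
    omega
  have hKn := Oesp.lgStar_mul_size_le (σ := σ) hN (hslen ▸ hlen)
  rw [← hKdef] at hKn
  have hbits : ∀ (h : Fin p × Fin p × Fin p) (b : ℕ), b ≤ a.D.length * Nat.size s.length +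
      4 * Nat.size (Oesp.par σ K α h).p + 300 * (Oesp.scale σ a.D.length * Oesp.width σ a.D.length) →
      (b : ℝ) ≤ a.D.length * Real.logb 2 S.length +
        100000 * ((a.D.length + σ) * Real.logb 2 (a.D.length + σ)) := by
    intro h b hb
    rw [hslen] at hb
    exact Oesp.bits_le hN hσ (hslen ▸ hlen) hpS hb
  have hi : 1 ≤ 1 / α := by rw [le_div_iff₀ hα]; linarith
  have hK' : (1 : ℝ) ≤ K := by exact_mod_cast hK
  refine ⟨a.D.length, fun t => (A t).D.length, ?_, ?_, ?_, ?_, ?_, ?_, ?_⟩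
  · intro h t ht1 ht2
    -- A separate run for the prefix, still with the `K` of the whole string: correctness requires
    -- only `1 ≤ K`.
    obtain ⟨_, _, _, _, _, _, _, _, hc⟩ := Oesp.exists_sim_construct hK (s.take t) (htake t)
      (List.ne_nil_of_length_pos (by rw [List.length_take]; omega))
    obtain ⟨r, h1, h2, -⟩ := hc _ (hstd h)
    rw [h2]
    exact h1.isIndex
  · intro h
    obtain ⟨r, h1, h2, -⟩ := hcon _ (hstd h)
    rw [h2]
    exact h1.n
  · intro h t _
    exact (hA2 t _ (hstd h)).index.base.R_length
  · intro h
    obtain ⟨r, h1, h2, -⟩ := hcon _ (hstd h)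
    rw [h2]
    refine hbits h _ ((h1.fits.size_le (hstd h) (hsmall h) hsd.vars).trans ?_)
    gcongr
    norm_num
  · intro h
    obtain ⟨r, h1, -, -, h2⟩ := hcon _ (hstd h)
    refine hbits h _ ((h2 _ ?_).trans (max_le le_rfl ?_))
    · intro b hb c hc st hst
      obtain ⟨h3, h4⟩ := hsound b hb c hc
      exact h3.size_le (hstd h) (hsmall h) (hst.fits h3) hst.stack hst.queue hst.done hst.levels
        hst.task h4 hKn
    · rw [h1.peak]
      exact hsd.size_le (hstd h) (hsmall h) h1.fits h1.stack h1.queue h1.done h1.levels h1.task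
        le_rfl hKn
  · have hx : 2 ≤ a.D.length + σ := by omega
    have hl := Oesp.one_le_logb hx
    have hcost := Oesp.mean_cost_le hp σ K hα hα1 (Oesp.width σ a.D.length)
      (hin tr fun b hb => (hsound b hb b (.inl rfl)).1)
    have hstep := Oesp.step_time_le (σ := σ) (n := a.D.length) (c := 5) hα hα1 hK hx
      (by unfold Oesp.scale; omega) (by norm_num)
    have hw := Oesp.width_le_logb (σ := σ) (n := a.D.length) (c := 5) hx
      (by unfold Oesp.scale; omega)
    have htime := Oesp.mean_mono (p := p) (f := fun h =>
      (Oesp.construct (Oesp.par σ K α h) s).time) (g := fun h =>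
      (tr.map (Oesp.AState.cost (Oesp.par σ K α h) (Oesp.width σ a.D.length))).sum +
        (e + (20 * Oesp.width σ a.D.length + 20))) (fun h => by
      obtain ⟨r, h1, -, h2, -⟩ := hcon _ (hstd h)
      have := h1.time
      omega)
    rw [Oesp.mean_add, Oesp.mean_const hp.pos] at htime
    refine htime.trans ((add_le_add_left hcost _).trans ?_)
    rw [← Nat.cast_add]
    -- This uses `2 ≤ S.length` to absorb the additive constants.
    have htr' : (tr.length : ℝ) ≤ 45 * S.length := by
      have : tr.length ≤ 45 * S.length := by omega
      exact_mod_cast this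
    have he' : (e : ℝ) ≤ 20 * S.length := by
      have : e ≤ 20 * S.length := by omega
      exact_mod_cast this
    have hN' : (2 : ℝ) ≤ S.length := by exact_mod_cast hN
    push_cast at hw ⊢
    rw [← Nat.cast_add] at hw ⊢
    set l := Real.logb 2 ((a.D.length + σ : ℕ) : ℝ)
    set i := 1 / α
    have hilK : 1 ≤ i * l * K := by
      have : 1 ≤ i * l := by nlinarith
      nlinarith
    have hlilK : l ≤ i * l * K := by
      have : l ≤ i * l := le_mul_of_one_le_left (by linarith) hi
      exact this.trans (le_mul_of_one_le_right (by linarith) hK')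
    have h1 := mul_le_mul htr' hstep (by positivity) (by positivity)
    have h2 : (S.length : ℝ) * 1 ≤ S.length * (i * l * K) := by gcongr
    have h3 : 2 * (i * l * K) ≤ S.length * (i * l * K) := by gcongr
    rw [show i * (S.length : ℝ) * l * K = S.length * (i * l * K) by ring]
    linarith
  · intro t ht hν
    have hν : 2 ≤ (A t).D.length + σ := hν
    have hl := Oesp.one_le_logb hν
    have hmin : min t s.length = t := by omega
    obtain ⟨tr', a', h1, -, h3, h4⟩ := (hA1 t).sim_update hK (N := s.length) (c := (S[t] : ℕ))
      (S[t]).2 (by rw [List.length_take]; omega)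
    have hcost := Oesp.mean_cost_le hp σ K hα hα1 (Oesp.width σ ((A t).D.length + 16))
      (hin tr' fun b hb => (h1.sound b hb b (.inl rfl)).1)
    -- Each of the 16 steps creates at most one variable, so the width is taken for `ν + 16`
    -- variables. The scale is then `8ν + σ + 169`, at most `2 ^ 7 * (ν + σ)` because `ν + σ ≥ 2`.
    have hstep := Oesp.step_time_le (σ := σ) (n := (A t).D.length + 16) (c := 7) hα hα1 hK hν
      (by unfold Oesp.scale; omega) le_rfl
    have htime := Oesp.mean_mono (p := p) (f := fun h =>
      ((Oesp.stateAfter (Oesp.par σ K α h) (s.take t)).update (Oesp.par σ K α h) (S[t] : ℕ)).time)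
      (g := fun h =>
      (tr'.map (Oesp.AState.cost (Oesp.par σ K α h) (Oesp.width σ ((A t).D.length + 16)))).sum + 1)
      (fun h => h1.time _ (hstd h) _ (hA2 t _ (hstd h)) _ h4)
    rw [Oesp.mean_add, Oesp.mean_const hp.pos] at htime
    refine htime.trans ((add_le_add_left hcost _).trans ?_)
    rw [h3]
    push_cast at hstep ⊢
    rw [← Nat.cast_add] at hstep ⊢
    set l := Real.logb 2 (((A t).D.length + σ : ℕ) : ℝ)
    set i := 1 / α
    have hilK : 1 ≤ i * l * K := by
      have : 1 ≤ i * l := by nlinarith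
      nlinarith
    linarith
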